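/- Let $G=(V,E)$ be a finite simple graph and $M$ a matching in $G$. Edges in $M$ are *matched*, the others *unmatched*; a vertex is unmatched if no matched edge is incident at it. An *alternating path* is a simple path whose edges alternate between $M$ and $E\setminus M$; an *augmenting path* is an alternating path between two distinct unmatched vertices, and $l_m$ is the minimum length of an augmenting path ($\infty$ if there is none). Let $\mathrm{evenlevel}(v)$ ($\mathrm{oddlevel}(v)$) be the minimum length of an alternating path of even (odd) length from an unmatched vertex to $v$ ($\infty$ if none); $\mathrm{minlevel}(v)$ and $\mathrm{maxlevel}(v)$ are the smaller and the larger of the two, and the tenacity of $v$ is $t(v)=\mathrm{evenlevel}(v)+\mathrm{oddlevel}(v)$. The tenacity of an edge $uv$ is $\mathrm{evenlevel}(u)+\mathrm{evenlevel}(v)+1$ if it is unmatched and $\mathrm{oddlevel}(u)+\mathrm{oddlevel}(v)+1$ if it is matched. If $uv$ is the last edge of an alternating path of length $\mathrm{minlevel}(v)$ from an unmatched vertex to $v$, then $u$ is a *predecessor* of $v$ and $uv$ is a *prop*; an edge that is not a prop is a *bridge*. Consider the following algorithm. Initially unmatched vertices have minlevel $0$ and nothing else is assigned. All choices below are arbitrary.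 An assigned minlevel or maxlevel of $v$ counts as its evenlevel or oddlevel according to its parity; the tenacity of an edge is *known* when both levels entering its definition are assigned. For search levels $i=0,1,2,\dots$ the algorithm runs MIN and then MAX. *MIN.* For each vertex $u$ with an assigned level equal to $i$ and each unmatched (if $i$ is even) or matched (if $i$ is odd) edge $uv$ that has not been scanned before, scan $uv$: if $v$ has no assigned minlevel or has the assigned minlevel $i+1$, let the minlevel of $v$ be $i+1$, record $u$ as a predecessor of $v$, and declare $uv$ a prop; otherwise declare $uv$ a bridge and, if its tenacity $t$ is known, insert it in the list $Br(t)$. *MAX.* Process each edge $xy\in Br(2i+1)$ once. Let $\mathrm{bud}(v)$ be the bud of the petal containing $v$, or $v$ if $v$ is in no petal, and let $\mathrm{bud}^*(v)$ be the result of iterating $\mathrm{bud}$ until it is stationary. Let $r=\mathrm{bud}^*(x)$, $g=\mathrm{bud}^*(y)$. If $r=g$, do nothing. Otherwise run *double depth first search* (DDFS) from $r$ and $g$ on the directed graph $H$ with edges $(v,\mathrm{bud}^*(u))$, $u$ a recorded predecessor of $v$, the layer of a vertex being its minlevel (smaller is deeper). DDFS grows a red tree from $r$ and a green tree from $g$,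 with centers of activity $C_r$ (initially $r$) and $C_g$ (initially $g$); the roots are visited, and Barrier is $r$. As long as the centers have not met, $C_r$ moves if its layer is at least that of $C_g$, and otherwise $C_g$ moves; a move goes along an edge of $H$ to an unvisited vertex, which joins the tree, or to the other center. When the centers meet at a vertex $z$, the vertex is given to the green tree, and the red tree backtracks from $z$ and continues as a depth first search through unvisited vertices until it visits a vertex at least as deep as $z$, whereupon the coordinated search resumes. If instead it has backtracked to Barrier and has no edge left to an unvisited vertex there, $z$ is given to the red tree with $C_r=z$, Barrier becomes $z$, and the green tree backtracks from $z$ and searches likewise for a vertex at least as deep as $z$; if it finds one the coordinated search resumes, and if it has backtracked to its root $g$ and has no edge left there, DDFS ends with bottleneck $b=z$. If the centers are at distinct vertices of layer $0$, DDFS ends without a bottleneck; the assignment of levels is then over, and augmenting paths are to be extracted. If DDFS ends with bottleneck $b$, all visited vertices $w\ne b$ form a new petal with bud $b$, each of them is assigned the maxlevel $2i+1-\mathrm{minlevel}(w)$, and, for each of them whose minlevel is odd, every incident edge that has not been declared a prop and whose tenacity $t$ is now known is inserted in $Br(t)$. **Theorem.** In every execution of this algorithm: 1. Every vertex $v$ with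 $t(v)<l_m$ is, after finitely many steps, assigned its correct $\mathrm{minlevel}(v)$ and $\mathrm{maxlevel}(v)$, and these values are not changed afterwards. 2. For every $i\ge 0$ with $2i+1\le l_m$, the end of MIN at search level $i$ is reached after finitely many steps. At that point exactly the vertices with minlevel at most $i+1$ have an assigned minlevel, and it is correct (so MIN at search level $i$ assigns the minlevel $i+1$ to exactly the vertices that have it); the recorded predecessors and declared props are exactly the predecessors of, and the props that lead to, vertices of minlevel at most $i+1$; and $Br(2i+1)$ is the set of all bridges of tenacity $2i+1$. 3. For every $i\ge 0$ with $2i+1<l_m$, the end of MAX at search level $i$ is reached after finitely many steps. At that point exactly the vertices of tenacity at most $2i+1$ have an assigned maxlevel, and it is correct (so MAX at search level $i$ finds exactly the vertices of tenacity $2i+1$ and assigns them their maxlevels). -/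

import Mathlib

namespace MV

variable {V : Type*} {G : SimpleGraph V}

/-! ### Alternating paths, levels, tenacity, props and bridges

Throughout, the matching is a subgraph `M` of `G` with `M.IsMatching`. -/

/-- `v` has no incident matched edge. -/
def Unmatched (M : G.Subgraph) (v : V) : Prop := ∀ w, ¬ M.Adj v w

/-- A simple path whose edges are alternately in `M` and outside `M`. -/
def IsAlternatingPath (M : G.Subgraph) {u v : V} (p : G.Walk u v) : Prop :=
  p.IsPath ∧ p.edges.IsChain (fun e e' => (e ∈ M.edgeSet ↔ e' ∉ M.edgeSet))

/-- The length of a shortest augmenting path, `⊤` if there is none. (The endpoints of an augmenting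
path are distinct, which excludes the path of length `0` at an unmatched vertex.) -/
noncomputable def minAugLength (M : G.Subgraph) : ℕ∞ :=
  ⨅ (f : V) (f' : V) (p : G.Walk f f')
    (_ : Unmatched M f ∧ Unmatched M f' ∧ f ≠ f' ∧ IsAlternatingPath M p), (p.length : ℕ∞)

/-- Length of a shortest alternating path of even length from an unmatched vertex to `v`. -/
noncomputable def evenlevel (M : G.Subgraph) (v : V) : ℕ∞ :=
  ⨅ (f : V) (p : G.Walk f v)
    (_ : Unmatched M f ∧ IsAlternatingPath M p ∧ Even p.length), (p.length : ℕ∞)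

/-- Length of a shortest alternating path of odd length from an unmatched vertex to `v`. -/
noncomputable def oddlevel (M : G.Subgraph) (v : V) : ℕ∞ :=
  ⨅ (f : V) (p : G.Walk f v)
    (_ : Unmatched M f ∧ IsAlternatingPath M p ∧ Odd p.length), (p.length : ℕ∞)

noncomputable def minlevel (M : G.Subgraph) (v : V) : ℕ∞ := min (evenlevel M v) (oddlevel M v)

noncomputable def maxlevel (M : G.Subgraph) (v : V) : ℕ∞ := max (evenlevel M v) (oddlevel M v)

noncomputable def tenacity (M : G.Subgraph) (v : V) : ℕ∞ := evenlevel M v + oddlevel M v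

open Classical in
/-- Tenacity of the edge `uv`. -/
noncomputable def edgeTenacity (M : G.Subgraph) (u v : V) : ℕ∞ :=
  if M.Adj u v then oddlevel M u + oddlevel M v + 1 else evenlevel M u + evenlevel M v + 1

/-- `u` is a predecessor of `v`: `uv` is the last edge of some `minlevel(v)` path. -/
def IsPredecessor (M : G.Subgraph) (u v : V) : Prop :=
  ∃ (f : V) (p : G.Walk f v), Unmatched M f ∧ IsAlternatingPath M p ∧
    (p.length : ℕ∞) = minlevel M v ∧ ¬ p.Nil ∧ p.penultimate = u

def IsProp (M : G.Subgraph) (u v : V) : Prop := IsPredecessor M u v ∨ IsPredecessor M v u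

/-- An edge that is not a prop. -/
def IsBridge (M : G.Subgraph) (u v : V) : Prop := G.Adj u v ∧ ¬ IsProp M u v

/-! ### The data maintained by the algorithm during a phase -/

/-- The value `⊤` of `minLevel v` or `maxLevel v` means "not (yet) assigned". -/
structure Labels (V : Type*) where
  minLevel : V → ℕ∞
  maxLevel : V → ℕ∞
  /-- lists of predecessors -/
  preds : V → Set V
  scanned : Set (Sym2 V)
  /-- edges declared props -/
  props : Set (Sym2 V)
  /-- edges declared bridges -/
  bridges : Set (Sym2 V)
  /-- `br t` is the list of bridges of tenacity `t` -/
  br : ℕ → Set (Sym2 V)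
  /-- the bud of the petal containing `v`, and `v` itself if `v` is in no petal -/
  bud : V → V

open Classical in
noncomputable def initLabels (M : G.Subgraph) : Labels V where
  minLevel v := if Unmatched M v then 0 else ⊤
  maxLevel _ := ⊤
  preds _ := ∅
  scanned := ∅
  props := ∅
  bridges := ∅
  br _ := ∅
  bud v := v

namespace Labels

/-- `k` is one of the levels of `v` assigned so far; it is the evenlevel or the oddlevel of `v`
according to its parity. -/
def HasLevel (L : Labels V) (v : V) (k : ℕ) : Prop := L.minLevel v = k ∨ L.maxLevel v = k

/-- From the levels assigned so far, the tenacity of the edge `uv` is known, and equal to `t`. -/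
def KnownTenacity (L : Labels V) (M : G.Subgraph) (u v : V) (t : ℕ) : Prop :=
  ∃ j k : ℕ, L.HasLevel u j ∧ L.HasLevel v k ∧
    ((M.Adj u v ∧ Odd j ∧ Odd k) ∨ (¬ M.Adj u v ∧ Even j ∧ Even k)) ∧ t = j + k + 1

/-- `v` has been recognized as an inner vertex. -/
def Inner (L : Labels V) (v : V) : Prop := ∃ k : ℕ, Odd k ∧ L.minLevel v = k

/-- `L.BudStar v b` means `bud*(v) = b`. -/
inductive BudStar (L : Labels V) : V → V → Prop
  | self (v : V) : L.bud v = v → BudStar L v v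
  | next (v b : V) : L.bud v ≠ v → BudStar L (L.bud v) b → BudStar L v b

/-- The directed edges `(v, bud*(u))`, `u` a predecessor of `v`, of the layered graph `H`. The
layer of a vertex of `H` is its `minLevel`. -/
def HEdge (L : Labels V) (v w : V) : Prop := ∃ u ∈ L.preds v, L.BudStar u w

end Labels

/-! ### Double depth first search -/

inductive Colour
  | red
  | green

/-- `normal`: the two trees grow by the rule that keeps the centers of activity level.
`redSeeks`: the centers have met at the vertex `cG`, and `T_r` looks for another vertex at least as
deep. `greenSeeks`: `T_r` has failed, the meeting vertex `cR` has been given to `T_r`, and `T_g`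
looks for another vertex at least as deep. -/
inductive Mode
  | normal
  | redSeeks
  | greenSeeks

structure DDFS (V : Type*) where
  /-- `none` for an unvisited vertex -/
  colour : V → Option Colour
  parentR : V → Option V
  parentG : V → Option V
  /-- center of activity of `T_r` -/
  cR : V
  /-- center of activity of `T_g` -/
  cG : V
  /-- the root of `T_g` -/
  rootG : V
  barrier : V
  mode : Mode

namespace DDFS

open Classical in
/-- The start of a DDFS with the distinct roots `r` and `g`. -/
noncomputable def start (r g : V) : DDFS V where
  colour v := if v = r then some .red else if v = g then some .green else none
  parentR _ := none
  parentG _ := none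
  cR := r
  cG := g
  rootG := g
  barrier := r
  mode := .normal

/-- `T_r` cannot go on from its center of activity while it looks for an alternative to the meeting
vertex `cG`: it does not search from the meeting vertex itself, and elsewhere it is out of edges. -/
def RedStuck (L : Labels V) (D : DDFS V) : Prop :=
  D.cR = D.cG ∨ ∀ u, L.HEdge D.cR u → D.colour u ≠ none

/-- The same for `T_g`, with the meeting vertex `cR`. -/
def GreenStuck (L : Labels V) (D : DDFS V) : Prop :=
  D.cG = D.cR ∨ ∀ u, L.HEdge D.cG u → D.colour u ≠ none

open Classical in
/-- One step of DDFS, with the edge to be explored chosen arbitrarily. An explored edge leads to a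
visited vertex, and edges to visited vertices are passed over (unless the centers meet), so that
explored edges need no marks of their own. -/
inductive Step (L : Labels V) : DDFS V → DDFS V → Prop
  | redMove (D : DDFS V) (u : V) (hm : D.mode = .normal)
      (hl : L.minLevel D.cG ≤ L.minLevel D.cR) (he : L.HEdge D.cR u) (hu : D.colour u = none) :
      Step L D { D with
        colour := Function.update D.colour u (some .red)
        parentR := Function.update D.parentR u (some D.cR)
        cR := u }
  | greenMove (D : DDFS V) (u : V) (hm : D.mode = .normal)
      (hl : L.minLevel D.cR < L.minLevel D.cG) (he : L.HEdge D.cG u) (hu : D.colour u = none) :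
      Step L D { D with
        colour := Function.update D.colour u (some .green)
        parentG := Function.update D.parentG u (some D.cG)
        cG := u }
  /- The centers meet; the meeting vertex is first given to `T_g`. -/
  | redMeets (D : DDFS V) (hm : D.mode = .normal)
      (hl : L.minLevel D.cG ≤ L.minLevel D.cR) (he : L.HEdge D.cR D.cG) :
      Step L D { D with
        colour := Function.update D.colour D.cG (some .green)
        parentR := Function.update D.parentR D.cG (some D.cR)
        cR := D.cG
        mode := .redSeeks }
  | greenMeets (D : DDFS V) (hm : D.mode = .normal)
      (hl : L.minLevel D.cR < L.minLevel D.cG) (he : L.HEdge D.cG D.cR) :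
      Step L D { D with
        colour := Function.update D.colour D.cR (some .green)
        parentG := Function.update D.parentG D.cR (some D.cG)
        cG := D.cR
        mode := .redSeeks }
  | redSeek (D : DDFS V) (u : V) (hm : D.mode = .redSeeks) (hc : D.cR ≠ D.cG)
      (he : L.HEdge D.cR u) (hu : D.colour u = none) :
      Step L D { D with
        colour := Function.update D.colour u (some .red)
        parentR := Function.update D.parentR u (some D.cR)
        cR := u
        mode := if L.minLevel u ≤ L.minLevel D.cG then .normal else .redSeeks }
  | redBacktrack (D : DDFS V) (x : V) (hm : D.mode = .redSeeks) (hs : D.RedStuck L)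
      (hb : D.cR ≠ D.barrier) (hx : D.parentR D.cR = some x) :
      Step L D { D with cR := x }
  /- `T_r` has backtracked to its barrier: the meeting vertex goes to `T_r`. -/
  | redFail (D : DDFS V) (hm : D.mode = .redSeeks) (hs : D.RedStuck L)
      (hb : D.cR = D.barrier) :
      Step L D { D with
        colour := Function.update D.colour D.cG (some .red)
        cR := D.cG
        barrier := D.cG
        mode := .greenSeeks }
  | greenSeek (D : DDFS V) (u : V) (hm : D.mode = .greenSeeks) (hc : D.cG ≠ D.cR)
      (he : L.HEdge D.cG u) (hu : D.colour u = none) :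
      Step L D { D with
        colour := Function.update D.colour u (some .green)
        parentG := Function.update D.parentG u (some D.cG)
        cG := u
        mode := if L.minLevel u ≤ L.minLevel D.cR then .normal else .greenSeeks }
  | greenBacktrack (D : DDFS V) (x : V) (hm : D.mode = .greenSeeks) (hs : D.GreenStuck L)
      (hb : D.cG ≠ D.rootG) (hx : D.parentG D.cG = some x) :
      Step L D { D with cG := x }

/-- DDFS ends with the highest bottleneck `b`: both trees have failed to find a vertex other than
the meeting vertex `b` at least as deep. -/
def EndsAt (L : Labels V) (D : DDFS V) (b : V) : Prop :=
  D.mode = .greenSeeks ∧ D.GreenStuck L ∧ D.cG = D.rootG ∧ b = D.cR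

/-- DDFS ends without a bottleneck: the centers are at distinct vertices of the lowest layer. -/
def EndsDisjoint (L : Labels V) (D : DDFS V) : Prop :=
  D.mode = .normal ∧ D.cR ≠ D.cG ∧ L.minLevel D.cR = 0 ∧ L.minLevel D.cG = 0

/-- The vertices other than the bottleneck `b` found by the search. -/
def found (D : DDFS V) (b : V) : Set V := {w | D.colour w ≠ none ∧ w ≠ b}

end DDFS

/-! ### The procedures MIN and MAX -/

/-- What MIN has to scan at search level `i`: pairs `(u, v)` such that `i` is a level of `u` and `uv`
is an edge that is unmatched if `i` is even and matched if `i` is odd. -/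
def minQueue (M : G.Subgraph) (i : ℕ) (L : Labels V) : Set (V × V) :=
  {d | L.HasLevel d.1 i ∧ G.Adj d.1 d.2 ∧ (M.Adj d.1 d.2 ↔ Odd i)}

open Classical in
/-- MIN, at search level `i`, searches from `u` along the edge `uv`. -/
noncomputable def scan (M : G.Subgraph) (i : ℕ) (u v : V) (L : Labels V) : Labels V :=
  if s(u, v) ∈ L.scanned then L
  else if (i + 1 : ℕ∞) ≤ L.minLevel v then
    { L with
      minLevel := Function.update L.minLevel v (i + 1)
      preds := Function.update L.preds v (insert u (L.preds v))
      scanned := insert s(u, v) L.scanned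
      props := insert s(u, v) L.props }
  else
    { L with
      scanned := insert s(u, v) L.scanned
      bridges := insert s(u, v) L.bridges
      br := fun t => L.br t ∪ {e | e = s(u, v) ∧ L.KnownTenacity M u v t} }

open Classical in
/-- The vertices of `P` get their maxlevels at search level `i` and form a petal with bud `b`. -/
noncomputable def assignPetal (i : ℕ) (P : Set V) (b : V) (L : Labels V) : Labels V :=
  { L with
    maxLevel := fun w => if w ∈ P then (2 * i + 1 : ℕ∞) - L.minLevel w else L.maxLevel w
    bud := fun w => if w ∈ P then b else L.bud w }

/-- Insert into the lists `br` all edges of known tenacity that are not props and are incident at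
an inner vertex of `P`. -/
def insertBridges (M : G.Subgraph) (P : Set V) (L : Labels V) : Labels V :=
  { L with
    br := fun t => L.br t ∪ {e | ∃ v w, e = s(v, w) ∧ v ∈ P ∧ L.Inner v ∧ G.Adj v w ∧
      e ∉ L.props ∧ L.KnownTenacity M v w t} }

/-! ### The algorithm for a phase as a transition system -/

/-- Control: `min todo` is MIN with the pairs `todo` still to be scanned; `max done` is MAX, between
two calls of DDFS, with the bridges in `done` already processed; `ddfs done D` is MAX in the course of
a call of DDFS; `augment` means that DDFS has found two disjoint paths to unmatched vertices, so that
the assignment of levels is over and augmenting paths are to be extracted. -/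
inductive Control (V : Type*)
  | min (todo : Set (V × V))
  | max (done : Set (Sym2 V))
  | ddfs (done : Set (Sym2 V)) (D : DDFS V)
  | augment

structure State (V : Type*) where
  /-- the search level -/
  level : ℕ
  labels : Labels V
  control : Control V

/-- Start of the phase. -/
noncomputable def init (M : G.Subgraph) : State V :=
  ⟨0, initLabels M, .min (minQueue M 0 (initLabels M))⟩

/-- One step of the algorithm. The pairs to be scanned by MIN, the bridges to be processed by MAX,
the endpoint of a bridge that is called red, and the edges explored by DDFS are chosen
arbitrarily. -/
inductive Step (M : G.Subgraph) : State V → State V → Prop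
  | scan (i : ℕ) (L : Labels V) (todo : Set (V × V)) (u v : V) (h : (u, v) ∈ todo) :
      Step M ⟨i, L, .min todo⟩ ⟨i, scan M i u v L, .min (todo \ {(u, v)})⟩
  | startMax (i : ℕ) (L : Labels V) : Step M ⟨i, L, .min ∅⟩ ⟨i, L, .max ∅⟩
  /- Both endpoints of the bridge have the same `bud*`: DDFS aborts. -/
  | abortDDFS (i : ℕ) (L : Labels V) (done : Set (Sym2 V)) (x y b : V)
      (h : s(x, y) ∈ L.br (2 * i + 1)) (hd : s(x, y) ∉ done)
      (hx : L.BudStar x b) (hy : L.BudStar y b) :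
      Step M ⟨i, L, .max done⟩ ⟨i, L, .max (insert s(x, y) done)⟩
  | startDDFS (i : ℕ) (L : Labels V) (done : Set (Sym2 V)) (x y r g : V)
      (h : s(x, y) ∈ L.br (2 * i + 1)) (hd : s(x, y) ∉ done)
      (hx : L.BudStar x r) (hy : L.BudStar y g) (hrg : r ≠ g) :
      Step M ⟨i, L, .max done⟩ ⟨i, L, .ddfs (insert s(x, y) done) (DDFS.start r g)⟩
  | stepDDFS (i : ℕ) (L : Labels V) (done : Set (Sym2 V)) (D D' : DDFS V) (h : D.Step L D') :
      Step M ⟨i, L, .ddfs done D⟩ ⟨i, L, .ddfs done D'⟩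
  | endDDFS (i : ℕ) (L : Labels V) (done : Set (Sym2 V)) (D : DDFS V) (b : V)
      (h : D.EndsAt L b) :
      Step M ⟨i, L, .ddfs done D⟩
        ⟨i, insertBridges M (D.found b) (assignPetal i (D.found b) b L), .max done⟩
  | foundPaths (i : ℕ) (L : Labels V) (done : Set (Sym2 V)) (D : DDFS V)
      (h : D.EndsDisjoint L) :
      Step M ⟨i, L, .ddfs done D⟩ ⟨i, L, .augment⟩
  | nextLevel (i : ℕ) (L : Labels V) (done : Set (Sym2 V)) (h : L.br (2 * i + 1) ⊆ done) :
      Step M ⟨i, L, .max done⟩ ⟨i + 1, L, .min (minQueue M (i + 1) L)⟩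

/-- `s` occurs in some execution of the phase. -/
def Reachable (M : G.Subgraph) (s : State V) : Prop := Relation.ReflTransGen (Step M) (init M) s

/-- Every execution from `s` arrives, after finitely many steps and without getting stuck before, at
a state satisfying `P`. -/
inductive Inevitably (M : G.Subgraph) (P : State V → Prop) : State V → Prop
  | now (s : State V) : P s → Inevitably M P s
  | later (s : State V) : (∃ s', Step M s s') → (∀ s', Step M s s' → Inevitably M P s') →
      Inevitably M P s

/-- End of MIN at search level `i`. -/
def EndOfMin (i : ℕ) (s : State V) : Prop := s.level = i ∧ s.control = .min ∅

/-- End of MAX at search level `i`. -/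
def EndOfMax (i : ℕ) (s : State V) : Prop :=
  s.level = i ∧ ∃ done, s.control = .max done ∧ s.labels.br (2 * i + 1) ⊆ done

/-! ### What is achieved at search level `i` -/

open Classical in
/-- Exactly the vertices with minlevel at most `i + 1` have an assigned minlevel, which is the correct
one; the predecessors recorded and the edges declared props are exactly those that give a
minlevel of at most `i + 1`. -/
def MinCorrect (M : G.Subgraph) (i : ℕ) (L : Labels V) : Prop :=
  (∀ v, L.minLevel v = if minlevel M v ≤ (i + 1 : ℕ∞) then minlevel M v else ⊤) ∧
  (∀ u v, u ∈ L.preds v ↔ IsPredecessor M u v ∧ minlevel M v ≤ (i + 1 : ℕ∞)) ∧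
  (∀ u v, s(u, v) ∈ L.props ↔
    (IsPredecessor M u v ∧ minlevel M v ≤ (i + 1 : ℕ∞)) ∨
    (IsPredecessor M v u ∧ minlevel M u ≤ (i + 1 : ℕ∞)))

/-- The list `br (2 i + 1)` consists of all bridges of tenacity `2 i + 1`. -/
def BridgesCollected (M : G.Subgraph) (i : ℕ) (L : Labels V) : Prop :=
  ∀ u v, s(u, v) ∈ L.br (2 * i + 1) ↔ IsBridge M u v ∧ edgeTenacity M u v = (2 * i + 1 : ℕ∞)

open Classical in
/-- Exactly the vertices of tenacity at most `2 i + 1` have an assigned maxlevel, which is the correct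
one. -/
def MaxCorrect (M : G.Subgraph) (i : ℕ) (L : Labels V) : Prop :=
  ∀ v, L.maxLevel v = if tenacity M v ≤ (2 * i + 1 : ℕ∞) then maxlevel M v else ⊤

end MV

namespace MV

variable {V : Type*} {G : SimpleGraph V} {M : G.Subgraph}

/-! ### Alternating paths with recorded vertex sets -/

/-! The proof is an induction along the execution: `Inv` says what is true of the labels in each
control state, and `Inv.step` that every step preserves it. That assigned levels are correct and
that none is missing have different reasons.

Correctness of what is found. DDFS works on a graph in which every blossom is contracted to its
base. A visited vertex `w` carries an alternating path from `w` up to the end of the bridge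
belonging to its colour, running through blossoms whose bases have that colour and lie no deeper
than `w` (`DInv`). Paths of different colours are therefore disjoint. Two centers at layer 0 yield
an augmenting path of length `2 i + 1`, which is excluded below `l_m`. If the search ends with a
bottleneck `b`, a path from `b` up to one end of the bridge, across it and down the other tree
reaches each found vertex `w` at level `2 i + 1 - minlevel w` (`EndInv.max_path`). Nothing shorter
of that parity exists: tenacities are odd, and all vertices of smaller tenacity are in blossoms
already. `EndInv.maxInv` shows that the enlarged blossom has the required structure again.

Completeness is linear programming duality (`Cert.of_sound`). The partitions into blossoms at the
search levels `0, ..., i` are nested; together with a value `E v` for each vertex, essentially its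
evenlevel as far as it is known, they form a feasible dual solution. Summing the constraints along
an alternating path (`AltPath.potential`) bounds its length from below, and for a vertex outside all
blossoms this forces tenacity at least `2 i + 3`. Feasibility only needs that the bridges of
tenacity `2 i + 1` have been processed and that blossoms are closed under mates and predecessors.

It remains to see that a bridge is in its list in time. If the two levels entering its tenacity
differ, the end with the larger one has a still smaller minlevel of the other parity
(`IsBridge.later_end`), hence smaller tenacity than the bridge, and lies in a blossom already. If
they agree, MIN scans the bridge at the search level equal to both. `MinInv` and `MaxState` carry
this bookkeeping. Termination rests on finiteness and, for DDFS, on a lexicographic measure. -/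

/-- `AltPath M a l v k S`: there is a simple path from `a` to `v` with vertex set `S`, whose vertices
are numbered consecutively from `l` to `k`, and an edge leaving the vertex with number `j` is matched
if and only if `j` is odd. -/
inductive AltPath (M : G.Subgraph) (a : V) (l : ℕ) : V → ℕ → Set V → Prop
  | nil : AltPath M a l a l {a}
  | snoc {u v : V} {k : ℕ} {S : Set V} (h : AltPath M a l u k S) (hadj : G.Adj u v)
      (hpar : M.Adj u v ↔ k % 2 = 1) (hv : v ∉ S) : AltPath M a l v (k + 1) (insert v S)

namespace AltPath

variable {a u v w : V} {l k m : ℕ} {S S' : Set V}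

theorem start_mem (h : AltPath M a l v k S) : a ∈ S := by
  induction h with
  | nil => rfl
  | snoc _ _ _ _ ih => exact Set.mem_insert_of_mem _ ih

theorem end_mem (h : AltPath M a l v k S) : v ∈ S := by
  cases h with
  | nil => rfl
  | snoc => exact Set.mem_insert _ _

theorem le (h : AltPath M a l v k S) : l ≤ k := by
  induction h with
  | nil => rfl
  | snoc _ _ _ _ ih => omega

theorem eq_of_level_eq (h : AltPath M a l v l S) : v = a := by
  generalize hk : l = k at h
  cases h with
  | nil => rfl
  | snoc h => subst hk; have := h.le; omega

theorem level_eq_of_eq (h : AltPath M a l a k S) : k = l := by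
  cases h with
  | nil => rfl
  | snoc h _ _ hv => exact absurd h.start_mem hv

theorem exists_initial_path (h : AltPath M a l v k S) {s : V} (hs : s ∈ S) :
    ∃ j S', AltPath M a l s j S' ∧ j ≤ k ∧ (s ≠ v → j < k) := by
  induction h with
  | nil => cases hs; exact ⟨_, _, .nil, le_rfl, fun h => absurd rfl h⟩
  | @snoc u v k S h hadj hpar hv ih =>
    rcases hs with rfl | hs
    · exact ⟨_, _, h.snoc hadj hpar hv, le_rfl, fun h => absurd rfl h⟩
    · obtain ⟨j, S', hj, hjk, -⟩ := ih hs
      exact ⟨j, S', hj, by omega, fun _ => by omega⟩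

theorem append (h : AltPath M a l u k S) (hadj : G.Adj u v) (hpar : M.Adj u v ↔ k % 2 = 1)
    (h' : AltPath M v (k + 1) w m S') (hd : ∀ s ∈ S, s ∉ S') :
    AltPath M a l w m (S ∪ S') := by
  induction h' with
  | nil =>
    rw [Set.union_singleton]
    exact h.snoc hadj hpar fun hv => hd _ hv rfl
  | @snoc u' v' k' S'' h' hadj' hpar' hv' ih =>
    rw [Set.union_insert]
    refine (ih fun s hs hs' => hd s hs (Set.mem_insert_of_mem _ hs')).snoc hadj' hpar' ?_
    rintro (hs | hs)
    · exact hd _ hs (Set.mem_insert _ _)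
    · exact hv' hs

theorem trans (h : AltPath M a l u k S) (h' : AltPath M u k w m S')
    (hd : ∀ s ∈ S, s ∈ S' → s = u) : AltPath M a l w m (S ∪ S') := by
  induction h' with
  | nil =>
    rwa [Set.union_singleton, Set.insert_eq_of_mem h.end_mem]
  | @snoc u' v' k' S'' h' hadj' hpar' hv' ih =>
    rw [Set.union_insert]
    refine (ih fun s hs hs' => hd s hs (Set.mem_insert_of_mem _ hs')).snoc hadj' hpar' ?_
    rintro (hs | hs)
    · have := hd _ hs (Set.mem_insert _ _)
      exact hv' (this ▸ h'.start_mem)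
    · exact hv' hs

/-- The last edge leaves number `k - 1` before the reversal and number `n` after it; these have the
same parity exactly when `n + k` is odd. -/
theorem reverse (h : AltPath M a l v k S) {n : ℕ} (hn : (n + k) % 2 = 1) :
    AltPath M v n a (n + (k - l)) S := by
  induction h generalizing n with
  | nil => simpa using AltPath.nil
  | @snoc u v k S h hadj hpar hv ih =>
    have hle := h.le
    have h1 : AltPath M v n v n {v} := .nil
    have h2 := h1.append hadj.symm (by rw [M.adj_comm, hpar]; omega) (ih (n := n + 1) (by omega))
      (by rintro s rfl; exact hv)
    rw [show n + (k + 1 - l) = n + 1 + (k - l) by omega, Set.insert_eq]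
    exact h2

/-- At an odd starting number the first edge is matched, so two such paths from the same vertex
share their second vertex. This is how odd bottlenecks are excluded. -/
theorem exists_second (h : AltPath M a l v k S) (hne : a ≠ v) :
    ∃ c ∈ S, G.Adj a c ∧ (M.Adj a c ↔ l % 2 = 1) := by
  induction h with
  | nil => exact absurd rfl hne
  | @snoc u v k S h hadj hpar hv ih =>
    by_cases hu : a = u
    · subst hu
      obtain rfl := h.level_eq_of_eq
      exact ⟨v, Set.mem_insert _ _, hadj, hpar⟩
    · obtain ⟨c, hc, h1, h2⟩ := ih hu
      exact ⟨c, Set.mem_insert_of_mem _ hc, h1, h2⟩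

/-- The vertices of an alternating path from an unmatched vertex are matched among themselves,
except that the last one is not if the last edge is unmatched. -/
theorem mate_mem (hM : M.IsMatching) {f : V} (hf : Unmatched M f)
    (h : AltPath M f 0 v k S) {s c : V} (hs : s ∈ S) (hsv : s ≠ v ∨ k % 2 = 0)
    (hsc : M.Adj s c) : c ∈ S ∧ (c ≠ v ∨ k % 2 = 0) := by
  induction h generalizing s c with
  | nil => cases hs; exact absurd hsc (hf c)
  | @snoc u v k S h hadj hpar hv ih =>
    rcases Nat.mod_two_eq_zero_or_one k with hk | hk
    · have hsS : s ∈ S := by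
        rcases hs with rfl | hs
        · exact hsv.elim (absurd rfl) (by omega)
        · exact hs
      obtain ⟨h1, -⟩ := ih hsS (Or.inr hk) hsc
      refine ⟨Set.mem_insert_of_mem _ h1, Or.inl ?_⟩
      rintro rfl; exact hv h1
    · refine ⟨?_, Or.inr (by omega)⟩
      have huv := hpar.2 hk
      rcases hs with rfl | hs
      · obtain rfl := hM.eq_of_adj_left huv.symm hsc
        exact Set.mem_insert_of_mem _ h.end_mem
      · by_cases hsu : s = u
        · subst hsu
          obtain rfl := hM.eq_of_adj_left huv hsc
          exact Set.mem_insert _ _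
        · exact Set.mem_insert_of_mem _ (ih hs (Or.inl hsu) hsc).1

theorem exists_walk (h : AltPath M a l v k S) :
    ∃ p : G.Walk a v, p.IsPath ∧ l + p.length = k ∧ (∀ x, x ∈ p.support ↔ x ∈ S) ∧
      p.edges.IsChain (fun e e' => (e ∈ M.edgeSet ↔ e' ∉ M.edgeSet)) ∧
      ∀ e ∈ p.edges.getLast?, (e ∈ M.edgeSet ↔ k % 2 = 0) := by
  induction h with
  | nil => exact ⟨.nil, by simp, by simp, by simp, by simp, by simp⟩
  | @snoc u v k S h hadj hpar hv ih =>
    obtain ⟨p, h1, h2, h3, h4, h5⟩ := ih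
    refine ⟨p.concat hadj, h1.concat (by rwa [h3]) hadj, ?_, ?_, ?_, ?_⟩
    · rw [SimpleGraph.Walk.length_concat]; omega
    · intro x
      rw [SimpleGraph.Walk.support_concat]
      simp [h3, or_comm]
    · rw [SimpleGraph.Walk.edges_concat, List.concat_eq_append, List.isChain_append]
      refine ⟨h4, by simp, ?_⟩
      intro e he e' he'
      simp only [List.head?_cons, Option.mem_def, Option.some.injEq] at he'
      subst he'
      rw [h5 e he, SimpleGraph.Subgraph.mem_edgeSet, hpar]
      omega
    · intro e he
      rw [SimpleGraph.Walk.edges_concat, List.concat_eq_append] at he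
      simp only [List.getLast?_append, List.getLast?_singleton, Option.some_or, Option.mem_def,
        Option.some.injEq] at he
      subst he
      rw [SimpleGraph.Subgraph.mem_edgeSet, hpar]; omega

theorem of_walk (p : G.Walk a v) (hp : p.IsPath)
    (hc : p.edges.IsChain (fun e e' => (e ∈ M.edgeSet ↔ e' ∉ M.edgeSet)))
    (hl : ∀ e ∈ p.edges.head?, (e ∈ M.edgeSet ↔ l % 2 = 1)) :
    AltPath M a l v (l + p.length) {x | x ∈ p.support} := by
  induction p generalizing l with
  | nil => simpa using AltPath.nil
  | @cons a b v hab p ih =>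
    rw [SimpleGraph.Walk.cons_isPath_iff] at hp
    rw [SimpleGraph.Walk.edges_cons] at hc hl
    have hl' : M.Adj a b ↔ l % 2 = 1 := by
      have := hl s(a, b) (by simp)
      rwa [SimpleGraph.Subgraph.mem_edgeSet] at this
    have h1 : AltPath M a l a l {a} := .nil
    rw [List.isChain_cons] at hc
    have h2 := ih hp.1 hc.2 (l := l + 1) (fun e he => by
      have := hc.1 e he
      rw [SimpleGraph.Subgraph.mem_edgeSet, hl'] at this
      by_cases h : e ∈ M.edgeSet
      · simp only [h, not_true_eq_false, iff_false] at this
        simp only [h, true_iff]; omega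
      · simp only [h, not_false_eq_true, iff_true] at this
        simp only [h, false_iff]; omega)
    have h3 := h1.append hab hl' h2 (by rintro s rfl; exact hp.2)
    rw [SimpleGraph.Walk.length_cons, show l + (p.length + 1) = l + 1 + p.length by omega]
    convert h3 using 1
    ext x; simp

theorem isAlternatingPath_concat (h : AltPath M a l u k S) (hadj : G.Adj u v)
    (hpar : M.Adj u v ↔ k % 2 = 1) (hv : v ∉ S) :
    ∃ p : G.Walk a v, IsAlternatingPath M p ∧ l + p.length = k + 1 ∧ ¬ p.Nil ∧
      p.penultimate = u := by
  obtain ⟨p, h1, h2, h3, h4, h5⟩ := h.exists_walk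
  refine ⟨p.concat hadj, ⟨h1.concat (by rwa [h3]) hadj, ?_⟩, ?_, ?_, by simp⟩
  · rw [SimpleGraph.Walk.edges_concat, List.concat_eq_append, List.isChain_append]
    refine ⟨h4, by simp, ?_⟩
    intro e he e' he'
    simp only [List.head?_cons, Option.mem_def, Option.some.injEq] at he'
    subst he'
    rw [h5 e he, SimpleGraph.Subgraph.mem_edgeSet, hpar]
    omega
  · rw [SimpleGraph.Walk.length_concat]; omega
  · rw [SimpleGraph.Walk.not_nil_iff_lt_length, SimpleGraph.Walk.length_concat]; omega

end AltPath

theorem IsAlternatingPath.altPath {f v : V} {p : G.Walk f v} (hp : IsAlternatingPath M p)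
    (hf : Unmatched M f) : AltPath M f 0 v p.length {x | x ∈ p.support} := by
  have := AltPath.of_walk (l := 0) p hp.1 hp.2 (by
    cases p with
    | nil => simp
    | @cons _ b _ h p =>
      intro e he
      simp only [SimpleGraph.Walk.edges_cons, List.head?_cons, Option.mem_def,
        Option.some.injEq] at he
      subst he
      simp only [SimpleGraph.Subgraph.mem_edgeSet]
      simp [hf b])
  simpa using this

/-! ### Levels as natural numbers -/

/-- There is an alternating path of length `k` from an unmatched vertex to `v`. -/
def Reach (M : G.Subgraph) (v : V) (k : ℕ) : Prop :=
  ∃ f S, Unmatched M f ∧ AltPath M f 0 v k S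

/-- `k` is the evenlevel or the oddlevel of `v`, according to its parity. -/
def IsLevel (M : G.Subgraph) (v : V) (k : ℕ) : Prop :=
  Reach M v k ∧ ∀ j, Reach M v j → j % 2 = k % 2 → k ≤ j

/-- `m` is the minlevel of `v`. -/
def IsMin (M : G.Subgraph) (v : V) (m : ℕ) : Prop :=
  Reach M v m ∧ ∀ j, Reach M v j → m ≤ j

/-- `t` is the tenacity of `v`. -/
def Ten (M : G.Subgraph) (v : V) (t : ℕ) : Prop :=
  ∃ a b, IsLevel M v a ∧ IsLevel M v b ∧ a % 2 ≠ b % 2 ∧ a + b = t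

/-- `t` is the tenacity of the edge `uv`. -/
def ETen (M : G.Subgraph) (u v : V) (t : ℕ) : Prop :=
  ∃ a b, IsLevel M u a ∧ IsLevel M v b ∧ (M.Adj u v ↔ a % 2 = 1) ∧ (M.Adj u v ↔ b % 2 = 1) ∧
    a + b + 1 = t

section Levels

variable {u v : V} {a b k m n t : ℕ}

theorem Unmatched.reach_zero (h : Unmatched M v) : Reach M v 0 := ⟨v, _, h, .nil⟩

theorem Reach.unmatched (h : Reach M v 0) : Unmatched M v := by
  obtain ⟨f, S, hf, hp⟩ := h
  rwa [hp.eq_of_level_eq]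

theorem Reach.exists_isMin (h : Reach M v k) : ∃ m, IsMin M v m ∧ m ≤ k := by
  classical
  have hex : ∃ k, Reach M v k := ⟨k, h⟩
  exact ⟨Nat.find hex, ⟨Nat.find_spec hex, fun j hj => Nat.find_min' hex hj⟩, Nat.find_min' hex h⟩

theorem Reach.exists_isLevel (h : Reach M v k) : ∃ m, IsLevel M v m ∧ m % 2 = k % 2 ∧ m ≤ k := by
  classical
  have hex : ∃ m, Reach M v m ∧ m % 2 = k % 2 := ⟨k, h, rfl⟩
  refine ⟨Nat.find hex, ⟨(Nat.find_spec hex).1, fun j hj hjk => Nat.find_min' hex ⟨hj, ?_⟩⟩,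
    (Nat.find_spec hex).2, Nat.find_min' hex ⟨h, rfl⟩⟩
  rw [hjk, (Nat.find_spec hex).2]

theorem IsMin.isLevel (h : IsMin M v m) : IsLevel M v m := ⟨h.1, fun j hj _ => h.2 j hj⟩

theorem IsMin.unique (h : IsMin M v m) (h' : IsMin M v n) : m = n :=
  le_antisymm (h.2 _ h'.1) (h'.2 _ h.1)

theorem IsLevel.unique (h : IsLevel M v a) (h' : IsLevel M v b) (hab : a % 2 = b % 2) : a = b :=
  le_antisymm (h.2 _ h'.1 hab.symm) (h'.2 _ h.1 hab)

theorem IsLevel.exists_isMin (h : IsLevel M v k) :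
    ∃ m, IsMin M v m ∧ (m = k ∨ m < k ∧ m % 2 ≠ k % 2 ∧ Ten M v (m + k)) := by
  obtain ⟨m, hm, hmk⟩ := h.1.exists_isMin
  refine ⟨m, hm, ?_⟩
  by_cases hp : m % 2 = k % 2
  · exact Or.inl (hm.isLevel.unique h hp)
  · exact Or.inr ⟨by omega, hp, m, k, hm.isLevel, h, hp, rfl⟩

theorem Ten.unique (h : Ten M v t) (h' : Ten M v n) : t = n := by
  obtain ⟨a, b, ha, hb, hab, rfl⟩ := h
  obtain ⟨c, d, hc, hd, hcd, rfl⟩ := h'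
  by_cases hac : a % 2 = c % 2
  · have := ha.unique hc hac
    have := hb.unique hd (by omega)
    omega
  · have := ha.unique hd (by omega)
    have := hb.unique hc (by omega)
    omega

theorem Ten.odd (h : Ten M v t) : t % 2 = 1 := by
  obtain ⟨a, b, -, -, hab, rfl⟩ := h
  omega

theorem ETen.symm (h : ETen M u v t) : ETen M v u t := by
  obtain ⟨a, b, ha, hb, h1, h2, rfl⟩ := h
  exact ⟨b, a, hb, ha, by rw [M.adj_comm, h2], by rw [M.adj_comm, h1], by omega⟩

theorem ETen.odd (h : ETen M u v t) : t % 2 = 1 := by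
  obtain ⟨a, b, ha, hb, h1, h2, rfl⟩ := h
  have : a % 2 = 1 ↔ b % 2 = 1 := h1.symm.trans h2
  omega

theorem AltPath.exists_reach {f : V} {S : Set V} (hf : Unmatched M f) (h : AltPath M f 0 v k S)
    {s : V} (hs : s ∈ S) : ∃ j, Reach M s j ∧ j ≤ k ∧ (s ≠ v → j < k) := by
  obtain ⟨j, S', h1, h2, h3⟩ := h.exists_initial_path hs
  exact ⟨j, ⟨f, S', hf, h1⟩, h2, h3⟩

/-- If `v` is already on the path, an initial segment reaches it, possibly with the wrong parity.
Thus extension controls minlevels but not levels of a given parity. -/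
theorem Reach.extend (h : Reach M u k) (hadj : G.Adj u v) (hpar : M.Adj u v ↔ k % 2 = 1) :
    Reach M v (k + 1) ∨ ∃ j ≤ k, Reach M v j := by
  obtain ⟨f, S, hf, hp⟩ := h
  by_cases hv : v ∈ S
  · obtain ⟨j, h1, h2, -⟩ := hp.exists_reach hf hv
    exact Or.inr ⟨j, h2, h1⟩
  · exact Or.inl ⟨f, _, hf, hp.snoc hadj hpar hv⟩

theorem Reach.exists_isMin_of_adj (h : Reach M u k) (hadj : G.Adj u v)
    (hpar : M.Adj u v ↔ k % 2 = 1) : ∃ m ≤ k + 1, IsMin M v m := by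
  rcases h.extend hadj hpar with h | ⟨j, hj, h⟩ <;> obtain ⟨m, hm, hmk⟩ := h.exists_isMin
  · exact ⟨m, hmk, hm⟩
  · exact ⟨m, by omega, hm⟩

theorem Reach.exists_last (h : Reach M v (k + 1)) :
    ∃ u, Reach M u k ∧ G.Adj u v ∧ (M.Adj u v ↔ k % 2 = 1) := by
  obtain ⟨f, S, hf, hp⟩ := h
  cases hp with
  | snoc hp hadj hpar hv => exact ⟨_, ⟨f, _, hf, hp⟩, hadj, hpar⟩

/-- A path of odd length ends with an unmatched edge, and its other vertices are matched among
themselves; so the mate of its last vertex is not on it. -/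
theorem Reach.mate (hM : M.IsMatching) (huv : M.Adj u v) (h : Reach M u k) (hk : k % 2 = 1) :
    Reach M v (k + 1) := by
  obtain ⟨f, S, hf, hp⟩ := h
  refine ⟨f, _, hf, hp.snoc huv.adj_sub (by simp [huv, hk]) fun hv => ?_⟩
  have := (hp.mate_mem hM hf hv (Or.inl huv.ne.symm) huv.symm).2
  exact this.elim (absurd rfl) (by omega)

theorem Reach.mate_of_even (hM : M.IsMatching) (huv : M.Adj u v) (h : Reach M v k)
    (hk : k % 2 = 0) : ∃ j, k = j + 1 ∧ Reach M u j := by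
  cases k with
  | zero => exact absurd huv.symm (h.unmatched u)
  | succ k =>
    obtain ⟨w, h1, h2, h3⟩ := h.exists_last
    have := hM.eq_of_adj_right (h3.2 (by omega)) huv
    exact ⟨k, rfl, this ▸ h1⟩

theorem IsLevel.mate (hM : M.IsMatching) (huv : M.Adj u v) (h : IsLevel M u k) (hk : k % 2 = 1) :
    IsLevel M v (k + 1) := by
  refine ⟨h.1.mate hM huv hk, fun j hj hjk => ?_⟩
  obtain ⟨j, rfl, hj'⟩ := hj.mate_of_even hM huv (by omega)
  have := h.2 j hj' (by omega)
  omega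

theorem IsLevel.mate_of_even (hM : M.IsMatching) (huv : M.Adj u v) (h : IsLevel M v k)
    (hk : k % 2 = 0) : ∃ j, k = j + 1 ∧ IsLevel M u j := by
  obtain ⟨j, rfl, hj⟩ := h.1.mate_of_even hM huv hk
  refine ⟨j, rfl, hj, fun n hn hnj => ?_⟩
  have := h.2 _ (hn.mate hM huv (by omega)) (by omega)
  omega

theorem Ten.mate (hM : M.IsMatching) (huv : M.Adj u v) (h : Ten M u t) : Ten M v t := by
  obtain ⟨a, b, ha, hb, hab, rfl⟩ := h
  rcases Nat.mod_two_eq_zero_or_one a with h0 | h0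
  · obtain ⟨j, rfl, hj⟩ := ha.mate_of_even hM huv.symm h0
    exact ⟨j, b + 1, hj, hb.mate hM huv (by omega), by omega, by omega⟩
  · obtain ⟨j, rfl, hj⟩ := hb.mate_of_even hM huv.symm (by omega)
    exact ⟨a + 1, j, ha.mate hM huv h0, hj, by omega, by omega⟩

/-- A vertex of positive minlevel has a neighbour one level below. -/
theorem IsMin.exists_pred (h : IsMin M v (k + 1)) :
    ∃ u, IsLevel M u k ∧ G.Adj u v ∧ (M.Adj u v ↔ k % 2 = 1) := by
  obtain ⟨u, h1, h2, h3⟩ := h.1.exists_last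
  refine ⟨u, ⟨h1, fun j hj hjk => ?_⟩, h2, h3⟩
  -- A shorter path to `u` of the same parity would reach `v` below its minlevel, either by
  -- extension or because it passes through `v`.
  rcases hj.extend h2 (by rw [h3, hjk]) with h' | ⟨n, hn, h'⟩
  · have := h.2 _ h'; omega
  · have := h.2 _ h'; omega

/-! ### Comparison of natural-number levels with the levels in `ℕ∞` -/

theorem reach_iff_walk : Reach M v k ↔
    ∃ f, ∃ p : G.Walk f v, Unmatched M f ∧ IsAlternatingPath M p ∧ p.length = k := by
  constructor
  · rintro ⟨f, S, hf, hp⟩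
    obtain ⟨p, h1, h2, h3, h4, h5⟩ := hp.exists_walk
    exact ⟨f, p, hf, ⟨h1, h4⟩, by omega⟩
  · rintro ⟨f, p, hf, hp, rfl⟩
    exact ⟨f, _, hf, hp.altPath hf⟩

theorem evenlevel_le (h : Reach M v k) (hk : k % 2 = 0) : evenlevel M v ≤ k := by
  obtain ⟨f, p, hf, hp, rfl⟩ := reach_iff_walk.1 h
  exact iInf_le_of_le f (iInf_le_of_le p (iInf_le_of_le ⟨hf, hp, Nat.even_iff.2 hk⟩ le_rfl))

theorem oddlevel_le (h : Reach M v k) (hk : k % 2 = 1) : oddlevel M v ≤ k := by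
  obtain ⟨f, p, hf, hp, rfl⟩ := reach_iff_walk.1 h
  exact iInf_le_of_le f (iInf_le_of_le p (iInf_le_of_le ⟨hf, hp, Nat.odd_iff.2 hk⟩ le_rfl))

theorem le_evenlevel {n : ℕ∞} (h : ∀ k, Reach M v k → k % 2 = 0 → n ≤ k) : n ≤ evenlevel M v :=
  le_iInf fun f => le_iInf fun p => le_iInf fun hp =>
    h _ (reach_iff_walk.2 ⟨f, p, hp.1, hp.2.1, rfl⟩) (Nat.even_iff.1 hp.2.2)

theorem le_oddlevel {n : ℕ∞} (h : ∀ k, Reach M v k → k % 2 = 1 → n ≤ k) : n ≤ oddlevel M v :=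
  le_iInf fun f => le_iInf fun p => le_iInf fun hp =>
    h _ (reach_iff_walk.2 ⟨f, p, hp.1, hp.2.1, rfl⟩) (Nat.odd_iff.1 hp.2.2)

theorem IsLevel.evenlevel_eq (h : IsLevel M v k) (hk : k % 2 = 0) : evenlevel M v = k :=
  le_antisymm (evenlevel_le h.1 hk) (le_evenlevel fun j hj hj2 => by
    exact_mod_cast h.2 j hj (by omega))

theorem IsLevel.oddlevel_eq (h : IsLevel M v k) (hk : k % 2 = 1) : oddlevel M v = k :=
  le_antisymm (oddlevel_le h.1 hk) (le_oddlevel fun j hj hj2 => by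
    exact_mod_cast h.2 j hj (by omega))

theorem evenlevel_eq_iff : evenlevel M v = k ↔ IsLevel M v k ∧ k % 2 = 0 := by
  constructor
  · intro h
    by_cases hex : ∃ j, Reach M v j ∧ j % 2 = 0
    · obtain ⟨j, hj, hj2⟩ := hex
      obtain ⟨m, hm, hmj, -⟩ := hj.exists_isLevel
      have := hm.evenlevel_eq (by omega)
      rw [h] at this
      obtain rfl : k = m := by exact_mod_cast this
      exact ⟨hm, by omega⟩
    · have : (⊤ : ℕ∞) ≤ evenlevel M v := le_evenlevel fun j hj hj2 => absurd ⟨j, hj, hj2⟩ hex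
      rw [h] at this
      simp at this
  · rintro ⟨h, hk⟩
    exact h.evenlevel_eq hk

theorem oddlevel_eq_iff : oddlevel M v = k ↔ IsLevel M v k ∧ k % 2 = 1 := by
  constructor
  · intro h
    by_cases hex : ∃ j, Reach M v j ∧ j % 2 = 1
    · obtain ⟨j, hj, hj2⟩ := hex
      obtain ⟨m, hm, hmj, -⟩ := hj.exists_isLevel
      have := hm.oddlevel_eq (by omega)
      rw [h] at this
      obtain rfl : k = m := by exact_mod_cast this
      exact ⟨hm, by omega⟩
    · have : (⊤ : ℕ∞) ≤ oddlevel M v := le_oddlevel fun j hj hj2 => absurd ⟨j, hj, hj2⟩ hex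
      rw [h] at this
      simp at this
  · rintro ⟨h, hk⟩
    exact h.oddlevel_eq hk

theorem minlevel_le (h : Reach M v k) : minlevel M v ≤ k := by
  rcases Nat.mod_two_eq_zero_or_one k with hk | hk
  · exact min_le_of_left_le (evenlevel_le h hk)
  · exact min_le_of_right_le (oddlevel_le h hk)

theorem minlevel_eq_iff : minlevel M v = m ↔ IsMin M v m := by
  constructor
  · intro h
    refine ⟨?_, fun j hj => ?_⟩
    · rcases min_choice (evenlevel M v) (oddlevel M v) with h' | h'
      · exact (evenlevel_eq_iff.1 (h'.symm.trans h)).1.1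
      · exact (oddlevel_eq_iff.1 (h'.symm.trans h)).1.1
    · have := minlevel_le hj
      rw [h] at this
      exact_mod_cast this
  · intro h
    refine le_antisymm (minlevel_le h.1) (le_min (le_evenlevel fun j hj _ => ?_)
      (le_oddlevel fun j hj _ => ?_)) <;> exact_mod_cast h.2 j hj

theorem tenacity_eq_iff : tenacity M v = t ↔ Ten M v t := by
  unfold tenacity
  constructor
  · intro h
    obtain ⟨a, ha⟩ : ∃ a : ℕ, evenlevel M v = a :=
      (ENat.ne_top_iff_exists.1 (fun h' => by simp [h'] at h)).imp fun _ h => h.symm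
    obtain ⟨b, hb⟩ : ∃ b : ℕ, oddlevel M v = b :=
      (ENat.ne_top_iff_exists.1 (fun h' => by simp [h'] at h)).imp fun _ h => h.symm
    rw [ha, hb] at h
    have h1 := evenlevel_eq_iff.1 ha
    have h2 := oddlevel_eq_iff.1 hb
    exact ⟨a, b, h1.1, h2.1, by omega, by exact_mod_cast h⟩
  · rintro ⟨a, b, ha, hb, hab, rfl⟩
    rcases Nat.mod_two_eq_zero_or_one a with h0 | h0
    · rw [ha.evenlevel_eq h0, hb.oddlevel_eq (by omega)]; norm_cast
    · rw [hb.evenlevel_eq (by omega), ha.oddlevel_eq (by omega), add_comm]; norm_cast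

theorem edgeTenacity_eq_iff : edgeTenacity M u v = t ↔ ETen M u v t := by
  unfold edgeTenacity
  constructor
  · intro h
    split_ifs at h with hM
    · obtain ⟨a, ha⟩ : ∃ a : ℕ, oddlevel M u = a :=
        (ENat.ne_top_iff_exists.1 (fun h' => by simp [h'] at h)).imp fun _ h => h.symm
      obtain ⟨b, hb⟩ : ∃ b : ℕ, oddlevel M v = b :=
        (ENat.ne_top_iff_exists.1 (fun h' => by simp [h'] at h)).imp fun _ h => h.symm
      rw [ha, hb] at h
      have h1 := oddlevel_eq_iff.1 ha
      have h2 := oddlevel_eq_iff.1 hb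
      exact ⟨a, b, h1.1, h2.1, by simp [hM, h1.2], by simp [hM, h2.2], by exact_mod_cast h⟩
    · obtain ⟨a, ha⟩ : ∃ a : ℕ, evenlevel M u = a :=
        (ENat.ne_top_iff_exists.1 (fun h' => by simp [h'] at h)).imp fun _ h => h.symm
      obtain ⟨b, hb⟩ : ∃ b : ℕ, evenlevel M v = b :=
        (ENat.ne_top_iff_exists.1 (fun h' => by simp [h'] at h)).imp fun _ h => h.symm
      rw [ha, hb] at h
      have h1 := evenlevel_eq_iff.1 ha
      have h2 := evenlevel_eq_iff.1 hb
      exact ⟨a, b, h1.1, h2.1, by simp [hM, h1.2], by simp [hM, h2.2], by exact_mod_cast h⟩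
  · rintro ⟨a, b, ha, hb, h1, h2, rfl⟩
    split_ifs with hM
    · rw [ha.oddlevel_eq (h1.1 hM), hb.oddlevel_eq (h2.1 hM)]; norm_cast
    · rw [ha.evenlevel_eq (by by_contra h; exact hM (h1.2 (by omega))),
        hb.evenlevel_eq (by by_contra h; exact hM (h2.2 (by omega)))]; norm_cast

theorem maxlevel_eq (hm : IsMin M v m) (ha : IsLevel M v a) (hma : m % 2 ≠ a % 2) :
    maxlevel M v = a := by
  have hle : (m : ℕ∞) ≤ a := by exact_mod_cast hm.2 a ha.1
  unfold maxlevel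
  rcases Nat.mod_two_eq_zero_or_one a with h0 | h0
  · rw [ha.evenlevel_eq h0, hm.isLevel.oddlevel_eq (by omega), max_eq_left hle]
  · rw [ha.oddlevel_eq h0, hm.isLevel.evenlevel_eq (by omega), max_eq_right hle]

theorem getLast_iff_of_isChain {α : Type*} {P : α → Prop} {L : List α} {l : ℕ}
    (hc : L.IsChain (fun e e' => (P e ↔ ¬ P e'))) (hl : ∀ e ∈ L.head?, (P e ↔ l % 2 = 1)) :
    ∀ e ∈ L.getLast?, (P e ↔ (l + L.length) % 2 = 0) := by
  induction L generalizing l with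
  | nil => simp
  | cons x L ih =>
    have hx := hl x (by simp)
    rw [List.isChain_cons] at hc
    cases L with
    | nil =>
      intro e he
      simp only [List.getLast?_singleton, Option.mem_def, Option.some.injEq] at he
      subst he
      rw [hx, List.length_singleton]
      omega
    | cons y L =>
      have hy := hc.1 y (by simp)
      have := ih (l := l + 1) hc.2 (fun e he => by
        simp only [List.head?_cons, Option.mem_def, Option.some.injEq] at he
        subst he
        rw [hx] at hy
        by_cases h : P y
        · simp only [h, not_true_eq_false, iff_false] at hy
          simp only [h, true_iff]; omega
        · simp only [h, not_false_eq_true, iff_true] at hy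
          simp only [h, false_iff]; omega)
      intro e he
      rw [List.getLast?_cons_cons] at he
      rw [this e he, List.length_cons (a := x)]
      omega

theorem IsAlternatingPath.getLast_mem_iff {f : V} {p : G.Walk f v} (hp : IsAlternatingPath M p)
    (hf : Unmatched M f) : ∀ e ∈ p.edges.getLast?, (e ∈ M.edgeSet ↔ p.length % 2 = 0) := by
  have := getLast_iff_of_isChain (l := 0) (P := (· ∈ M.edgeSet)) hp.2 (by
    cases p with
    | nil => simp
    | @cons _ b _ h p =>
      intro e he
      simp only [SimpleGraph.Walk.edges_cons, List.head?_cons, Option.mem_def,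
        Option.some.injEq] at he
      subst he
      simp only [SimpleGraph.Subgraph.mem_edgeSet]
      simp [hf b])
  simpa using this

/-- A path to `u` of length `k` cannot contain `v`, whose minlevel is `k + 1`. So every adjacent
vertex at the right level and joined by an edge of the right kind is a predecessor, whichever path
realizes its level. -/
theorem isPredecessor_iff : IsPredecessor M u v ↔
    ∃ k, IsMin M v (k + 1) ∧ IsLevel M u k ∧ G.Adj u v ∧ (M.Adj u v ↔ k % 2 = 1) := by
  constructor
  · rintro ⟨f, p, hf, hp, hlen, hnil, rfl⟩
    have hmin := minlevel_eq_iff.1 hlen.symm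
    have hadj := p.adj_penultimate hnil
    have hcon := SimpleGraph.Walk.concat_dropLast hadj
    have hlen' := SimpleGraph.Walk.length_dropLast_add_one hnil
    have hq : IsAlternatingPath M p.dropLast := by
      refine ⟨hp.1.dropLast, ?_⟩
      have := hp.2
      rw [← hcon, SimpleGraph.Walk.edges_concat, List.concat_eq_append] at this
      exact this.left_of_append
    have hreach : Reach M p.penultimate p.dropLast.length :=
      ⟨f, _, hf, hq.altPath hf⟩
    rw [← hlen'] at hmin
    have hpar : M.Adj p.penultimate v ↔ p.dropLast.length % 2 = 1 := by
      have hlast := hp.getLast_mem_iff hf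
      have := hlast s(p.penultimate, v) (by
        rw [← hcon, SimpleGraph.Walk.edges_concat, List.concat_eq_append]; simp)
      rw [SimpleGraph.Subgraph.mem_edgeSet] at this
      rw [this]; omega
    refine ⟨p.dropLast.length, hmin, ⟨hreach, fun j hj hjk => ?_⟩, hadj, hpar⟩
    rcases hj.extend hadj (by rw [hpar, hjk]) with h' | ⟨n, hn, h'⟩
    · have := hmin.2 _ h'; omega
    · have := hmin.2 _ h'; omega
  · rintro ⟨k, hmin, ⟨⟨f, S, hf, hp⟩, -⟩, hadj, hpar⟩
    have hv : v ∉ S := fun hv => by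
      obtain ⟨j, h1, h2, -⟩ := hp.exists_reach hf hv
      have := hmin.2 j h1
      omega
    obtain ⟨p, h1, h2, h3, h4⟩ := hp.isAlternatingPath_concat hadj hpar hv
    refine ⟨f, p, hf, h1, ?_, h3, h4⟩
    rw [minlevel_eq_iff.2 hmin]
    exact_mod_cast (by omega : p.length = k + 1)

end Levels

/-! ### Bridges -/

section Bridges

variable {u v : V} {a b i t : ℕ}

/-- The level `a` of `v` is known when the search at level `i` begins. -/
def Early (M : G.Subgraph) (i : ℕ) (v : V) (a : ℕ) : Prop :=
  (IsMin M v a ∧ a ≤ i) ∨ ∃ t, Ten M v t ∧ t + 1 ≤ 2 * i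

theorem IsLevel.early (h : IsLevel M v a) (hai : a ≤ i) : Early M i v a := by
  obtain ⟨m, hm, rfl | ⟨h1, -, h2⟩⟩ := h.exists_isMin
  · exact Or.inl ⟨hm, hai⟩
  · exact Or.inr ⟨_, h2, by omega⟩

theorem IsBridge.symm (h : IsBridge M u v) : IsBridge M v u := ⟨h.1.symm, fun h' => h.2 h'.symm⟩

theorem IsBridge.not_pred (h : IsBridge M u v) (hm : IsMin M v (a + 1)) (ha : IsLevel M u a)
    (hpar : M.Adj u v ↔ a % 2 = 1) : False :=
  h.2 (Or.inl (isPredecessor_iff.2 ⟨a, hm, ha, h.1, hpar⟩))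

/-- Going on from `u` gives `v` a minlevel of at most `a + 1`. It does not have the parity of `b`,
since it would then be `b > a`; and it is not `a + 1`, since `u` would then be a predecessor. -/
theorem IsBridge.later_end (h : IsBridge M u v) (ha : IsLevel M u a) (hb : IsLevel M v b)
    (hua : M.Adj u v ↔ a % 2 = 1) (hub : M.Adj u v ↔ b % 2 = 1) (hab : a < b) :
    ∃ m, IsMin M v m ∧ m < a ∧ m % 2 ≠ b % 2 := by
  have hpar : a % 2 = 1 ↔ b % 2 = 1 := hua.symm.trans hub
  obtain ⟨m, hma, hm⟩ := ha.1.exists_isMin_of_adj h.1 hua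
  have hmb : m % 2 ≠ b % 2 := fun hmb => by
    have := hm.isLevel.unique hb hmb
    omega
  have hne : m ≠ a + 1 := by
    rintro rfl
    exact h.not_pred hm ha hua
  exact ⟨m, hm, by omega, hmb⟩

/-- The evenlevels of the ends of a matched edge are the oddlevels of the opposite ends plus one.
Unequal oddlevels would contradict the small minlevel given by `later_end`. -/
theorem IsBridge.eq_of_matched (hM : M.IsMatching) (h : IsBridge M u v) (hadj : M.Adj u v)
    (ha : IsLevel M u a) (hb : IsLevel M v b) (ha2 : a % 2 = 1) (hb2 : b % 2 = 1) :
    a = b ∧ IsMin M u a ∧ IsMin M v b := by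
  have key : ∀ {u v : V} {a b : ℕ}, IsBridge M u v → M.Adj u v → IsLevel M u a → IsLevel M v b →
      a % 2 = 1 → b % 2 = 1 → ¬ a < b := by
    intro u v a b h hadj ha hb ha2 hb2 hab
    obtain ⟨m, hm, hma, hmb⟩ := h.later_end ha hb (by simp [hadj, ha2]) (by simp [hadj, hb2]) hab
    have := hm.isLevel.unique (ha.mate hM hadj ha2) (by omega)
    omega
  have hab : a = b := by
    have h1 := key h hadj ha hb ha2 hb2
    have h2 := key h.symm hadj.symm hb ha hb2 ha2
    omega
  subst hab
  refine ⟨rfl, ?_, ?_⟩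
  · obtain ⟨m, hm, rfl | ⟨h1, h2, -⟩⟩ := ha.exists_isMin
    · exact hm
    · have := hm.isLevel.unique (hb.mate hM hadj.symm hb2) (by omega)
      omega
  · obtain ⟨m, hm, rfl | ⟨h1, h2, -⟩⟩ := hb.exists_isMin
    · exact hm
    · have := hm.isLevel.unique (ha.mate hM hadj ha2) (by omega)
      omega

/-- Both levels that enter the tenacity `2 i + 1` of a bridge are known when the search at level `i`
begins. -/
theorem IsBridge.early (h : IsBridge M u v) (ha : IsLevel M u a) (hb : IsLevel M v b)
    (hua : M.Adj u v ↔ a % 2 = 1) (hub : M.Adj u v ↔ b % 2 = 1) (hab : a + b = 2 * i) :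
    Early M i u a := by
  by_cases hai : a ≤ i
  · exact ha.early hai
  · obtain ⟨m, hm, hma, hmb⟩ := h.symm.later_end hb ha (by rw [M.adj_comm, hub])
      (by rw [M.adj_comm, hua]) (by omega)
    -- Here `m < b` and `a + b = 2 i`, so the tenacity `m + a` is below `2 i`.
    exact Or.inr ⟨m + a, ⟨m, a, hm.isLevel, ha, hmb, rfl⟩, by omega⟩

end Bridges

/-! ### Lower bounds on the lengths of alternating paths -/

/-- `β` maps every vertex to the base of its blossom, where the blossoms are those of
tenacity at most `2 j + 1`. -/
structure Cert (M : G.Subgraph) (j : ℕ) (β : V → V) : Prop where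
  mate : ∀ v w, β v ≠ v → M.Adj v w → β w = β v ∧ β w ≠ w
  ten_iff : ∀ v, β v ≠ v ↔ ∃ t, Ten M v t ∧ t ≤ 2 * j + 1
  edge : ∀ u v t, G.Adj u v → ¬ M.Adj u v → ETen M u v t → t ≤ 2 * j + 1 → β u = β v

open Classical in
/-- The number of `j < n` such that `u` and `v` are in the same class of `β j`. -/
noncomputable def common (β : ℕ → V → V) (n : ℕ) (u v : V) : ℤ :=
  ∑ j ∈ Finset.range n, if β j u = β j v then 1 else 0

/-- `E` is a dual solution for the nested partitions `β j`; `s j` counts the unmatched minus the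
matched edges of the path inside the classes of `β j`. -/
theorem AltPath.potential {n : ℕ} {β : ℕ → V → V} {E : V → ℤ} {T : ℤ}
    {f v : V} {k : ℕ} {S : Set V}
    (hmate : ∀ j < n, ∀ v w, β j v ≠ v → M.Adj v w → β j w = β j v ∧ β j w ≠ w)
    (hfree : ∀ j < n, β j f = f) (hE : E f = 0)
    (hun : ∀ u v, G.Adj u v → ¬ M.Adj u v → T ≤ E u + E v + 1 + 2 * common β n u v)
    (hma : ∀ u v, M.Adj u v → E u + E v + 2 * common β n u v ≤ T + 1)
    (hp : AltPath M f 0 v k S) :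
    ∃ s : ℕ → ℤ,
      (∀ j < n, (k % 2 = 0 → s j ≤ 0 ∧ (β j v ∉ S → s j ≤ -1)) ∧
        (k % 2 = 1 → s j ≤ 1 ∧ (β j v = v ∨ β j v ∉ S → s j ≤ 0))) ∧
      (k % 2 = 0 → E v - 2 * ∑ j ∈ Finset.range n, s j ≤ k) ∧
      (k % 2 = 1 → T - 2 * ∑ j ∈ Finset.range n, s j ≤ k + E v) := by
  classical
  induction hp with
  | nil =>
    refine ⟨0, fun j hj => ⟨fun _ => ⟨le_rfl, fun h => ?_⟩, by omega⟩, ?_, by omega⟩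
    · exact absurd (hfree j hj) h
    · simp [hE]
  | @snoc u v k S h hadj hpar hv ih =>
    obtain ⟨s, hs, hs0, hs1⟩ := ih
    rcases Nat.mod_two_eq_zero_or_one k with hk | hk
    · refine ⟨fun j => s j + if β j u = β j v then 1 else 0, fun j hj => ⟨by omega, fun _ => ?_⟩,
        by omega, fun _ => ?_⟩
      · obtain ⟨h1, h2⟩ := (hs j hj).1 hk
        by_cases hc : β j u = β j v
        · simp only [hc, if_true]
          refine ⟨by omega, fun hb => ?_⟩
          -- The edge stays in the class. Its base was not on the path to `u`: it is the new vertex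
          -- itself or still unvisited. So `s j ≤ -1` before the edge, which absorbs the additional
          -- 1.
          have := h2 (by
            rw [hc]
            rcases hb with hb | hb
            · rwa [hb]
            · exact fun h' => hb (Set.mem_insert_of_mem _ h'))
          omega
        · simp only [hc, if_false]
          exact ⟨by omega, fun _ => by omega⟩
      · have h1 := hs0 hk
        have h2 := hun u v hadj (by rw [hpar]; omega)
        rw [Finset.sum_add_distrib]
        change _ - 2 * (_ + common β n u v) ≤ _
        push_cast
        linarith
    · refine ⟨fun j => s j - if β j u = β j v then 1 else 0, fun j hj => ⟨fun _ => ?_, by omega⟩,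
        fun _ => ?_, by omega⟩
      · obtain ⟨h1, h2⟩ := (hs j hj).2 hk
        have huv := hpar.2 hk
        by_cases hu : β j u = u
        · have h3 := h2 (Or.inl hu)
          have hvb : β j v = v := by
            by_contra hvb
            exact (hmate j hj v u hvb huv.symm).2 hu
          have hc : β j u ≠ β j v := by rw [hu, hvb]; exact hadj.ne
          simp only [hc, if_false]
          refine ⟨by omega, fun h' => ?_⟩
          rw [hvb] at h'
          exact absurd (Set.mem_insert _ _) h'
        · have hc := (hmate j hj u v hu huv).1
          simp only [hc, if_true]
          refine ⟨by omega, fun h' => ?_⟩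
          have := h2 (Or.inr fun h'' => h' (Set.mem_insert_of_mem _ h''))
          omega
      · have h1 := hs1 hk
        have h2 := hma u v (hpar.2 hk)
        rw [Finset.sum_sub_distrib]
        change _ - 2 * (_ - common β n u v) ≤ _
        push_cast
        linarith

theorem common_nonneg (β : ℕ → V → V) (n : ℕ) (u v : V) : 0 ≤ common β n u v := by
  classical
  exact Finset.sum_nonneg fun j _ => by split_ifs <;> norm_num

theorem common_le {β : ℕ → V → V} {n m : ℕ} {u v : V} (hmn : m ≤ n)
    (h : ∀ j < m, β j u ≠ β j v) : common β n u v ≤ n - m := by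
  classical
  induction n, hmn using Nat.le_induction with
  | base =>
    rw [sub_self]
    exact (Finset.sum_eq_zero fun j hj => if_neg (h j (Finset.mem_range.1 hj))).le
  | succ n hmn ih =>
    unfold common at ih ⊢
    rw [Finset.sum_range_succ]
    push_cast
    split_ifs <;> linarith

theorem le_common {β : ℕ → V → V} {n m : ℕ} {u v : V} (hmn : m ≤ n)
    (h : ∀ j, m ≤ j → j < n → β j u = β j v) : (n : ℤ) - m ≤ common β n u v := by
  classical
  induction n, hmn using Nat.le_induction with
  | base => simpa using common_nonneg β m u v
  | succ n hmn ih =>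
    have ih' := ih fun j h1 h2 => h j h1 (by omega)
    unfold common at ih' ⊢
    rw [Finset.sum_range_succ, if_pos (h n hmn (by omega))]
    push_cast
    linarith

/-! ### The dual solution after a search level -/

/-- The (shifted) dual variable of `v` after the search at level `i`. -/
def DualValue (M : G.Subgraph) (i : ℕ) (β : V → V) (v : V) (e : ℕ) : Prop :=
  (β v ≠ v ∧ IsLevel M v e ∧ e % 2 = 0) ∨
  (β v = v ∧ IsMin M v e ∧ e % 2 = 0 ∧ e ≤ i + 1) ∨
  (β v = v ∧ ∃ o, IsMin M v o ∧ o % 2 = 1 ∧ o ≤ i + 1 ∧ e + o = 2 * i + 3) ∨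
  (β v = v ∧ (∀ k, Reach M v k → i + 2 ≤ k) ∧ e = i + 2)

section DualValue

variable {β : V → V} {i e e' : ℕ} {u v : V}

theorem exists_dualValue (h : β v ≠ v → ∃ t, Ten M v t) : ∃ e, DualValue M i β v e := by
  by_cases hv : β v = v
  · by_cases hex : ∃ k ≤ i + 1, Reach M v k
    · obtain ⟨k, hk, hr⟩ := hex
      obtain ⟨m, hm, hmk⟩ := hr.exists_isMin
      rcases Nat.mod_two_eq_zero_or_one m with h0 | h0
      · exact ⟨m, Or.inr (Or.inl ⟨hv, hm, h0, by omega⟩)⟩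
      · exact ⟨2 * i + 3 - m, Or.inr (Or.inr (Or.inl ⟨hv, m, hm, h0, by omega, by omega⟩))⟩
    · refine ⟨i + 2, Or.inr (Or.inr (Or.inr ⟨hv, fun k hk => ?_, rfl⟩))⟩
      by_contra hlt
      exact hex ⟨k, by omega, hk⟩
  · obtain ⟨t, a, b, ha, hb, hab, -⟩ := h hv
    rcases Nat.mod_two_eq_zero_or_one a with h0 | h0
    · exact ⟨a, Or.inl ⟨hv, ha, h0⟩⟩
    · exact ⟨b, Or.inl ⟨hv, hb, by omega⟩⟩

/-- For unmatched edges only this alternative matters: the value is a genuine evenlevel, or it is at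
least `i + 2`. -/
theorem DualValue.cases (h : DualValue M i β v e) :
    (IsLevel M v e ∧ e % 2 = 0 ∧ (β v ≠ v ∨ IsMin M v e)) ∨
      (i + 2 ≤ e ∧ ∀ m, IsMin M v m → m ≤ i + 1 → e + m = 2 * i + 3) := by
  rcases h with ⟨h1, h2, h3⟩ | ⟨h1, h2, h3, h4⟩ | ⟨h1, o, h2, h3, h4, h5⟩ | ⟨h1, h2, h3⟩
  · exact Or.inl ⟨h2, h3, Or.inl h1⟩
  · exact Or.inl ⟨h2.isLevel, h3, Or.inr h2⟩
  · refine Or.inr ⟨by omega, fun m hm _ => ?_⟩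
    obtain rfl := hm.unique h2
    exact h5
  · refine Or.inr ⟨by omega, fun m hm hmi => ?_⟩
    have := h2 m hm.1
    omega

/-- Equality holds for an outer vertex with an inner mate, whose values are `j + 1` and `2 i + 3 -
j`, and for two unreached vertices. Two inner ends form a matched bridge. If their values were too
large, its tenacity would be at most `2 i + 1`: an older one would put the ends in a blossom, and
tenacity `2 i + 1` would have merged them. -/
theorem DualValue.add_le_of_matched (hM : M.IsMatching) (huv : M.Adj u v)
    (hu : DualValue M i β u e) (hv : DualValue M i β v e') (hbu : β u = u) (hbv : β v = v)
    (hold : ∀ v t, Ten M v t → t + 1 ≤ 2 * i → β v ≠ v)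
    (hbridge : ∀ u v, IsBridge M u v → ETen M u v (2 * i + 1) → β u = β v) :
    e + e' ≤ 2 * i + 4 := by
  have outer : ∀ {u v : V} {e e' : ℕ}, M.Adj u v → β v = v → IsMin M u e → e % 2 = 0 →
      e ≤ i + 1 → DualValue M i β v e' → e + e' ≤ 2 * i + 4 := by
    intro u v e e' huv hbv hu h0 hle hv
    obtain ⟨j, rfl, hj⟩ := hu.isLevel.mate_of_even hM huv.symm h0
    rcases hv with ⟨h1, -⟩ | ⟨-, h2, h3, h4⟩ | ⟨-, o, h2, h3, h4, h5⟩ | ⟨-, h2, h3⟩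
    · exact absurd hbv h1
    · have := h2.2 j hj.1
      exact absurd hbv (hold v (e' + j) ⟨e', j, h2.isLevel, hj, by omega, rfl⟩ (by omega))
    · have := h2.isLevel.unique hj (by omega)
      omega
    · have := h2 j hj.1
      omega
  have inner : ∀ {u v : V} {o : ℕ}, M.Adj u v → IsMin M u o → o % 2 = 1 →
      (∀ k, Reach M v k → i + 2 ≤ k) → i + 1 ≤ o := by
    intro u v o huv hu h1 hv
    have := hv _ (hu.1.mate hM huv h1)
    omega
  have hu' := hu
  have hv' := hv
  rcases hu with ⟨h1, -⟩ | ⟨-, h2, h3, h4⟩ | ⟨-, o, h2, h3, h4, h5⟩ | ⟨-, h2, h3⟩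
  · exact absurd hbu h1
  · exact outer huv hbv h2 h3 h4 hv'
  · rcases hv with ⟨h1, -⟩ | ⟨-, g2, g3, g4⟩ | ⟨-, o', g2, g3, g4, g5⟩ | ⟨-, g2, g3⟩
    · exact absurd hbv h1
    · have := outer huv.symm hbu g2 g3 g4 hu'
      omega
    · have hten : Ten M u (o + (o' + 1)) :=
        ⟨o, o' + 1, h2.isLevel, g2.isLevel.mate hM huv.symm g3, by omega, rfl⟩
      by_contra hlt
      by_cases hlt' : o + (o' + 1) + 1 ≤ 2 * i
      · exact hold u _ hten hlt' hbu
      · have hbr : IsBridge M u v := by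
          refine ⟨huv.adj_sub, ?_⟩
          rintro (h | h) <;> obtain ⟨k, k1, k2, k3, k4⟩ := isPredecessor_iff.1 h
          · have := k1.unique g2
            have := k4.1 huv
            omega
          · have := k1.unique h2
            have := k4.1 huv.symm
            omega
        have := hbridge u v hbr ⟨o, o', h2.isLevel, g2.isLevel, by simp [huv, h3],
          by simp [huv, g3], by omega⟩
        rw [hbu, hbv] at this
        exact huv.ne this
    · have := inner huv h2 h3 g2
      omega
  · rcases hv with ⟨h1, -⟩ | ⟨-, g2, g3, g4⟩ | ⟨-, o', g2, g3, g4, g5⟩ | ⟨-, g2, g3⟩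
    · exact absurd hbv h1
    · have := outer huv.symm hbu g2 g3 g4 hu'
      omega
    · have := inner huv.symm g2 g3 h2
      omega
    · omega

end DualValue

/-- If all blossoms found up to search level `i` are genuine, the bridges of tenacity `2 i + 1` have
their ends in a common blossom and blossoms are closed under predecessors, then no vertex of
tenacity `2 i + 1` is missing. -/
theorem Cert.of_sound (hM : M.IsMatching) {i : ℕ} {β : V → V}
    (hprev : ∀ j < i, ∃ β, Cert M j β)
    (hmatched : ∀ v, β v ≠ v → ∃ w, M.Adj v w)
    (hmate : ∀ v w, β v ≠ v → M.Adj v w → β w = β v ∧ β w ≠ w)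
    (hsound : ∀ v, β v ≠ v → ∃ t, Ten M v t ∧ t ≤ 2 * i + 1)
    (hold : ∀ v t, Ten M v t → t + 1 ≤ 2 * i → β v ≠ v)
    (hbridge : ∀ u v, IsBridge M u v → ETen M u v (2 * i + 1) → β u = β v)
    (hpred : ∀ u v, β v ≠ v → IsPredecessor M u v → β u = β v)
    (holdedge : ∀ u v t, G.Adj u v → ¬ M.Adj u v → ETen M u v t → t + 1 ≤ 2 * i → β u = β v) :
    Cert M i β := by
  classical
  have : Nonempty (V → V) := ⟨id⟩
  choose! γ hγ using hprev
  -- The nested partitions: earlier certificates for the levels below `i`, and the present blossoms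
  -- on top.
  let δ : ℕ → V → V := fun j => if j < i then γ j else β
  have hδlt : ∀ j < i, δ j = γ j := fun j hj => if_pos hj
  have hδi : δ i = β := if_neg (lt_irrefl i)
  have hδ : ∀ j < i + 1, j < i ∨ j = i := fun j hj => by omega
  have hEx : ∀ v, ∃ e, DualValue M i β v e := fun v =>
    exists_dualValue fun h => (hsound v h).imp fun _ h => h.1
  choose E hE using hEx
  have hδmate : ∀ j < i + 1, ∀ v w, δ j v ≠ v → M.Adj v w → δ j w = δ j v ∧ δ j w ≠ w := by
    intro j hj
    rcases hδ j hj with hj | rfl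
    · rw [hδlt j hj]; exact (hγ j hj).mate
    · rw [hδi]; exact hmate
  have hbase : ∀ v, β v = v → ∀ j < i + 1, δ j v = v := by
    intro v hv j hj
    rcases hδ j hj with hj | rfl
    · rw [hδlt j hj]
      by_contra h
      obtain ⟨t, ht, hle⟩ := ((hγ j hj).ten_iff v).1 h
      exact hold v t ht (by omega) hv
    · rw [hδi]; exact hv
  have hfree : ∀ f, Unmatched M f → β f = f := fun f hf => by
    by_contra h
    obtain ⟨w, hw⟩ := hmatched f h
    exact hf w hw
  have hE0 : ∀ f, Unmatched M f → (E f : ℤ) = 0 := by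
    intro f hf
    have h0 : IsMin M f 0 := ⟨hf.reach_zero, fun _ _ => Nat.zero_le _⟩
    rcases hE f with ⟨h1, -⟩ | ⟨-, h2, h3, h4⟩ | ⟨-, o, h2, h3, h4, h5⟩ | ⟨-, h2, h3⟩
    · exact absurd (hfree f hf) h1
    · exact_mod_cast h2.unique h0
    · have := h2.unique h0
      omega
    · have := h2 0 h0.1
      omega
  -- An unmatched prop leads to a vertex of odd minlevel. A vertex whose dual value is an evenlevel
  -- can then only be in a blossom, and blossoms are closed under predecessors.
  have hpropcase : ∀ u v, IsPredecessor M u v → ¬ M.Adj u v → E v % 2 = 0 →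
      (β v ≠ v ∨ IsMin M v (E v)) → β u = β v := by
    intro u v h hn h0 hv
    refine hpred u v ?_ h
    rcases hv with hv | hv
    · exact hv
    · obtain ⟨k, k1, k2, k3, k4⟩ := isPredecessor_iff.1 h
      have := k1.unique hv
      have : ¬ k % 2 = 1 := fun h => hn (k4.2 h)
      omega
  have hun : ∀ u v, G.Adj u v → ¬ M.Adj u v →
      (2 * i + 3 : ℤ) ≤ E u + E v + 1 + 2 * common δ (i + 1) u v := by
    intro u v hadj hn
    have hnn := common_nonneg δ (i + 1) u v
    -- A neighbour of small evenlevel `e` gives `u` a minlevel of at most `e + 1`; the value of `u`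
    -- is then `2 i + 3` minus this minlevel.
    have far : ∀ {u v : V}, G.Adj u v → ¬ M.Adj u v → i + 2 ≤ E u →
        (∀ m, IsMin M u m → m ≤ i + 1 → E u + m = 2 * i + 3) → 2 * i + 2 ≤ E u + E v := by
      intro u v hadj hn h1 h2
      by_cases hv : i ≤ E v
      · omega
      · rcases (hE v).cases with ⟨g1, g2, -⟩ | ⟨g1, -⟩
        · obtain ⟨m, hm, hmin⟩ := g1.1.exists_isMin_of_adj hadj.symm
            (iff_of_false (fun h => hn h.symm) (by omega))
          have := h2 m hmin (by omega)
          omega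
        · omega
    rcases (hE u).cases with ⟨h1, h2, h3⟩ | ⟨h1, h2⟩
    · rcases (hE v).cases with ⟨g1, g2, g3⟩ | ⟨g1, g2⟩
      · have hten : ETen M u v (E u + E v + 1) :=
          ⟨E u, E v, h1, g1, iff_of_false hn (by omega), iff_of_false hn (by omega), rfl⟩
        by_cases hlt : 2 * i + 3 ≤ E u + E v + 1
        · have : (2 * i + 3 : ℤ) ≤ E u + E v + 1 := by exact_mod_cast hlt
          linarith
        -- An edge of tenacity `2 j₀ + 1` violates the constraint without blossom terms by `2 (i + 1
        -- - j₀)`. Its ends share a class at each of the levels `j₀, ..., i`, which supplies exactly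
        -- this amount.
        · obtain ⟨j₀, hj₀⟩ : ∃ j₀, E u + E v = 2 * j₀ := ⟨(E u + E v) / 2, by omega⟩
          have hc := le_common (β := δ) (n := i + 1) (m := j₀) (u := u) (v := v) (by omega) (by
            intro j hj hji
            rcases hδ j hji with hji | rfl
            · rw [hδlt j hji]
              exact (hγ j hji).edge u v _ hadj hn hten (by omega)
            · rw [hδi]
              by_cases hlt' : E u + E v + 1 + 1 ≤ 2 * j
              · exact holdedge u v _ hadj hn hten hlt'
              · by_cases hb : IsProp M u v
                · rcases hb with hb | hb
                  · exact hpropcase u v hb hn g2 g3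
                  · exact (hpropcase v u hb (fun h => hn h.symm) h2 h3).symm
                · refine hbridge u v ⟨hadj, hb⟩ ?_
                  rwa [show 2 * j + 1 = E u + E v + 1 by omega])
          have : (E u + E v : ℤ) = 2 * j₀ := by exact_mod_cast hj₀
          push_cast at hc
          linarith
      · have := far hadj.symm (fun h => hn h.symm) g1 g2 (v := u)
        have : (2 * i + 2 : ℤ) ≤ E v + E u := by exact_mod_cast this
        linarith
    · have := far hadj hn h1 h2
      have : (2 * i + 2 : ℤ) ≤ E u + E v := by exact_mod_cast this
      linarith
  have hma : ∀ u v, M.Adj u v →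
      (E u + E v + 2 * common δ (i + 1) u v : ℤ) ≤ 2 * i + 3 + 1 := by
    intro u v huv
    by_cases hu : β u = u
    · have hv : β v = v := by
        by_contra hv
        exact (hmate v u hv huv.symm).2 hu
      have h1 := (hE u).add_le_of_matched hM huv (hE v) hu hv hold hbridge
      have h2 := common_le (β := δ) (n := i + 1) (m := i + 1) (u := u) (v := v) le_rfl
        (fun j hj => by rw [hbase u hu j hj, hbase v hv j hj]; exact huv.ne)
      have h3 : (E u + E v : ℤ) ≤ 2 * i + 4 := by exact_mod_cast h1
      linarith
    · have hv := (hmate u v hu huv).2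
      have lev : ∀ v, β v ≠ v → IsLevel M v (E v) ∧ E v % 2 = 0 := by
        intro v hv
        rcases hE v with ⟨-, h⟩ | ⟨h, -⟩ | ⟨h, -⟩ | ⟨h, -⟩
        · exact h
        all_goals exact absurd h hv
      obtain ⟨hu1, hu2⟩ := lev u hu
      obtain ⟨hv1, hv2⟩ := lev v hv
      obtain ⟨j, hj, hj'⟩ := hu1.mate_of_even hM huv.symm hu2
      have htv : Ten M v (j + E v) := ⟨j, E v, hj', hv1, by omega, rfl⟩
      have htu : Ten M u (j + E v) := htv.mate hM huv.symm
      obtain ⟨t, ht, hti⟩ := hsound v hv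
      obtain rfl := ht.unique htv
      -- Both ends have tenacity `2 j₀ + 1` and are therefore singletons of the partitions below
      -- level `j₀`; so at most `i + 1 - j₀` blossom terms occur.
      obtain ⟨j₀, hj₀⟩ : ∃ j₀, j + E v = 2 * j₀ + 1 := ⟨(j + E v) / 2, by omega⟩
      have hc := common_le (β := δ) (n := i + 1) (m := j₀) (u := u) (v := v) (by omega) (by
        intro j' hj'
        rw [hδlt j' (by omega)]
        have e1 : γ j' u = u := by
          by_contra h
          obtain ⟨t, ht, hle⟩ := ((hγ j' (by omega)).ten_iff u).1 h
          have := ht.unique htu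
          omega
        have e2 : γ j' v = v := by
          by_contra h
          obtain ⟨t, ht, hle⟩ := ((hγ j' (by omega)).ten_iff v).1 h
          have := ht.unique htv
          omega
        rw [e1, e2]
        exact huv.ne)
      have : (E u + E v : ℤ) = 2 * j₀ + 2 := by
        exact_mod_cast (by omega : E u + E v = 2 * j₀ + 2)
      push_cast at hc
      linarith
  have hten : ∀ v, β v ≠ v ↔ ∃ t, Ten M v t ∧ t ≤ 2 * i + 1 := by
    refine fun v => ⟨hsound v, ?_⟩
    rintro ⟨t, ht, hti⟩ hv
    have hodd := ht.odd
    have hlt : ¬ t + 1 ≤ 2 * i := fun h => hold v t ht h hv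
    -- Apply the path inequality to a path realizing the second level `k`. Since `v` is its own
    -- base, every `s j` is nonpositive for either parity. What remains is `2 i + 3 ≤ m + k`.
    have key : ∀ m k, IsMin M v m → IsLevel M v k → m % 2 ≠ k % 2 → t = m + k → False := by
      intro m k hm hk hmk htmk
      obtain ⟨f, S, hf, hp⟩ := hk.1
      obtain ⟨s, hs, hs0, hs1⟩ := AltPath.potential (E := fun v => (E v : ℤ)) hδmate
        (hbase f (hfree f hf)) (hE0 f hf) hun hma hp
      have hle := hm.2 k hk.1
      have hsum : ∑ j ∈ Finset.range (i + 1), s j ≤ 0 := by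
        refine Finset.sum_nonpos fun j hj => ?_
        have hj := Finset.mem_range.1 hj
        rcases Nat.mod_two_eq_zero_or_one k with h | h
        · exact ((hs j hj).1 h).1
        · exact ((hs j hj).2 h).2 (Or.inl (hbase v hv j hj))
      rcases hE v with ⟨h1, -⟩ | ⟨-, h2, h3, h4⟩ | ⟨-, o, h2, h3, h4, h5⟩ | ⟨-, h2, h3⟩
      · exact h1 hv
      · obtain rfl := h2.unique hm
        have h6 := hs1 (by omega)
        have : (2 * i + 3 : ℤ) ≤ k + E v := by linarith
        have : 2 * i + 3 ≤ k + E v := by exact_mod_cast this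
        omega
      · obtain rfl := h2.unique hm
        have h6 := hs0 (by omega)
        have : (E v : ℤ) ≤ k := by linarith
        have : E v ≤ k := by exact_mod_cast this
        omega
      · have := h2 m hm.1
        omega
    obtain ⟨a, b, ha, hb, hab, rfl⟩ := ht
    obtain ⟨m, hm, hma'⟩ := ha.1.exists_isMin
    by_cases hp : m % 2 = a % 2
    · obtain rfl := hm.isLevel.unique ha hp
      exact key m b hm hb hab rfl
    · obtain rfl := hm.isLevel.unique hb (by omega)
      exact key m a hm ha (by omega) (by omega)
  refine ⟨hmate, hten, ?_⟩
  intro u v t hadj hn ht hti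
  have hodd := ht.odd
  by_cases hlt : t + 1 ≤ 2 * i
  · exact holdedge u v t hadj hn ht hlt
  · obtain rfl : t = 2 * i + 1 := by omega
    have prop : ∀ u v, IsPredecessor M u v → ¬ M.Adj u v → ETen M u v (2 * i + 1) →
        β u = β v := by
      intro u v h hn ht
      refine hpred u v ((hten v).2 ⟨2 * i + 1, ?_, le_rfl⟩) h
      obtain ⟨k, k1, k2, k3, k4⟩ := isPredecessor_iff.1 h
      obtain ⟨a, b, ha, hb, h1, h2, h3⟩ := ht
      have ha2 : ¬ a % 2 = 1 := fun h => hn (h1.2 h)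
      have hb2 : ¬ b % 2 = 1 := fun h => hn (h2.2 h)
      have hk2 : ¬ k % 2 = 1 := fun h => hn (k4.2 h)
      have := ha.unique k2 (by omega)
      -- The tenacity of an unmatched prop is `k + b + 1`, the minlevel `k + 1` of `v` plus its
      -- evenlevel `b`; so `v` has the tenacity of the edge.
      exact ⟨k + 1, b, k1.isLevel, hb, by omega, by omega⟩
    by_cases hb : IsProp M u v
    · rcases hb with hb | hb
      · exact prop u v hb hn ht
      · exact (prop v u hb (fun h => hn h.symm) ht.symm).symm
    · exact hbridge u v ⟨hadj, hb⟩ ht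

/-! ### The layered graph of a double depth first search -/

/-- The minlevel as a natural number. -/
noncomputable def ml (M : G.Subgraph) (v : V) : ℕ := (minlevel M v).toNat

theorem IsMin.ml_eq {v : V} {m : ℕ} (h : IsMin M v m) : ml M v = m := by
  rw [ml, minlevel_eq_iff.2 h, ENat.toNat_natCast]

theorem IsMin.ml {v : V} {m : ℕ} (h : IsMin M v m) : IsMin M v (ml M v) := by
  rwa [h.ml_eq]

/-- `v` is the base of its blossom, and its minlevel is at most `i`. -/
def Live (M : G.Subgraph) (β : V → V) (i : ℕ) (v : V) : Prop :=
  β v = v ∧ IsMin M v (ml M v) ∧ ml M v ≤ i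

/-- The properties of the graph `H` on which the double depth first search relies. -/
structure Layers (M : G.Subgraph) (L : Labels V) (β : V → V) (i : ℕ) : Prop where
  minLevel : ∀ w, Live M β i w → L.minLevel w = ml M w
  step : ∀ w w', Live M β i w → L.HEdge w w' → Live M β i w' ∧ ml M w' < ml M w ∧
    ∃ u S, AltPath M w' (ml M w') u (ml M w - 1) S ∧ (∀ s ∈ S, β s = w') ∧ G.Adj u w ∧
      (M.Adj u w ↔ (ml M w - 1) % 2 = 1)
  exists_step : ∀ w, Live M β i w → 0 < ml M w → ∃ w', L.HEdge w w'

/-- There is an alternating path upwards from `w` to the vertex `x` at its level `lx` through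
blossoms, with bases satisfying `P`, that lie above `w`. -/
def TreePath (M : G.Subgraph) (β : V → V) (P : V → Prop) (w x : V) (lx : ℕ) : Prop :=
  ∃ S, AltPath M w (ml M w) x lx S ∧ ∀ s ∈ S, P (β s) ∧ (β s = w ∨ ml M w < ml M (β s))

section TreePath

variable {L : Labels V} {β : V → V} {i lx : ℕ} {P Q : V → Prop} {w w' x : V}

theorem TreePath.mono (h : TreePath M β P w x lx)
    (hPQ : ∀ c, P c → (c = w ∨ ml M w < ml M c) → Q c) : TreePath M β Q w x lx := by
  obtain ⟨S, h1, h2⟩ := h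
  exact ⟨S, h1, fun s hs => ⟨hPQ _ (h2 s hs).1 (h2 s hs).2, (h2 s hs).2⟩⟩

/-- The new piece lies in the blossom with base `w'`, strictly below `w`, whereas the old path meets
only blossoms with bases at `w` or above. Hence the two pieces are disjoint. -/
theorem TreePath.step (hL : Layers M L β i) (hw : Live M β i w) (he : L.HEdge w w')
    (h : TreePath M β P w x lx) (hP : P w') : TreePath M β P w' x lx := by
  obtain ⟨S, h1, h2⟩ := h
  obtain ⟨hw', hlt, u, S', h3, h4, h5, h6⟩ := hL.step w w' hw he
  have h1' : AltPath M w (ml M w - 1 + 1) x lx S := by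
    rwa [show ml M w - 1 + 1 = ml M w by omega]
  refine ⟨S' ∪ S, h3.append h5 h6 h1' fun s hs hs' => ?_, ?_⟩
  · have h7 := (h2 s hs').2
    rw [h4 s hs] at h7
    rcases h7 with rfl | h7
    · exact lt_irrefl _ hlt
    · omega
  · rintro s (hs | hs)
    · rw [h4 s hs]
      exact ⟨hP, Or.inl rfl⟩
    · refine ⟨(h2 s hs).1, Or.inr ?_⟩
      rcases (h2 s hs).2 with h7 | h7
      · rwa [h7]
      · omega

end TreePath

/-- `A` is the set of vertices on the way from `c` up to `root` along the pointers `par`. -/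
inductive Stack (M : G.Subgraph) (par : V → Option V) (root : V) : V → Set V → Prop
  | base : Stack M par root root {root}
  | push {c x : V} {A : Set V} (hpar : par c = some x) (hlt : ml M c < ml M x)
      (h : Stack M par root x A) : Stack M par root c (insert c A)

namespace Stack

variable {par : V → Option V} {root c : V} {A : Set V}

theorem mem (h : Stack M par root c A) : c ∈ A := by
  cases h with
  | base => rfl
  | push => exact Set.mem_insert _ _

theorem lt (h : Stack M par root c A) {a : V} (ha : a ∈ A) : a = c ∨ ml M c < ml M a := by
  induction h with
  | base => exact Or.inl ha
  | push hpar hlt h ih =>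
    rcases ha with rfl | ha
    · exact Or.inl rfl
    · rcases ih ha with rfl | h'
      · exact Or.inr hlt
      · exact Or.inr (by omega)

theorem le_root (h : Stack M par root c A) : ml M c ≤ ml M root := by
  induction h with
  | base => rfl
  | push hpar hlt h ih => omega

theorem eq_singleton (h : Stack M par root root A) : A = {root} := by
  generalize hc : root = c at h
  cases h with
  | base => rfl
  | push hpar hlt h =>
    subst hc
    have := h.le_root
    omega

theorem update [DecidableEq V] (h : Stack M par root c A) {z : V} (hz : z ∉ A) (o : Option V) :
    Stack M (Function.update par z o) root c A := by
  induction h with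
  | base => exact .base
  | @push c x A hpar hlt h ih =>
    refine .push ?_ hlt (ih fun hz' => hz (Set.mem_insert_of_mem _ hz'))
    rwa [Function.update_of_ne]
    rintro rfl
    exact hz (Set.mem_insert _ _)

theorem pop (h : Stack M par root c A) (hc : c ≠ root) :
    ∃ x B, par c = some x ∧ ml M c < ml M x ∧ Stack M par root x B ∧ A = insert c B := by
  cases h with
  | base => exact absurd rfl hc
  | push hpar hlt h => exact ⟨_, _, hpar, hlt, h, rfl⟩

-- The search paths and colour classes of DDFS

end Stack

/-- The invariant of the double depth first search from the ends `x`, `y` of a bridge, with roots `r`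
and `g`; `A` and `B` are the current search paths. -/
structure DInv (M : G.Subgraph) (L : Labels V) (β : V → V) (i : ℕ) (x y : V) (lx ly : ℕ) (r g : V)
    (D : DDFS V) (A B : Set V) : Prop where
  live : ∀ w, D.colour w ≠ none → Live M β i w
  red : ∀ w, D.colour w = some .red → TreePath M β (fun c => D.colour c = some .red) w x lx
  green : ∀ w, D.colour w = some .green → TreePath M β (fun c => D.colour c = some .green) w y ly
  stackR : Stack M D.parentR D.barrier D.cR A
  stackG : Stack M D.parentG D.rootG D.cG B
  visR : ∀ a ∈ A, D.colour a ≠ none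
  visG : ∀ b ∈ B, D.colour b ≠ none
  rootR : D.colour r ≠ none
  rootG : D.colour g ≠ none
  closed : ∀ w, D.colour w ≠ none → w ∈ A ∨ w ∈ B ∨ ∀ u, L.HEdge w u → D.colour u ≠ none
  normal : D.mode = .normal → D.cR ≠ D.cG ∧ (∀ a ∈ A, D.colour a = some .red) ∧
    (∀ b ∈ B, D.colour b = some .green) ∧
    ∀ w, D.colour w ≠ none → w = D.cR ∨ w = D.cG ∨ (ml M D.cR ≤ ml M w ∧ ml M D.cG ≤ ml M w)
  redSeeks : D.mode = .redSeeks → D.colour D.cG = some .green ∧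
    (∀ a ∈ A, a = D.cG ∨ D.colour a = some .red) ∧ (∀ b ∈ B, D.colour b = some .green) ∧
    (∀ w, D.colour w ≠ none → w = D.cG ∨ ml M D.cG < ml M w) ∧
    TreePath M β (fun c => c = D.cG ∨ D.colour c = some .red) D.cG x lx
  greenSeeks : D.mode = .greenSeeks → D.colour D.cR = some .red ∧ D.barrier = D.cR ∧
    (∀ b ∈ B, b = D.cR ∨ D.colour b = some .green) ∧
    (∀ w, D.colour w ≠ none → w = D.cR ∨ ml M D.cR < ml M w) ∧
    TreePath M β (fun c => c = D.cR ∨ D.colour c = some .green) D.cR y ly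

section DDFS

variable {L : Labels V} {β : V → V} {i lx ly : ℕ} {x y r g : V} {D D' : DDFS V} {A B : Set V}

theorem DInv.start (hr : Live M β i r) (hg : Live M β i g) (hrg : r ≠ g)
    (hpr : TreePath M β (· = r) r x lx) (hpg : TreePath M β (· = g) g y ly) :
    DInv M L β i x y lx ly r g (DDFS.start r g) {r} {g} := by
  classical
  have cr : (DDFS.start r g).colour r = some .red := by simp [DDFS.start]
  have cg : (DDFS.start r g).colour g = some .green := by simp [DDFS.start, hrg.symm]
  have vis : ∀ w, (DDFS.start r g).colour w ≠ none → w = r ∨ w = g := by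
    intro w hw
    by_contra h
    push Not at h
    exact hw (by simp [DDFS.start, h.1, h.2])
  have isr : ∀ w, (DDFS.start r g).colour w = some .red → w = r := by
    intro w hw
    rcases vis w (by simp [hw]) with rfl | rfl
    · rfl
    · simp [cg] at hw
  have isg : ∀ w, (DDFS.start r g).colour w = some .green → w = g := by
    intro w hw
    rcases vis w (by simp [hw]) with rfl | rfl
    · simp [cr] at hw
    · rfl
  refine ⟨?_, ?_, ?_, .base, .base, ?_, ?_, by simp [cr], by simp [cg], ?_, ?_, ?_, ?_⟩
  · intro w hw
    rcases vis w hw with rfl | rfl <;> assumption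
  · intro w hw
    obtain rfl := isr w hw
    exact hpr.mono fun c hc _ => by rw [hc, cr]
  · intro w hw
    obtain rfl := isg w hw
    exact hpg.mono fun c hc _ => by rw [hc, cg]
  · rintro a rfl; simp [cr]
  · rintro a rfl; simp [cg]
  · intro w hw
    rcases vis w hw with rfl | rfl
    · exact Or.inl rfl
    · exact Or.inr (Or.inl rfl)
  · intro _
    refine ⟨hrg, by rintro a rfl; exact cr, by rintro a rfl; exact cg, fun w hw => ?_⟩
    rcases vis w hw with h | h
    · exact Or.inl h
    · exact Or.inr (Or.inl h)
  · intro h; simp [DDFS.start] at h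
  · intro h; simp [DDFS.start] at h

theorem DInv.step (hL : Layers M L β i) (hD : DInv M L β i x y lx ly r g D A B)
    (hs : D.Step L D') : ∃ A' B', DInv M L β i x y lx ly r g D' A' B' := by
  classical
  cases hs with
  | redMove u hm hl he hu =>
    obtain ⟨hne, hA, hB, hlow⟩ := hD.normal hm
    have hcR := hD.live _ (hD.visR _ hD.stackR.mem)
    have hcG := hD.live _ (hD.visG _ hD.stackG.mem)
    obtain ⟨hulive, hult, -⟩ := hL.step _ _ hcR he
    rw [hL.minLevel _ hcR, hL.minLevel _ hcG] at hl
    have hl : ml M D.cG ≤ ml M D.cR := by exact_mod_cast hl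
    have hne' : ∀ w, D.colour w ≠ none → w ≠ u := by rintro w hw rfl; exact hw hu
    have hcol : ∀ w, w ≠ u → Function.update D.colour u (some .red) w = D.colour w :=
      fun w hw => Function.update_of_ne hw _ _
    have hcu : Function.update D.colour u (some .red) u = some .red := Function.update_self _ _ _
    have hkeep : ∀ w c, D.colour w = some c → Function.update D.colour u (some .red) w = some c :=
      fun w c hw => by rw [hcol w (hne' w (by simp [hw])), hw]
    have hvis : ∀ w, D.colour w ≠ none → Function.update D.colour u (some .red) w ≠ none :=
      fun w hw => by rwa [hcol w (hne' w hw)]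
    refine ⟨insert u A, B, ?_⟩
    constructor <;> dsimp only
    · intro w hw
      by_cases h : w = u
      · rwa [h]
      · rw [hcol w h] at hw; exact hD.live w hw
    · intro w hw
      by_cases h : w = u
      · subst h
        exact TreePath.step hL hcR he ((hD.red _ (hA _ hD.stackR.mem)).mono
          fun c hc _ => hkeep c _ hc) hcu
      · rw [hcol w h] at hw
        exact (hD.red w hw).mono fun c hc _ => hkeep c _ hc
    · intro w hw
      by_cases h : w = u
      · subst h; rw [hcu] at hw; simp at hw
      · rw [hcol w h] at hw
        exact (hD.green w hw).mono fun c hc _ => hkeep c _ hc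
    · refine .push (Function.update_self _ _ _) hult (hD.stackR.update (fun h => ?_) _)
      exact hD.visR _ h hu
    · exact hD.stackG
    · rintro a (rfl | ha)
      · simp
      · exact hvis a (hD.visR a ha)
    · exact fun b hb => hvis b (hD.visG b hb)
    · exact hvis _ hD.rootR
    · exact hvis _ hD.rootG
    · intro w hw
      by_cases h : w = u
      · exact Or.inl (Or.inl h)
      · rw [hcol w h] at hw
        rcases hD.closed w hw with h | h | h
        · exact Or.inl (Or.inr h)
        · exact Or.inr (Or.inl h)
        · exact Or.inr (Or.inr fun v hv => hvis v (h v hv))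
    · intro _
      refine ⟨fun h => hD.visG _ hD.stackG.mem (h ▸ hu), ?_, fun b hb => hkeep b _ (hB b hb), ?_⟩
      · rintro a (rfl | ha)
        · exact hcu
        · exact hkeep a _ (hA a ha)
      · intro w hw
        by_cases h : w = u
        · exact Or.inl h
        · rw [hcol w h] at hw
          -- The vertex just left lies above `u`, and no deeper than the green center because of the
          -- rule for red moves.
          rcases hlow w hw with rfl | h | ⟨h1, h2⟩
          · exact Or.inr (Or.inr ⟨by omega, hl⟩)
          · exact Or.inr (Or.inl h)
          · exact Or.inr (Or.inr ⟨by omega, h2⟩)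
    · intro h; rw [hm] at h; cases h
    · intro h; rw [hm] at h; cases h
  | greenMove u hm hl he hu =>
    obtain ⟨hne, hA, hB, hlow⟩ := hD.normal hm
    have hcR := hD.live _ (hD.visR _ hD.stackR.mem)
    have hcG := hD.live _ (hD.visG _ hD.stackG.mem)
    obtain ⟨hulive, hult, -⟩ := hL.step _ _ hcG he
    rw [hL.minLevel _ hcR, hL.minLevel _ hcG] at hl
    have hl : ml M D.cR < ml M D.cG := by exact_mod_cast hl
    have hne' : ∀ w, D.colour w ≠ none → w ≠ u := by rintro w hw rfl; exact hw hu
    have hcol : ∀ w, w ≠ u → Function.update D.colour u (some .green) w = D.colour w :=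
      fun w hw => Function.update_of_ne hw _ _
    have hcu : Function.update D.colour u (some .green) u = some .green :=
      Function.update_self _ _ _
    have hkeep : ∀ w c, D.colour w = some c →
        Function.update D.colour u (some .green) w = some c :=
      fun w c hw => by rw [hcol w (hne' w (by simp [hw])), hw]
    have hvis : ∀ w, D.colour w ≠ none → Function.update D.colour u (some .green) w ≠ none :=
      fun w hw => by rwa [hcol w (hne' w hw)]
    refine ⟨A, insert u B, ?_⟩
    constructor <;> dsimp only
    · intro w hw
      by_cases h : w = u
      · rwa [h]
      · rw [hcol w h] at hw; exact hD.live w hw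
    · intro w hw
      by_cases h : w = u
      · subst h; rw [hcu] at hw; simp at hw
      · rw [hcol w h] at hw
        exact (hD.red w hw).mono fun c hc _ => hkeep c _ hc
    · intro w hw
      by_cases h : w = u
      · subst h
        exact TreePath.step hL hcG he ((hD.green _ (hB _ hD.stackG.mem)).mono
          fun c hc _ => hkeep c _ hc) hcu
      · rw [hcol w h] at hw
        exact (hD.green w hw).mono fun c hc _ => hkeep c _ hc
    · exact hD.stackR
    · refine .push (Function.update_self _ _ _) hult (hD.stackG.update (fun h => ?_) _)
      exact hD.visG _ h hu
    · exact fun b hb => hvis b (hD.visR b hb)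
    · rintro a (rfl | ha)
      · simp
      · exact hvis a (hD.visG a ha)
    · exact hvis _ hD.rootR
    · exact hvis _ hD.rootG
    · intro w hw
      by_cases h : w = u
      · exact Or.inr (Or.inl (Or.inl h))
      · rw [hcol w h] at hw
        rcases hD.closed w hw with h | h | h
        · exact Or.inl h
        · exact Or.inr (Or.inl (Or.inr h))
        · exact Or.inr (Or.inr fun v hv => hvis v (h v hv))
    · intro _
      refine ⟨fun h => hD.visR _ hD.stackR.mem (h ▸ hu), fun b hb => hkeep b _ (hA b hb), ?_, ?_⟩
      · rintro a (rfl | ha)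
        · exact hcu
        · exact hkeep a _ (hB a ha)
      · intro w hw
        by_cases h : w = u
        · exact Or.inr (Or.inl h)
        · rw [hcol w h] at hw
          rcases hlow w hw with h | rfl | ⟨h1, h2⟩
          · exact Or.inl h
          · exact Or.inr (Or.inr ⟨by omega, by omega⟩)
          · exact Or.inr (Or.inr ⟨h1, by omega⟩)
    · intro h; rw [hm] at h; cases h
    · intro h; rw [hm] at h; cases h
  | redMeets hm hl he =>
    obtain ⟨hne, hA, hB, hlow⟩ := hD.normal hm
    have hcR := hD.live _ (hD.visR _ hD.stackR.mem)
    obtain ⟨-, hult, -⟩ := hL.step _ _ hcR he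
    have hcG : D.colour D.cG = some .green := hB _ hD.stackG.mem
    -- The meeting vertex is already green, so the colouring does not change.
    have hup : Function.update D.colour D.cG (some .green) = D.colour := by
      rw [← hcG, Function.update_eq_self]
    refine ⟨insert D.cG A, B, ?_⟩
    constructor <;> dsimp only <;> try rw [hup]
    · exact hD.live
    · exact hD.red
    · exact hD.green
    · refine .push (Function.update_self _ _ _) hult (hD.stackR.update (fun h => ?_) _)
      have := hA _ h
      simp [hcG] at this
    · exact hD.stackG
    · rintro a (rfl | ha)
      · simp [hcG]
      · exact hD.visR a ha
    · exact hD.visG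
    · exact hD.rootR
    · exact hD.rootG
    · intro w hw
      rcases hD.closed w hw with h | h | h
      · exact Or.inl (Or.inr h)
      · exact Or.inr (Or.inl h)
      · exact Or.inr (Or.inr h)
    · intro h; cases h
    · intro _
      refine ⟨hcG, ?_, hB, ?_, ?_⟩
      · rintro a (rfl | ha)
        · exact Or.inl rfl
        · exact Or.inr (hA a ha)
      · intro w hw
        rcases hlow w hw with rfl | h | ⟨h1, h2⟩
        · exact Or.inr hult
        · exact Or.inl h
        · exact Or.inr (by omega)
      · exact TreePath.step hL hcR he ((hD.red _ (hA _ hD.stackR.mem)).mono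
          fun c hc _ => Or.inr hc) (Or.inl rfl)
    · intro h; cases h
  | greenMeets hm hl he =>
    obtain ⟨hne, hA, hB, hlow⟩ := hD.normal hm
    have hcG := hD.live _ (hD.visG _ hD.stackG.mem)
    obtain ⟨-, hult, -⟩ := hL.step _ _ hcG he
    have hcR : D.colour D.cR = some .red := hA _ hD.stackR.mem
    have hlow' : ∀ w, D.colour w ≠ none → w = D.cR ∨ ml M D.cR < ml M w := by
      intro w hw
      rcases hlow w hw with h | rfl | ⟨h1, h2⟩
      · exact Or.inl h
      · exact Or.inr hult
      · exact Or.inr (by omega)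
    have hcol : ∀ w, w ≠ D.cR → Function.update D.colour D.cR (some .green) w = D.colour w :=
      fun w hw => Function.update_of_ne hw _ _
    have hcu : Function.update D.colour D.cR (some .green) D.cR = some .green :=
      Function.update_self _ _ _
    have hkeep : ∀ w, D.colour w = some .green →
        Function.update D.colour D.cR (some .green) w = some .green := fun w hw => by
      rw [hcol w, hw]
      rintro rfl; simp [hcR] at hw
    have hvis : ∀ w, Function.update D.colour D.cR (some .green) w ≠ none ↔ D.colour w ≠ none := by
      intro w
      by_cases h : w = D.cR
      · subst h; simp [hcR]
      · rw [hcol w h]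
    refine ⟨A, insert D.cR B, ?_⟩
    constructor <;> dsimp only <;> try simp only [hvis]
    · exact hD.live
    · intro w hw
      have hwz : w ≠ D.cR := by rintro rfl; simp at hw
      rw [hcol w hwz] at hw
      -- The recoloured meeting vertex is strictly the deepest visited vertex. A tree path from
      -- another red vertex `w` only uses bases at `w` or above, so it stays red.
      refine (hD.red w hw).mono fun c hc hcw => ?_
      rw [hcol c, hc]
      rintro rfl
      rcases hlow' w (by simp [hw]) with h | h
      · exact hwz h
      · rcases hcw with h' | h'
        · exact hwz h'.symm
        · omega
    · intro w hw
      by_cases h : w = D.cR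
      · subst h
        exact TreePath.step hL hcG he ((hD.green _ (hB _ hD.stackG.mem)).mono
          fun c hc _ => hkeep c hc) hcu
      · rw [hcol w h] at hw
        exact (hD.green w hw).mono fun c hc _ => hkeep c hc
    · exact hD.stackR
    · refine .push (Function.update_self _ _ _) hult (hD.stackG.update (fun h => ?_) _)
      have := hB _ h
      simp [hcR] at this
    · exact hD.visR
    · rintro a (rfl | ha)
      · simp [hcR]
      · exact hD.visG a ha
    · exact hD.rootR
    · exact hD.rootG
    · intro w hw
      rcases hD.closed w hw with h | h | h
      · exact Or.inl h
      · exact Or.inr (Or.inl (Or.inr h))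
      · exact Or.inr (Or.inr h)
    · intro h; cases h
    · intro _
      refine ⟨hcu, ?_, ?_, hlow', ?_⟩
      · intro a ha
        by_cases h : a = D.cR
        · exact Or.inl h
        · rw [hcol a h]; exact Or.inr (hA a ha)
      · rintro a (rfl | ha)
        · exact hcu
        · exact hkeep a (hB a ha)
      · refine (hD.red _ hcR).mono fun c hc _ => ?_
        by_cases h : c = D.cR
        · exact Or.inl h
        · rw [hcol c h]; exact Or.inr hc
    · intro h; cases h
  | redSeek u hm hc he hu =>
    obtain ⟨hzg, hA, hB, hlow, halt⟩ := hD.redSeeks hm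
    have hcR := hD.live _ (hD.visR _ hD.stackR.mem)
    have hcG := hD.live _ (hD.visG _ hD.stackG.mem)
    obtain ⟨hulive, hult, -⟩ := hL.step _ _ hcR he
    -- The center has left the meeting vertex and lies above it. The search path lies above the
    -- center, so the meeting vertex is no longer on it.
    have hA' : ∀ a ∈ A, D.colour a = some .red := by
      intro a ha
      rcases hA a ha with rfl | h
      · exfalso
        rcases hlow _ (hD.visR _ hD.stackR.mem) with h | h
        · exact hc h
        · rcases hD.stackR.lt ha with h' | h'
          · exact hc h'.symm
          · omega
      · exact h
    have hne' : ∀ w, D.colour w ≠ none → w ≠ u := by rintro w hw rfl; exact hw hu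
    have hcol : ∀ w, w ≠ u → Function.update D.colour u (some .red) w = D.colour w :=
      fun w hw => Function.update_of_ne hw _ _
    have hcu : Function.update D.colour u (some .red) u = some .red := Function.update_self _ _ _
    have hkeep : ∀ w c, D.colour w = some c → Function.update D.colour u (some .red) w = some c :=
      fun w c hw => by rw [hcol w (hne' w (by simp [hw])), hw]
    have hvis : ∀ w, D.colour w ≠ none → Function.update D.colour u (some .red) w ≠ none :=
      fun w hw => by rwa [hcol w (hne' w hw)]
    rw [hL.minLevel _ hulive, hL.minLevel _ hcG]
    refine ⟨insert u A, B, ?_⟩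
    constructor <;> dsimp only
    · intro w hw
      by_cases h : w = u
      · rwa [h]
      · rw [hcol w h] at hw; exact hD.live w hw
    · intro w hw
      by_cases h : w = u
      · subst h
        exact TreePath.step hL hcR he ((hD.red _ (hA' _ hD.stackR.mem)).mono
          fun c hc _ => hkeep c _ hc) hcu
      · rw [hcol w h] at hw
        exact (hD.red w hw).mono fun c hc _ => hkeep c _ hc
    · intro w hw
      by_cases h : w = u
      · subst h; rw [hcu] at hw; simp at hw
      · rw [hcol w h] at hw
        exact (hD.green w hw).mono fun c hc _ => hkeep c _ hc
    · refine .push (Function.update_self _ _ _) hult (hD.stackR.update (fun h => ?_) _)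
      exact hD.visR _ h hu
    · exact hD.stackG
    · rintro a (rfl | ha)
      · simp
      · exact hvis a (hD.visR a ha)
    · exact fun b hb => hvis b (hD.visG b hb)
    · exact hvis _ hD.rootR
    · exact hvis _ hD.rootG
    · intro w hw
      by_cases h : w = u
      · exact Or.inl (Or.inl h)
      · rw [hcol w h] at hw
        rcases hD.closed w hw with h | h | h
        · exact Or.inl (Or.inr h)
        · exact Or.inr (Or.inl h)
        · exact Or.inr (Or.inr fun v hv => hvis v (h v hv))
    · intro hmode
      have hle : ml M u ≤ ml M D.cG := by
        by_contra hle
        rw [if_neg (by exact_mod_cast hle)] at hmode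
        cases hmode
      refine ⟨fun h => hD.visG _ hD.stackG.mem (h ▸ hu), ?_, fun b hb => hkeep b _ (hB b hb), ?_⟩
      · rintro a (rfl | ha)
        · exact hcu
        · exact hkeep a _ (hA' a ha)
      · intro w hw
        by_cases h : w = u
        · exact Or.inl h
        · rw [hcol w h] at hw
          rcases hlow w hw with h | h
          · exact Or.inr (Or.inl h)
          · exact Or.inr (Or.inr ⟨by omega, by omega⟩)
    · intro hmode
      have hle : ml M D.cG < ml M u := by
        by_contra hle
        rw [if_pos (by exact_mod_cast not_lt.1 hle)] at hmode
        cases hmode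
      refine ⟨hkeep _ _ hzg, ?_, fun b hb => hkeep b _ (hB b hb), ?_, ?_⟩
      · rintro a (rfl | ha)
        · exact Or.inr hcu
        · exact Or.inr (hkeep a _ (hA' a ha))
      · intro w hw
        by_cases h : w = u
        · subst h; exact Or.inr hle
        · rw [hcol w h] at hw
          exact hlow w hw
      · exact halt.mono fun c hc _ => hc.imp id (hkeep c _)
    · intro hmode
      split_ifs at hmode
  | redBacktrack p hm hs hb hx =>
    obtain ⟨hzg, hA, hB, hlow, halt⟩ := hD.redSeeks hm
    obtain ⟨p', A', hp1, hp2, hp3, rfl⟩ := hD.stackR.pop hb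
    obtain rfl : p' = p := by rw [hp1] at hx; exact Option.some.inj hx
    refine ⟨A', B, ?_⟩
    constructor <;> dsimp only
    · exact hD.live
    · exact hD.red
    · exact hD.green
    · exact hp3
    · exact hD.stackG
    · exact fun a ha => hD.visR a (Or.inr ha)
    · exact hD.visG
    · exact hD.rootR
    · exact hD.rootG
    · intro w hw
      rcases hD.closed w hw with (rfl | h) | h | h
      -- The vertex leaving the red search path is either the meeting vertex, which is on the green
      -- one, or has no edges to unvisited vertices.
      · rcases hs with hs | hs
        · rw [hs]; exact Or.inr (Or.inl hD.stackG.mem)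
        · exact Or.inr (Or.inr hs)
      · exact Or.inl h
      · exact Or.inr (Or.inl h)
      · exact Or.inr (Or.inr h)
    · intro h; rw [hm] at h; cases h
    · exact fun _ => ⟨hzg, fun a ha => hA a (Or.inr ha), hB, hlow, halt⟩
    · intro h; rw [hm] at h; cases h
  | redFail hm hs hb =>
    obtain ⟨hzg, hA, hB, hlow, halt⟩ := hD.redSeeks hm
    have hA1 : A = {D.cR} := by
      have := hD.stackR
      rw [hb] at this ⊢
      exact this.eq_singleton
    have hcol : ∀ w, w ≠ D.cG → Function.update D.colour D.cG (some .red) w = D.colour w :=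
      fun w hw => Function.update_of_ne hw _ _
    have hcu : Function.update D.colour D.cG (some .red) D.cG = some .red :=
      Function.update_self _ _ _
    have hvis : ∀ w, Function.update D.colour D.cG (some .red) w ≠ none ↔ D.colour w ≠ none := by
      intro w
      by_cases h : w = D.cG
      · subst h; simp [hzg]
      · rw [hcol w h]
    have hkeep : ∀ w, D.colour w = some .red →
        Function.update D.colour D.cG (some .red) w = some .red := fun w hw => by
      rw [hcol w, hw]
      rintro rfl; simp [hzg] at hw
    refine ⟨{D.cG}, B, ?_⟩
    constructor <;> dsimp only <;> try simp only [hvis]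
    · exact hD.live
    · intro w hw
      by_cases h : w = D.cG
      · subst h
        -- The alternative path, kept since the meeting, reaches the red end of the bridge; it now
        -- justifies the new colour of the meeting vertex.
        refine halt.mono fun c hc _ => ?_
        rcases hc with rfl | hc
        · exact hcu
        · exact hkeep c hc
      · rw [hcol w h] at hw
        exact (hD.red w hw).mono fun c hc _ => hkeep c hc
    · intro w hw
      have hwz : w ≠ D.cG := by rintro rfl; simp at hw
      rw [hcol w hwz] at hw
      refine (hD.green w hw).mono fun c hc hcw => ?_
      rw [hcol c, hc]
      rintro rfl
      rcases hlow w (by simp [hw]) with h | h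
      · exact hwz h
      · rcases hcw with h' | h'
        · exact hwz h'.symm
        · omega
    · exact .base
    · exact hD.stackG
    · rintro a rfl; simp [hzg]
    · exact hD.visG
    · exact hD.rootR
    · exact hD.rootG
    · intro w hw
      rcases hD.closed w hw with h | h | h
      · rw [hA1] at h
        obtain rfl : w = D.cR := h
        rcases hs with hs | hs
        · exact Or.inl hs
        · exact Or.inr (Or.inr hs)
      · exact Or.inr (Or.inl h)
      · exact Or.inr (Or.inr h)
    · intro h; cases h
    · intro h; cases h
    · intro _
      refine ⟨hcu, trivial, ?_, hlow, ?_⟩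
      · intro b hb
        by_cases h : b = D.cG
        · exact Or.inl h
        · rw [hcol b h]; exact Or.inr (hB b hb)
      · refine (hD.green _ hzg).mono fun c hc _ => ?_
        by_cases h : c = D.cG
        · exact Or.inl h
        · rw [hcol c h]; exact Or.inr hc
  | greenSeek u hm hc he hu =>
    obtain ⟨hzr, hbar, hB, hlow, halt⟩ := hD.greenSeeks hm
    have hA1 : A = {D.cR} := by
      have := hD.stackR
      rw [hbar] at this
      exact this.eq_singleton
    have hcR := hD.live _ (hD.visR _ hD.stackR.mem)
    have hcG := hD.live _ (hD.visG _ hD.stackG.mem)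
    obtain ⟨hulive, hult, -⟩ := hL.step _ _ hcG he
    have hB' : ∀ b ∈ B, D.colour b = some .green := by
      intro b hb
      rcases hB b hb with rfl | h
      · exfalso
        rcases hlow _ (hD.visG _ hD.stackG.mem) with h | h
        · exact hc h
        · rcases hD.stackG.lt hb with h' | h'
          · exact hc h'.symm
          · omega
      · exact h
    have hne' : ∀ w, D.colour w ≠ none → w ≠ u := by rintro w hw rfl; exact hw hu
    have hcol : ∀ w, w ≠ u → Function.update D.colour u (some .green) w = D.colour w :=
      fun w hw => Function.update_of_ne hw _ _
    have hcu : Function.update D.colour u (some .green) u = some .green :=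
      Function.update_self _ _ _
    have hkeep : ∀ w c, D.colour w = some c →
        Function.update D.colour u (some .green) w = some c :=
      fun w c hw => by rw [hcol w (hne' w (by simp [hw])), hw]
    have hvis : ∀ w, D.colour w ≠ none → Function.update D.colour u (some .green) w ≠ none :=
      fun w hw => by rwa [hcol w (hne' w hw)]
    rw [hL.minLevel _ hulive, hL.minLevel _ hcR]
    refine ⟨A, insert u B, ?_⟩
    constructor <;> dsimp only
    · intro w hw
      by_cases h : w = u
      · rwa [h]
      · rw [hcol w h] at hw; exact hD.live w hw
    · intro w hw
      by_cases h : w = u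
      · subst h; rw [hcu] at hw; simp at hw
      · rw [hcol w h] at hw
        exact (hD.red w hw).mono fun c hc _ => hkeep c _ hc
    · intro w hw
      by_cases h : w = u
      · subst h
        exact TreePath.step hL hcG he ((hD.green _ (hB' _ hD.stackG.mem)).mono
          fun c hc _ => hkeep c _ hc) hcu
      · rw [hcol w h] at hw
        exact (hD.green w hw).mono fun c hc _ => hkeep c _ hc
    · exact hD.stackR
    · refine .push (Function.update_self _ _ _) hult (hD.stackG.update (fun h => ?_) _)
      exact hD.visG _ h hu
    · exact fun b hb => hvis b (hD.visR b hb)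
    · rintro a (rfl | ha)
      · simp
      · exact hvis a (hD.visG a ha)
    · exact hvis _ hD.rootR
    · exact hvis _ hD.rootG
    · intro w hw
      by_cases h : w = u
      · exact Or.inr (Or.inl (Or.inl h))
      · rw [hcol w h] at hw
        rcases hD.closed w hw with h | h | h
        · exact Or.inl h
        · exact Or.inr (Or.inl (Or.inr h))
        · exact Or.inr (Or.inr fun v hv => hvis v (h v hv))
    · intro hmode
      have hle : ml M u ≤ ml M D.cR := by
        by_contra hle
        rw [if_neg (by exact_mod_cast hle)] at hmode
        cases hmode
      refine ⟨fun h => hD.visR _ hD.stackR.mem (h ▸ hu), ?_, ?_, ?_⟩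
      · rw [hA1]; rintro a rfl; exact hkeep _ _ hzr
      · rintro a (rfl | ha)
        · exact hcu
        · exact hkeep a _ (hB' a ha)
      · intro w hw
        by_cases h : w = u
        · exact Or.inr (Or.inl h)
        · rw [hcol w h] at hw
          rcases hlow w hw with h | h
          · exact Or.inl h
          · exact Or.inr (Or.inr ⟨by omega, by omega⟩)
    · intro hmode
      split_ifs at hmode
    · intro hmode
      have hle : ml M D.cR < ml M u := by
        by_contra hle
        rw [if_pos (by exact_mod_cast not_lt.1 hle)] at hmode
        cases hmode
      refine ⟨hkeep _ _ hzr, hbar, ?_, ?_, ?_⟩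
      · rintro a (rfl | ha)
        · exact Or.inr hcu
        · exact Or.inr (hkeep a _ (hB' a ha))
      · intro w hw
        by_cases h : w = u
        · subst h; exact Or.inr hle
        · rw [hcol w h] at hw
          exact hlow w hw
      · exact halt.mono fun c hc _ => hc.imp id (hkeep c _)
  | greenBacktrack p hm hs hb hx =>
    obtain ⟨hzr, hbar, hB, hlow, halt⟩ := hD.greenSeeks hm
    obtain ⟨p', B', hp1, hp2, hp3, rfl⟩ := hD.stackG.pop hb
    obtain rfl : p' = p := by rw [hp1] at hx; exact Option.some.inj hx
    refine ⟨A, B', ?_⟩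
    constructor <;> dsimp only
    · exact hD.live
    · exact hD.red
    · exact hD.green
    · exact hD.stackR
    · exact hp3
    · exact hD.visR
    · exact fun a ha => hD.visG a (Or.inr ha)
    · exact hD.rootR
    · exact hD.rootG
    · intro w hw
      rcases hD.closed w hw with h | (rfl | h) | h
      · exact Or.inl h
      · rcases hs with hs | hs
        · rw [hs]; exact Or.inl hD.stackR.mem
        · exact Or.inr (Or.inr hs)
      · exact Or.inr (Or.inl h)
      · exact Or.inr (Or.inr h)
    · intro h; rw [hm] at h; cases h
    · intro h; rw [hm] at h; cases h
    · exact fun _ => ⟨hzr, hbar, fun a ha => hB a (Or.inr ha), hlow, halt⟩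

/-- As long as it has not ended, the search can go on. -/
theorem DInv.progress (hL : Layers M L β i) (hD : DInv M L β i x y lx ly r g D A B) :
    (∃ D', D.Step L D') ∨ (∃ b, D.EndsAt L b) ∨ D.EndsDisjoint L := by
  classical
  have hcR := hD.live _ (hD.visR _ hD.stackR.mem)
  have hcG := hD.live _ (hD.visG _ hD.stackG.mem)
  rcases hm : D.mode with _ | _ | _
  · obtain ⟨hne, hA, hB, hlow⟩ := hD.normal hm
    rcases le_or_gt (ml M D.cG) (ml M D.cR) with hle | hlt
    · have hl : L.minLevel D.cG ≤ L.minLevel D.cR := by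
        rw [hL.minLevel _ hcR, hL.minLevel _ hcG]; exact_mod_cast hle
      rcases Nat.eq_zero_or_pos (ml M D.cR) with h0 | hpos
      · right; right
        refine ⟨hm, hne, ?_, ?_⟩
        · rw [hL.minLevel _ hcR, h0]; rfl
        · rw [hL.minLevel _ hcG, show ml M D.cG = 0 by omega]; rfl
      · left
        obtain ⟨u, hu⟩ := hL.exists_step _ hcR hpos
        obtain ⟨-, hlt, -⟩ := hL.step _ _ hcR hu
        by_cases hc : D.colour u = none
        · exact ⟨_, .redMove D u hm hl hu hc⟩
        -- The vertex `u` is deeper than the red center, while visited vertices other than the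
        -- centers are not. So a visited `u` must be the green center.
        · rcases hlow u hc with rfl | rfl | ⟨h1, -⟩
          · omega
          · exact ⟨_, .redMeets D hm hl hu⟩
          · omega
    · have hl : L.minLevel D.cR < L.minLevel D.cG := by
        rw [hL.minLevel _ hcR, hL.minLevel _ hcG]; exact_mod_cast hlt
      left
      obtain ⟨u, hu⟩ := hL.exists_step _ hcG (by omega)
      obtain ⟨-, hlt', -⟩ := hL.step _ _ hcG hu
      by_cases hc : D.colour u = none
      · exact ⟨_, .greenMove D u hm hl hu hc⟩
      · rcases hlow u hc with rfl | rfl | ⟨-, h1⟩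
        · exact ⟨_, .greenMeets D hm hl hu⟩
        · omega
        · omega
  · left
    by_cases hs : D.RedStuck L
    · by_cases hb : D.cR = D.barrier
      · exact ⟨_, .redFail D hm hs hb⟩
      · obtain ⟨p, B', h1, -⟩ := hD.stackR.pop hb
        exact ⟨_, .redBacktrack D p hm hs hb h1⟩
    · simp only [DDFS.RedStuck, not_or, not_forall, not_not] at hs
      obtain ⟨hc, u, hu, hcu⟩ := hs
      exact ⟨_, .redSeek D u hm hc hu hcu⟩
  · by_cases hs : D.GreenStuck L
    · by_cases hb : D.cG = D.rootG
      · exact Or.inr (Or.inl ⟨_, hm, hs, hb, rfl⟩)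
      · obtain ⟨p, B', h1, -⟩ := hD.stackG.pop hb
        exact Or.inl ⟨_, .greenBacktrack D p hm hs hb h1⟩
    · simp only [DDFS.GreenStuck, not_or, not_forall, not_not] at hs
      obtain ⟨hc, u, hu, hcu⟩ := hs
      exact Or.inl ⟨_, .greenSeek D u hm hc hu hcu⟩

end DDFS

/-! ### The invariant of MAX -/

namespace Labels

variable {L : Labels V} {v b c : V}

theorem BudStar.bud_eq (h : L.BudStar v b) : L.bud b = b := by
  induction h with
  | self v h => exact h
  | next v b h h' ih => exact ih

theorem BudStar.unique (h : L.BudStar v b) (h' : L.BudStar v c) : b = c := by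
  induction h with
  | self v h =>
    cases h' with
    | self => rfl
    | next _ _ h1 => exact absurd h h1
  | next v b h _ ih =>
    cases h' with
    | self _ h1 => exact absurd h1 h
    | next _ _ _ h2 => exact ih h2

end Labels

/-- The properties of the blossoms found up to search level `i`, where `β` is `bud*`. -/
structure Blossoms (M : G.Subgraph) (i : ℕ) (L : Labels V) (β : V → V) : Prop where
  prev : ∀ j < i, ∃ β, Cert M j β
  maxLevel_base : ∀ v, β v = v → L.maxLevel v = ⊤
  maxLevel : ∀ v, β v ≠ v → ∃ m a : ℕ, IsMin M v m ∧ IsLevel M v a ∧ m % 2 ≠ a % 2 ∧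
    m + a ≤ 2 * i + 1 ∧ L.maxLevel v = a
  star : ∀ v, L.BudStar v (β v)
  base_lt : ∀ v, β v ≠ v → ∃ m n, IsMin M v m ∧ IsMin M (β v) n ∧ n < m ∧ n % 2 = 0
  matched : ∀ v, β v ≠ v → ∃ w, M.Adj v w
  mate : ∀ v w, β v ≠ v → M.Adj v w → β w = β v ∧ β w ≠ w
  old : ∀ v t, Ten M v t → t + 1 ≤ 2 * i → β v ≠ v
  old_edge : ∀ u v t, G.Adj u v → ¬ M.Adj u v → ETen M u v t → t + 1 ≤ 2 * i → β u = β v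
  pred_closed : ∀ u v, β v ≠ v → IsPredecessor M u v → β u = β v
  path : ∀ v k, β v ≠ v → IsLevel M v k →
    ∃ S, AltPath M (β v) (ml M (β v)) v k S ∧ ∀ s ∈ S, β s = β v

/-- The invariant of the labels during MAX at search level `i`. -/
structure MaxInv (M : G.Subgraph) (i : ℕ) (L : Labels V) (β : V → V) : Prop
    extends Blossoms M i L β where
  minLevel : ∀ v (m : ℕ), L.minLevel v = m ↔ IsMin M v m ∧ m ≤ i + 1
  preds : ∀ u v, u ∈ L.preds v ↔ IsPredecessor M u v ∧ ∃ m ≤ i + 1, IsMin M v m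

namespace MaxInv

variable {L : Labels V} {β : V → V} {i : ℕ}

theorem bud_eq_iff (h : MaxInv M i L β) {v : V} : L.bud v = v ↔ β v = v :=
  ⟨fun hv => ((Labels.BudStar.self v hv).unique (h.star v)).symm,
    fun hv => by have := (h.star v).bud_eq; rwa [hv] at this⟩

theorem base_idem (h : MaxInv M i L β) (v : V) : β (β v) = β v :=
  h.bud_eq_iff.1 (h.star v).bud_eq

theorem hedge_iff (h : MaxInv M i L β) {v w : V} :
    L.HEdge v w ↔ (∃ m ≤ i + 1, IsMin M v m) ∧ ∃ u, IsPredecessor M u v ∧ β u = w := by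
  constructor
  · rintro ⟨u, hu, hs⟩
    obtain ⟨h1, h2⟩ := (h.preds u v).1 hu
    exact ⟨h2, u, h1, (h.star u).unique hs⟩
  · rintro ⟨h1, u, h2, rfl⟩
    exact ⟨u, (h.preds u v).2 ⟨h2, h1⟩, h.star u⟩

/-- The base of a blossom containing a vertex whose level `a` is known. -/
theorem live_base (h : MaxInv M i L β) {x : V} {a : ℕ} (ha : IsLevel M x a)
    (he : Early M i x a) : Live M β i (β x) ∧ TreePath M β (· = β x) (β x) x a := by
  by_cases hx : β x = x
  · rcases he with ⟨h1, h2⟩ | ⟨t, h1, h2⟩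
    · rw [hx]
      refine ⟨⟨hx, h1.ml, by rwa [h1.ml_eq]⟩, {x}, ?_, ?_⟩
      · rw [h1.ml_eq]; exact .nil
      · rintro s rfl; exact ⟨hx, Or.inl hx⟩
    · exact absurd hx (h.old x t h1 h2)
  · obtain ⟨m, n, hm, hn, hlt, -⟩ := h.base_lt x hx
    obtain ⟨m', a', hm', ha', hp, hle, -⟩ := h.maxLevel x hx
    obtain rfl := hm.unique hm'
    have := hm.2 a' ha'.1
    refine ⟨⟨h.base_idem x, hn.ml, by rw [hn.ml_eq]; omega⟩, ?_⟩
    obtain ⟨S, h1, h2⟩ := h.path x a hx ha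
    exact ⟨S, h1, fun s hs => ⟨h2 s hs, Or.inl (h2 s hs)⟩⟩

/-- A predecessor of `w` has level `ml M w - 1 ≤ i`, which is known by now; `live_base` supplies a
path to it at that level from the base of its blossom. This realizes the corresponding edge of `H`.
-/
theorem layers (h : MaxInv M i L β) : Layers M L β i where
  minLevel w hw := (h.minLevel w _).2 ⟨hw.2.1, by have := hw.2.2; omega⟩
  step w w' hw he := by
    obtain ⟨-, u, hu, rfl⟩ := h.hedge_iff.1 he
    obtain ⟨k, k1, k2, k3, k4⟩ := isPredecessor_iff.1 hu
    have hk := k1.ml_eq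
    have hki := hw.2.2
    obtain ⟨h1, S, h2, h3⟩ := h.live_base k2 (k2.early (i := i) (by omega))
    have hle := h2.le
    refine ⟨h1, by omega, u, S, ?_, fun s hs => (h3 s hs).1, k3, ?_⟩
    · rwa [hk, Nat.add_sub_cancel]
    · rw [k4, hk, Nat.add_sub_cancel]
  exists_step w hw hpos := by
    obtain ⟨k, hk⟩ : ∃ k, ml M w = k + 1 := ⟨ml M w - 1, by omega⟩
    have hmin := hw.2.1
    rw [hk] at hmin
    obtain ⟨u, h1, h2, h3⟩ := hmin.exists_pred
    exact ⟨β u, h.hedge_iff.2 ⟨⟨_, by have := hw.2.2; omega, hmin⟩, u,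
      isPredecessor_iff.2 ⟨k, hmin, h1, h2, h3⟩, rfl⟩⟩

/-- The minlevel of a vertex is at least that of the base of its blossom. -/
theorem ml_base_le (h : MaxInv M i L β) {s : V} (hl : Live M β i (β s)) :
    IsMin M s (ml M s) ∧ ml M (β s) ≤ ml M s := by
  by_cases hs : β s = s
  · rw [hs] at hl ⊢
    exact ⟨hl.2.1, le_rfl⟩
  · obtain ⟨m, n, hm, hn, hlt, -⟩ := h.base_lt s hs
    refine ⟨hm.ml, ?_⟩
    rw [hm.ml_eq, hn.ml_eq]
    exact hlt.le

theorem cert (hM : M.IsMatching) (h : MaxInv M i L β)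
    (hb : ∀ u v, IsBridge M u v → ETen M u v (2 * i + 1) → β u = β v) : Cert M i β :=
  Cert.of_sound hM h.prev h.matched h.mate (fun v hv => by
    obtain ⟨m, a, hm, ha, hp, hle, -⟩ := h.maxLevel v hv
    exact ⟨_, ⟨m, a, hm.isLevel, ha, hp, rfl⟩, hle⟩) h.old hb h.pred_closed h.old_edge

end MaxInv

/-! ### The blossom formed when a DDFS ends -/

/-- What is known about the bridge `xy` processed by the double depth first search. -/
structure BridgeData (M : G.Subgraph) (i : ℕ) (x y : V) (lx ly : ℕ) : Prop where
  adj : G.Adj x y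
  parx : M.Adj x y ↔ lx % 2 = 1
  pary : M.Adj x y ↔ ly % 2 = 1
  sum : lx + ly = 2 * i
  eq : M.Adj x y → lx = ly

/-- The state of affairs when the double depth first search has ended with bottleneck `b`. -/
structure EndInv (M : G.Subgraph) (L : Labels V) (β : V → V) (i : ℕ) (x y : V) (lx ly : ℕ)
    (colour : V → Option Colour) (b : V) : Prop where
  live : ∀ w, colour w ≠ none → Live M β i w
  red : ∀ w, colour w = some .red → TreePath M β (fun c => colour c = some .red) w x lx
  green : ∀ w, colour w = some .green → TreePath M β (fun c => colour c = some .green) w y ly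
  visx : colour (β x) ≠ none
  visy : colour (β y) ≠ none
  closed : ∀ w, colour w ≠ none → w ≠ b → ∀ u, L.HEdge w u → colour u ≠ none
  bred : colour b = some .red
  low : ∀ w, colour w ≠ none → w = b ∨ ml M b < ml M w
  alt : TreePath M β (fun c => c = b ∨ colour c = some .green) b y ly

/-- Both search paths have shrunk to their roots: the red one to the barrier, which is `b`, the
green one to a root out of edges or equal to `b`. Hence only `b` can have edges to unvisited
vertices. -/
theorem DInv.endInv {L : Labels V} {β : V → V} {i lx ly : ℕ} {x y b : V} {D : DDFS V} {A B : Set V}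
    (hD : DInv M L β i x y lx ly (β x) (β y) D A B) (he : D.EndsAt L b) :
    EndInv M L β i x y lx ly D.colour b := by
  obtain ⟨hm, hs, hroot, rfl⟩ := he
  obtain ⟨hzr, hbar, hB, hlow, halt⟩ := hD.greenSeeks hm
  have hA1 : A = {D.cR} := by
    have := hD.stackR
    rw [hbar] at this
    exact this.eq_singleton
  have hB1 : B = {D.cG} := by
    have := hD.stackG
    rw [hroot] at this ⊢
    exact this.eq_singleton
  refine ⟨hD.live, hD.red, hD.green, hD.rootR, hD.rootG, fun w hw hwb => ?_, hzr, hlow, halt⟩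
  rcases hD.closed w hw with h | h | h
  · rw [hA1] at h; exact absurd h hwb
  · rw [hB1] at h
    obtain rfl : w = D.cG := h
    rcases hs with hs | hs
    · exact absurd hs hwb
    · exact hs
  · exact h

/-- The red path up to `x`, the bridge, and the reversed green path form an augmenting path; it is
simple because the bases of the blossoms on the two sides have different colours. -/
theorem DInv.minAugLength_le {L : Labels V} {β : V → V} {i lx ly : ℕ} {x y r g : V} {D : DDFS V}
    {A B : Set V} (hL : Layers M L β i) (hxy : BridgeData M i x y lx ly)
    (hD : DInv M L β i x y lx ly r g D A B) (he : D.EndsDisjoint L) :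
    minAugLength M ≤ (2 * i + 1 : ℕ) := by
  obtain ⟨hm, hne, h0R, h0G⟩ := he
  obtain ⟨-, hA, hB, -⟩ := hD.normal hm
  have hR := hD.live _ (hD.visR _ hD.stackR.mem)
  have hG := hD.live _ (hD.visG _ hD.stackG.mem)
  rw [hL.minLevel _ hR] at h0R
  rw [hL.minLevel _ hG] at h0G
  have h0R : ml M D.cR = 0 := by exact_mod_cast h0R
  have h0G : ml M D.cG = 0 := by exact_mod_cast h0G
  have huR := hR.2.1.1
  have huG := hG.2.1.1
  rw [h0R] at huR
  rw [h0G] at huG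
  obtain ⟨S, h1, h2⟩ := hD.red _ (hA _ hD.stackR.mem)
  obtain ⟨S', h3, h4⟩ := hD.green _ (hB _ hD.stackG.mem)
  rw [h0R] at h1
  rw [h0G] at h3
  have hsum := hxy.sum
  have h5 := h1.append hxy.adj hxy.parx (h3.reverse (n := lx + 1) (by omega)) (fun s hs hs' => by
    have e1 : D.colour (β s) = _ := (h2 s hs).1
    have e2 : D.colour (β s) = _ := (h4 s hs').1
    rw [e1] at e2
    simp at e2)
  obtain ⟨p, p1, p2, p3, p4, p5⟩ := h5.exists_walk
  refine iInf_le_of_le D.cR (iInf_le_of_le D.cG (iInf_le_of_le p (iInf_le_of_le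
    ⟨huR.unmatched, huG.unmatched, hne, p1, p4⟩ ?_)))
  exact_mod_cast (by omega : p.length ≤ 2 * i + 1)

namespace EndInv

variable {L : Labels V} {β : V → V} {i lx ly : ℕ} {x y b : V} {colour : V → Option Colour}

theorem vis_base (hE : EndInv M L β i x y lx ly colour b) : colour b ≠ none := by
  simp [hE.bred]

/-- Edges of `H` lead from `w` downwards and, before `b`, do not leave the visited set, whose
deepest vertex is `b`. Each step enters the path of a strictly deeper base, which keeps the composed
path simple. -/
theorem down_path (hI : MaxInv M i L β) (hE : EndInv M L β i x y lx ly colour b) {w : V}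
    (hw : colour w ≠ none) : ∃ S, AltPath M b (ml M b) w (ml M w) S ∧
      ∀ s ∈ S, colour (β s) ≠ none ∧ (s = w ∨ ml M (β s) < ml M w) := by
  induction hn : ml M w using Nat.strong_induction_on generalizing w with
  | _ n ih =>
    by_cases hwb : w = b
    · subst hwb
      rw [← hn]
      refine ⟨{w}, .nil, ?_⟩
      rintro s rfl
      rw [(hE.live s hw).1]
      exact ⟨hw, Or.inl rfl⟩
    · have hlw := hE.live w hw
      have hlt := (hE.low w hw).resolve_left hwb
      obtain ⟨w₁, he⟩ := hI.layers.exists_step w hlw (by omega)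
      have hw₁ := hE.closed w hw hwb w₁ he
      obtain ⟨hl₁, hlt₁, u, S', h1, h2, h3, h4⟩ := hI.layers.step w w₁ hlw he
      obtain ⟨S, h5, h6⟩ := ih (ml M w₁) (by omega) hw₁ rfl
      have h7 := h5.trans h1 (fun s hs hs' => by
        rcases (h6 s hs).2 with h | h
        · exact h
        · rw [h2 s hs'] at h; omega)
      have h8 := h7.snoc h3 h4 (v := w) (by
        rintro (hs | hs)
        · rcases (h6 w hs).2 with h | h
          · rw [h] at hlt₁; omega
          · rw [hlw.1] at h; omega
        · have := h2 w hs
          rw [hlw.1] at this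
          rw [this] at hlt₁; omega)
      rw [show ml M w - 1 + 1 = n by omega] at h8
      refine ⟨_, h8, ?_⟩
      rintro s (rfl | hs | hs)
      · rw [hlw.1]; exact ⟨hw, Or.inl rfl⟩
      · refine ⟨(h6 s hs).1, Or.inr ?_⟩
        rcases (h6 s hs).2 with h | h
        · rw [h, hl₁.1]; omega
        · omega
      · rw [h2 s hs]; exact ⟨hw₁, Or.inr (by omega)⟩

/-- The path climbs from `b` on the side opposite to the colour of `w`, crosses the bridge and
descends in the tree of `w`. As `b` is red, the climb needed for a red `w` is the alternative path
of `b` to the green end. -/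
theorem max_path (hxy : BridgeData M i x y lx ly)
    (hE : EndInv M L β i x y lx ly colour b) {w : V} (hw : colour w ≠ none) (hwb : w ≠ b) :
    ∃ S, AltPath M b (ml M b) w (2 * i + 1 - ml M w) S ∧ ∀ s ∈ S, colour (β s) ≠ none := by
  have hsum := hxy.sum
  have hlt := (hE.low w hw).resolve_left hwb
  obtain ⟨col, hcol⟩ := Option.ne_none_iff_exists'.1 hw
  cases col with
  | red =>
    obtain ⟨S, h1, h2⟩ := hE.red w hcol
    obtain ⟨S', h3, h4⟩ := hE.alt
    have hle := h1.le
    have h5 := h3.append hxy.adj.symm (by rw [M.adj_comm, hxy.pary])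
      (h1.reverse (n := ly + 1) (by omega)) (fun s hs hs' => by
        obtain ⟨e1, e2⟩ := h2 s hs'
        rcases (h4 s hs).1 with e3 | e3
        · rw [e3] at e2
          rcases e2 with e2 | e2
          · exact hwb e2.symm
          · omega
        · rw [e1] at e3; simp at e3)
    rw [show ly + 1 + (lx - ml M w) = 2 * i + 1 - ml M w by omega] at h5
    refine ⟨_, h5, ?_⟩
    rintro s (hs | hs)
    · rcases (h4 s hs).1 with e | e
      · rw [e]; exact hE.vis_base
      · simp [e]
    · simp [(h2 s hs).1]
  | green =>
    obtain ⟨S, h1, h2⟩ := hE.green w hcol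
    obtain ⟨S', h3, h4⟩ := hE.red b hE.bred
    have hle := h1.le
    have h5 := h3.append hxy.adj hxy.parx
      (h1.reverse (n := lx + 1) (by omega)) (fun s hs hs' => by
        have e1 : colour (β s) = _ := (h2 s hs').1
        have e3 : colour (β s) = _ := (h4 s hs).1
        rw [e1] at e3; simp at e3)
    rw [show lx + 1 + (ly - ml M w) = 2 * i + 1 - ml M w by omega] at h5
    refine ⟨_, h5, ?_⟩
    rintro s (hs | hs)
    · simp [(h4 s hs).1]
    · simp [(h2 s hs).1]

/-- Prefix a minlevel path of `b`: its other vertices have minlevel below that of `b`, whereas the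
blossoms used above `b` contain no such vertex. A smaller level would give tenacity below `2 i`, and
`w` would not be a base. -/
theorem isLevel_max (hI : MaxInv M i L β) (hxy : BridgeData M i x y lx ly)
    (hE : EndInv M L β i x y lx ly colour b) {w : V} (hw : colour w ≠ none) (hwb : w ≠ b) :
    IsLevel M w (2 * i + 1 - ml M w) := by
  obtain ⟨S, h1, h2⟩ := hE.max_path hxy hw hwb
  have hlb := hE.live b hE.vis_base
  obtain ⟨f, S₀, hf, h0⟩ := hlb.2.1.1
  have h3 := h0.trans h1 (fun s hs hs' => by
    by_contra hsb
    obtain ⟨j, hj, -, hlt⟩ := h0.exists_reach hf hs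
    have hlt := hlt hsb
    obtain ⟨hm, hle⟩ := hI.ml_base_le (hE.live _ (h2 s hs'))
    have := hm.2 j hj
    rcases hE.low _ (h2 s hs') with h | h
    · rw [h] at hle; omega
    · omega)
  have hlw := hE.live w hw
  have hmi := hlw.2.2
  obtain ⟨k, hk, hpar, hkle⟩ := Reach.exists_isLevel ⟨f, _, hf, h3⟩
  have hten : Ten M w (ml M w + k) := ⟨_, k, hlw.2.1.isLevel, hk, by omega, rfl⟩
  have : ¬ ml M w + k + 1 ≤ 2 * i := fun h => hI.old w _ hten h hlw.1
  rwa [show 2 * i + 1 - ml M w = k by omega]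

/-- From an odd `b` that is not an end of the bridge, both tree paths would start with its matched
edge. The base of the mate would be red, and also `b` or green, hence `b`; but then closure under
mates would put `b` in a blossom without being its base. If `b` is an end, the bridge is matched and
has equal oddlevels, so both ends would coincide. -/
theorem even_base (hM : M.IsMatching) (hI : MaxInv M i L β) (hxy : BridgeData M i x y lx ly)
    (hE : EndInv M L β i x y lx ly colour b) : ml M b % 2 = 0 := by
  by_contra hodd
  have hodd : ml M b % 2 = 1 := by omega
  have hlb := hE.live b hE.vis_base
  obtain ⟨S, h1, h2⟩ := hE.red b hE.bred
  obtain ⟨S', h3, h4⟩ := hE.alt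
  by_cases hbx : b = x
  · subst hbx
    have e1 := h1.level_eq_of_eq
    have hadj := hxy.parx.2 (by omega)
    have e2 := hxy.eq hadj
    rw [show ly = ml M b by omega] at h3
    exact hadj.ne h3.eq_of_level_eq.symm
  · by_cases hby : b = y
    · subst hby
      have e1 := h3.level_eq_of_eq
      have hadj := hxy.pary.2 (by omega)
      have e2 := hxy.eq hadj
      rw [show lx = ml M b by omega] at h1
      exact hadj.ne h1.eq_of_level_eq
    · obtain ⟨c, hc, -, c1⟩ := h1.exists_second hbx
      obtain ⟨c', hc', -, c2⟩ := h3.exists_second hby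
      have hbc := c1.2 hodd
      obtain rfl := hM.eq_of_adj_left hbc (c2.2 hodd)
      have hred : colour (β c) = some .red := (h2 c hc).1
      have hβc : β c = b := (h4 c hc').1.resolve_right (by simp [hred])
      have hcc : β c ≠ c := by rw [hβc]; exact hbc.ne
      exact (hI.mate c b hcc hbc.symm).2 hlb.1

/-- If `w` is outer, its mate is a predecessor and has been visited. If `w` is inner, the tree path
upwards starts with the matched edge, unless `w` is an end of the bridge and the mate is the other
end. The mate of `b` itself is deeper than `b` and therefore not found. -/
theorem mate_vis (hM : M.IsMatching) (hI : MaxInv M i L β) (hxy : BridgeData M i x y lx ly)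
    (hE : EndInv M L β i x y lx ly colour b) {w c : V} (hw : colour w ≠ none) (hwb : w ≠ b)
    (hwc : M.Adj w c) : colour c ≠ none ∧ c ≠ b := by
  have hlw := hE.live w hw
  have hlt := (hE.low w hw).resolve_left hwb
  have hcb : c ≠ b := by
    rintro rfl
    obtain ⟨j, hj, hj'⟩ := (hE.live c hE.vis_base).2.1.isLevel.mate_of_even hM hwc
      (hE.even_base hM hI hxy)
    have := hlw.2.1.2 j hj'.1
    omega
  have hβc : β c = c := by
    by_contra h
    exact (hI.mate c w h hwc.symm).2 hlw.1
  refine ⟨?_, hcb⟩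
  rcases Nat.mod_two_eq_zero_or_one (ml M w) with h0 | h0
  · obtain ⟨k, hk, hk'⟩ := hlw.2.1.isLevel.mate_of_even hM hwc.symm h0
    have hmin := hlw.2.1
    rw [hk] at hmin
    refine hE.closed w hw hwb c (hI.hedge_iff.2 ⟨⟨_, ?_, hlw.2.1⟩, c, ?_, hβc⟩)
    · have := hlw.2.2; omega
    · exact isPredecessor_iff.2 ⟨k, hmin, hk', hwc.symm.adj_sub,
        iff_of_true hwc.symm (by omega)⟩
  · obtain ⟨col, hcol⟩ := Option.ne_none_iff_exists'.1 hw
    cases col with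
    | red =>
      obtain ⟨S, h1, h2⟩ := hE.red w hcol
      by_cases hwx : w = x
      · subst hwx
        have hadj := hxy.parx.2 (by rw [h1.level_eq_of_eq]; exact h0)
        obtain rfl := hM.eq_of_adj_left hwc hadj
        have := hE.visy
        rwa [hβc] at this
      · obtain ⟨c', hc', -, h3⟩ := h1.exists_second hwx
        obtain rfl := hM.eq_of_adj_left hwc (h3.2 h0)
        have h4 : colour (β c) = _ := (h2 c hc').1
        rw [hβc] at h4
        simp [h4]
    | green =>
      obtain ⟨S, h1, h2⟩ := hE.green w hcol
      by_cases hwx : w = y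
      · subst hwx
        have hadj := hxy.pary.2 (by rw [h1.level_eq_of_eq]; exact h0)
        obtain rfl := hM.eq_of_adj_left hwc hadj.symm
        have := hE.visx
        rwa [hβc] at this
      · obtain ⟨c', hc', -, h3⟩ := h1.exists_second hwx
        obtain rfl := hM.eq_of_adj_left hwc (h3.2 h0)
        have h4 : colour (β c) = _ := (h2 c hc').1
        rw [hβc] at h4
        simp [h4]

open Classical in
/-- `bud*` after the blossom of the search has been formed. -/
noncomputable def newBase (β : V → V) (colour : V → Option Colour) (b v : V) : V :=
  if colour (β v) ≠ none then b else β v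

theorem newBase_of_vis {v : V} (h : colour (β v) ≠ none) : newBase β colour b v = b := if_pos h

theorem newBase_of_not_vis {v : V} (h : ¬ colour (β v) ≠ none) : newBase β colour b v = β v :=
  if_neg h

theorem newBase_congr {u v : V} (h : β u = β v) :
    newBase β colour b u = newBase β colour b v := by
  unfold newBase; rw [h]

theorem newBase_ne_iff (hE : EndInv M L β i x y lx ly colour b) {v : V} :
    newBase β colour b v ≠ v ↔ β v ≠ v ∨ (colour v ≠ none ∧ v ≠ b) := by
  have hb := (hE.live b hE.vis_base).1
  by_cases hv : colour (β v) ≠ none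
  · rw [newBase_of_vis hv]
    by_cases hβ : β v = v
    · rw [hβ] at hv
      simp only [hβ, ne_eq, not_true_eq_false, false_or]
      exact ⟨fun h => ⟨hv, fun h' => h h'.symm⟩, fun h h' => h.2 h'.symm⟩
    · refine iff_of_true ?_ (Or.inl hβ)
      rintro rfl; exact hβ hb
  · rw [newBase_of_not_vis hv]
    refine ⟨Or.inl, ?_⟩
    rintro (h | ⟨h, -⟩)
    · exact h
    · rw [(hE.live v h).1] at hv; exact absurd h hv

/-- Forming the petal of all vertices found by the search preserves the invariant. -/
theorem maxInv (hM : M.IsMatching) (hI : MaxInv M i L β) (hxy : BridgeData M i x y lx ly)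
    (hE : EndInv M L β i x y lx ly colour b) {P : Set V}
    (hP : ∀ w, w ∈ P ↔ colour w ≠ none ∧ w ≠ b) :
    MaxInv M i (assignPetal i P b L) (newBase β colour b) := by
  classical
  have hb := hE.live b hE.vis_base
  have hbP : b ∉ P := fun h => ((hP b).1 h).2 rfl
  have hbud : ∀ w ∈ P, L.bud w = w := fun w hw =>
    hI.bud_eq_iff.2 (hE.live w ((hP w).1 hw).1).1
  have hne : ∀ v, newBase β colour b v ≠ v ↔ β v ≠ v ∨ v ∈ P := fun v => by
    rw [newBase_ne_iff hE, hP]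
  have hPbase : ∀ w ∈ P, newBase β colour b w = b := fun w hw => by
    have h1 := ((hP w).1 hw).1
    exact newBase_of_vis (by rwa [(hE.live w h1).1])
  have hPml : ∀ w ∈ P, ml M b < ml M w := fun w hw =>
    (hE.low w ((hP w).1 hw).1).resolve_left ((hP w).1 hw).2
  refine ⟨⟨hI.prev, ?_, ?_, ?_, ?_, ?_, ?_, ?_, ?_, ?_, ?_⟩, hI.minLevel, hI.preds⟩
  · intro v hv
    have := mt (hne v).2 (not_not.2 hv)
    push Not at this
    change (if v ∈ P then _ else _) = _
    rw [if_neg this.2]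
    exact hI.maxLevel_base v this.1
  · intro v hv
    change ∃ m a : ℕ, _ ∧ _ ∧ _ ∧ _ ∧ (if v ∈ P then _ else _) = _
    by_cases hvP : v ∈ P
    · have hvis := (hP v).1 hvP
      have hl := hE.live v hvis.1
      have hle := hl.2.2
      refine ⟨ml M v, 2 * i + 1 - ml M v, hl.2.1, hE.isLevel_max hI hxy hvis.1 hvis.2, by omega,
        by omega, ?_⟩
      rw [if_pos hvP, hI.layers.minLevel v hl]
      norm_cast
    · rw [if_neg hvP]
      exact hI.maxLevel v (((hne v).1 hv).resolve_right hvP)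
  · intro v
    -- Found vertices were ends of chains of `bud` and now point to `b`. A chain that ended at one
    -- of them is prolonged by this one step.
    have key : ∀ v c, L.BudStar v c → (assignPetal i P b L).BudStar v
        (if colour c ≠ none then b else c) := by
      intro v c h
      have bself : (assignPetal i P b L).BudStar b b := .self b (by
        change (if b ∈ P then _ else _) = _
        rw [if_neg hbP]
        exact hI.bud_eq_iff.2 hb.1)
      induction h with
      | self v h =>
        by_cases hvP : v ∈ P
        · have hvis := (hP v).1 hvP
          rw [if_pos hvis.1]
          have hbv : (assignPetal i P b L).bud v = b := if_pos hvP
          refine .next v b ?_ ?_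
          · rw [hbv]; exact hvis.2.symm
          · rwa [hbv]
        · have hbv : (assignPetal i P b L).bud v = v := by
            change (if v ∈ P then _ else _) = _
            rw [if_neg hvP, h]
          by_cases hvis : colour v ≠ none
          · have : v = b := by
              by_contra hvb
              exact hvP ((hP v).2 ⟨hvis, hvb⟩)
            rw [if_pos hvis, this]
            exact bself
          · rw [if_neg hvis]
            exact .self v hbv
      | next v c h h' ih =>
        have hvP : v ∉ P := fun hv => h (hbud v hv)
        have hbv : (assignPetal i P b L).bud v = L.bud v := if_neg hvP
        refine .next v _ ?_ ?_
        · rwa [hbv]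
        · rwa [hbv]
    exact key v _ (hI.star v)
  · intro v hv
    by_cases hvis : colour (β v) ≠ none
    · rw [newBase_of_vis hvis]
      rcases hE.low _ hvis with h | h
      · have hv' : β v ≠ v := by
          rcases (hne v).1 hv with h' | h'
          · exact h'
          · rw [h]; rintro rfl; exact hbP h'
        obtain ⟨m, n, h1, h2, h3, h4⟩ := hI.base_lt v hv'
        rw [h] at h2
        exact ⟨m, n, h1, h2, h3, h4⟩
      · obtain ⟨h1, h2⟩ := hI.ml_base_le (hE.live _ hvis)
        exact ⟨_, _, h1, hb.2.1, by omega, hE.even_base hM hI hxy⟩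
    · rw [newBase_of_not_vis hvis] at hv ⊢
      exact hI.base_lt v hv
  · intro v hv
    rcases (hne v).1 hv with h | h
    · exact hI.matched v h
    · by_contra hex
      push Not at hex
      have hun : Unmatched M v := hex
      have := (hE.live v ((hP v).1 h).1).2.1.2 0 hun.reach_zero
      have := hPml v h
      omega
  · intro v w hv hvw
    rcases (hne v).1 hv with h | h
    · obtain ⟨h1, h2⟩ := hI.mate v w h hvw
      exact ⟨newBase_congr h1, (hne w).2 (Or.inl h2)⟩
    · have hvis := (hP v).1 h
      have hw : w ∈ P := (hP w).2 (hE.mate_vis hM hI hxy hvis.1 hvis.2 hvw)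
      exact ⟨by rw [hPbase w hw, hPbase v h], (hne w).2 (Or.inr hw)⟩
  · exact fun v t h1 h2 => (hne v).2 (Or.inl (hI.old v t h1 h2))
  · exact fun u v t h1 h2 h3 h4 => newBase_congr (hI.old_edge u v t h1 h2 h3 h4)
  · intro u v hv hu
    rcases (hne v).1 hv with h | h
    · exact newBase_congr (hI.pred_closed u v h hu)
    · have hvis := (hP v).1 h
      have hl := hE.live v hvis.1
      rw [hPbase v h, newBase_of_vis]
      refine hE.closed v hvis.1 hvis.2 _ (hI.hedge_iff.2 ⟨⟨_, ?_, hl.2.1⟩, u, hu, rfl⟩)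
      have := hl.2.2
      omega
  · intro v k hv hk
    -- For a vertex of an absorbed blossom, the old path from its base is preceded by the way from
    -- `b` to that base.
    have old : β v ≠ v → ∃ S, AltPath M (newBase β colour b v) (ml M (newBase β colour b v)) v k S ∧
        ∀ s ∈ S, newBase β colour b s = newBase β colour b v := by
      intro hβ
      obtain ⟨S, h1, h2⟩ := hI.path v k hβ hk
      by_cases hvis : colour (β v) ≠ none
      · obtain ⟨S', h3, h4⟩ := hE.down_path hI hvis
        rw [newBase_of_vis hvis]
        refine ⟨_, h3.trans h1 (fun s hs hs' => ?_), ?_⟩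
        · rcases (h4 s hs).2 with h | h
          · exact h
          · rw [h2 s hs'] at h; omega
        · rintro s (hs | hs)
          · exact newBase_of_vis (h4 s hs).1
          · exact newBase_of_vis (by rwa [h2 s hs])
      · rw [newBase_of_not_vis hvis]
        exact ⟨S, h1, fun s hs => by rw [newBase_of_not_vis, h2 s hs]; rwa [h2 s hs]⟩
    rcases (hne v).1 hv with h | h
    · exact old h
    · have hvis := (hP v).1 h
      have hl := hE.live v hvis.1
      have hle := hl.2.2
      rw [hPbase v h]
      by_cases hpar : k % 2 = ml M v % 2
      · obtain rfl := hk.unique hl.2.1.isLevel hpar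
        obtain ⟨S, h1, h2⟩ := hE.down_path hI hvis.1
        exact ⟨S, h1, fun s hs => newBase_of_vis (h2 s hs).1⟩
      · obtain rfl := hk.unique (hE.isLevel_max hI hxy hvis.1 hvis.2) (by omega)
        obtain ⟨S, h1, h2⟩ := hE.max_path hxy hvis.1 hvis.2
        exact ⟨S, h1, fun s hs => newBase_of_vis (h2 s hs)⟩

end EndInv

/-! ### The lists of bridges, and the invariant of MIN -/

theorem Labels.BudStar.congr {L L' : Labels V} (hb : L'.bud = L.bud) {v b : V}
    (h : L.BudStar v b) : L'.BudStar v b := by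
  induction h with
  | self v h => exact .self v (by rwa [hb])
  | next v b h _ ih => exact .next v b (by rwa [hb]) (by rwa [hb])

theorem Blossoms.congr {L L' : Labels V} {i : ℕ} {β : V → V} (h : Blossoms M i L β)
    (hm : L'.maxLevel = L.maxLevel) (hb : L'.bud = L.bud) : Blossoms M i L' β :=
  { h with
    maxLevel_base := by rw [hm]; exact h.maxLevel_base
    maxLevel := by rw [hm]; exact h.maxLevel
    star := fun v => (h.star v).congr hb }

section Known

variable {L : Labels V} {u v : V} {a b t : ℕ}

theorem Labels.HasLevel.knownTenacity (hu : L.HasLevel u a) (hv : L.HasLevel v b)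
    (ha : M.Adj u v ↔ a % 2 = 1) (hb : M.Adj u v ↔ b % 2 = 1) :
    L.KnownTenacity M u v (a + b + 1) := by
  refine ⟨a, b, hu, hv, ?_, rfl⟩
  by_cases h : M.Adj u v
  · exact Or.inl ⟨h, Nat.odd_iff.2 (ha.1 h), Nat.odd_iff.2 (hb.1 h)⟩
  · have ha : ¬ a % 2 = 1 := fun h' => h (ha.2 h')
    have hb : ¬ b % 2 = 1 := fun h' => h (hb.2 h')
    exact Or.inr ⟨h, Nat.even_iff.2 (by omega), Nat.even_iff.2 (by omega)⟩

theorem Labels.KnownTenacity.eTen (h : L.KnownTenacity M u v t)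
    (hs : ∀ v k, L.HasLevel v k → IsLevel M v k) : ETen M u v t := by
  obtain ⟨j, k, hj, hk, hp, rfl⟩ := h
  refine ⟨j, k, hs _ _ hj, hs _ _ hk, ?_, ?_, rfl⟩ <;>
    rcases hp with ⟨h1, h2, h3⟩ | ⟨h1, h2, h3⟩
  · exact iff_of_true h1 (Nat.odd_iff.1 h2)
  · exact iff_of_false h1 (by have := Nat.even_iff.1 h2; omega)
  · exact iff_of_true h1 (Nat.odd_iff.1 h3)
  · exact iff_of_false h1 (by have := Nat.even_iff.1 h3; omega)

end Known

/-- The invariant of the lists of bridges: a bridge is in its list once one of its ends is an inner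
vertex in a blossom, and the other one is in a blossom or outer with minlevel less than `N`. -/
structure BrInv (M : G.Subgraph) (N : ℕ) (L : Labels V) (β : V → V) : Prop where
  props : ∀ u v, s(u, v) ∈ L.props ↔ u ∈ L.preds v ∨ v ∈ L.preds u
  sound : ∀ u v t, s(u, v) ∈ L.br t → IsBridge M u v ∧ ETen M u v t
  inner : ∀ u v t, IsBridge M u v → ¬ M.Adj u v → ETen M u v t → β v ≠ v → ml M v % 2 = 1 →
    (β u ≠ u ∨ (IsMin M u (ml M u) ∧ ml M u % 2 = 0 ∧ ml M u < N)) → s(u, v) ∈ L.br t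

/-- The edge `uv` has been scanned by MIN at a search level less than `N`. -/
def OldScanned (M : G.Subgraph) (N : ℕ) (u v : V) : Prop :=
  ∃ k < N, G.Adj u v ∧ (M.Adj u v ↔ k % 2 = 1) ∧ (IsLevel M u k ∨ IsLevel M v k)

/-- The pair `(u, v)` has been scanned by MIN at search level `i`. -/
def Done (M : G.Subgraph) (i : ℕ) (todo : Set (V × V)) (u v : V) : Prop :=
  IsLevel M u i ∧ G.Adj u v ∧ (M.Adj u v ↔ i % 2 = 1) ∧ (u, v) ∉ todo

/-- The invariant of the labels during MIN at search level `i`. -/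
structure MinInv (M : G.Subgraph) (i : ℕ) (L : Labels V) (β : V → V) (todo : Set (V × V)) : Prop
    extends Blossoms M i L β where
  small : ∀ v, β v ≠ v → ∃ t, Ten M v t ∧ t + 1 ≤ 2 * i
  todo_sub : ∀ u v, (u, v) ∈ todo → IsLevel M u i ∧ G.Adj u v ∧ (M.Adj u v ↔ i % 2 = 1)
  minLevel : ∀ v (m : ℕ), L.minLevel v = m ↔
    IsMin M v m ∧ (m ≤ i ∨ m = i + 1 ∧ ∃ u, Done M i todo u v)
  preds : ∀ u v, u ∈ L.preds v ↔
    IsPredecessor M u v ∧ ∃ m, IsMin M v m ∧ (m ≤ i ∨ m = i + 1 ∧ (u, v) ∉ todo)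
  br : BrInv M i L β
  scanned : ∀ u v, s(u, v) ∈ L.scanned ↔
    OldScanned M i u v ∨ Done M i todo u v ∨ Done M i todo v u
  scan : ∀ u v k, Done M i todo u v → IsBridge M u v → IsLevel M v k → k % 2 = i % 2 →
    Early M i v k → s(u, v) ∈ L.br (i + k + 1)

namespace MinInv

variable {i : ℕ} {L : Labels V} {β : V → V} {todo : Set (V × V)}

theorem isLevel (h : MinInv M i L β todo) {v : V} {k : ℕ} (hk : L.HasLevel v k) :
    IsLevel M v k := by
  rcases hk with hk | hk
  · exact ((h.minLevel v k).1 hk).1.isLevel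
  · by_cases hv : β v = v
    · rw [h.maxLevel_base v hv] at hk
      simp at hk
    · obtain ⟨m, a, -, ha, -, -, h1⟩ := h.maxLevel v hv
      rw [h1] at hk
      have : a = k := by exact_mod_cast hk
      rwa [← this]

theorem hasLevel (h : MinInv M i L β todo) {v : V} {k : ℕ} (hk : IsLevel M v k)
    (he : Early M i v k) : L.HasLevel v k := by
  rcases he with ⟨h1, h2⟩ | ⟨t, h1, h2⟩
  · exact Or.inl ((h.minLevel v k).2 ⟨h1, Or.inl h2⟩)
  · obtain ⟨m, a, hm, ha, hp, hle, h3⟩ := h.maxLevel v (h.old v t h1 h2)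
    by_cases hpar : k % 2 = m % 2
    · obtain rfl := hk.unique hm.isLevel hpar
      have := hm.2 a ha.1
      exact Or.inl ((h.minLevel v k).2 ⟨hm, Or.inl (by omega)⟩)
    · obtain rfl := hk.unique ha (by omega)
      exact Or.inr h3

/-- The passage to the situation after `(u, v)` has been scanned. -/
theorem done_diff {u v : V} (h : MinInv M i L β todo) (huv : (u, v) ∈ todo) (a b : V) :
    Done M i (todo \ {(u, v)}) a b ↔ Done M i todo a b ∨ (a = u ∧ b = v) := by
  unfold Done
  simp only [Set.mem_sdiff, Set.mem_singleton_iff, Prod.mk.injEq]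
  constructor
  · rintro ⟨h1, h2, h3, h4⟩
    by_cases h5 : a = u ∧ b = v
    · exact Or.inr h5
    · exact Or.inl ⟨h1, h2, h3, fun h6 => h4 ⟨h6, h5⟩⟩
  · rintro (⟨h1, h2, h3, h4⟩ | ⟨rfl, rfl⟩)
    · exact ⟨h1, h2, h3, fun h5 => h4 h5.1⟩
    · obtain ⟨h1, h2, h3⟩ := h.todo_sub a b huv
      exact ⟨h1, h2, h3, fun h5 => h5.2 ⟨rfl, rfl⟩⟩

theorem minLevel_diff {u v : V} (h : MinInv M i L β todo) (huv : (u, v) ∈ todo)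
    (hv : ∃ m ≤ i, IsMin M v m) (w : V) (m : ℕ) : L.minLevel w = m ↔
      IsMin M w m ∧ (m ≤ i ∨ m = i + 1 ∧ ∃ a, Done M i (todo \ {(u, v)}) a w) := by
  rw [h.minLevel]
  refine and_congr_right fun hm => or_congr_right (and_congr_right fun hmi => ?_)
  refine exists_congr fun a => ?_
  rw [h.done_diff huv, iff_self_or]
  rintro ⟨-, rfl⟩
  obtain ⟨m', hm', h'⟩ := hv
  have := hm.unique h'
  omega

theorem preds_diff {u v : V} (h : MinInv M i L β todo)
    (hv : ∃ m ≤ i, IsMin M v m) (a w : V) : a ∈ L.preds w ↔ IsPredecessor M a w ∧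
      ∃ m, IsMin M w m ∧ (m ≤ i ∨ m = i + 1 ∧ (a, w) ∉ todo \ {(u, v)}) := by
  rw [h.preds]
  refine and_congr_right fun _ => exists_congr fun m => and_congr_right fun hm =>
    or_congr_right (and_congr_right fun hmi => ?_)
  refine ⟨fun h1 h2 => h1 h2.1, fun h1 h2 => h1 ⟨h2, fun h3 => ?_⟩⟩
  obtain ⟨-, rfl⟩ := Prod.mk.inj h3
  obtain ⟨m', hm', h'⟩ := hv
  have := hm.unique h'
  omega

/-- The three cases are an edge scanned before, a prop and a bridge. In the first, nothing is
assigned, so it must be shown that the minlevel of `v` is known and that a bridge already is in its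
list. -/
theorem scan_step (hM : M.IsMatching) (h : MinInv M i L β todo) {u v : V} (huv : (u, v) ∈ todo) :
    MinInv M i (MV.scan M i u v L) β (todo \ {(u, v)}) := by
  classical
  obtain ⟨hu, hadj, hpar⟩ := h.todo_sub u v huv
  have hsub : ∀ a b, (a, b) ∈ todo \ {(u, v)} →
      IsLevel M a i ∧ G.Adj a b ∧ (M.Adj a b ↔ i % 2 = 1) := fun a b hab => h.todo_sub a b hab.1
  by_cases hsc : s(u, v) ∈ L.scanned
  · have hL : MV.scan M i u v L = L := if_pos hsc
    rw [hL]
    obtain ⟨k, hk, hki, hkpar⟩ : ∃ k, IsLevel M v k ∧ k ≤ i ∧ k % 2 = i % 2 := by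
      rcases (h.scanned u v).1 hsc with ⟨k, hk, -, h1, h2⟩ | h1 | h1
      · have hp : k % 2 = 1 ↔ i % 2 = 1 := h1.symm.trans hpar
        rcases h2 with h2 | h2
        · have := h2.unique hu (by omega)
          omega
        · exact ⟨k, h2, hk.le, by omega⟩
      · exact absurd huv h1.2.2.2
      · exact ⟨i, h1.1, le_rfl, rfl⟩
    have hv : ∃ m ≤ i, IsMin M v m := by
      obtain ⟨m, hm, hmk⟩ := hk.1.exists_isMin
      exact ⟨m, by omega, hm⟩
    refine ⟨h.toBlossoms, h.small, hsub, h.minLevel_diff huv hv, h.preds_diff hv, h.br, ?_, ?_⟩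
    · intro a b
      rw [h.scanned, h.done_diff huv, h.done_diff huv]
      constructor
      · tauto
      · rintro (h1 | (h1 | ⟨rfl, rfl⟩) | (h1 | ⟨rfl, rfl⟩))
        · exact Or.inl h1
        · exact Or.inr (Or.inl h1)
        · exact (h.scanned _ _).1 hsc
        · exact Or.inr (Or.inr h1)
        · rw [Sym2.eq_swap] at hsc; exact (h.scanned _ _).1 hsc
    · intro a b k' hab hbr hk' hpar' he
      rcases (h.done_diff huv a b).1 hab with hab | ⟨rfl, rfl⟩
      · exact h.scan a b k' hab hbr hk' hpar' he
      · obtain rfl := hk.unique hk' (by omega)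
        -- A scan at a level `n < i` came from `b`. Then `later_end` makes `a` an inner vertex of
        -- tenacity below `2 i`, and `BrInv.inner` has the bridge listed. Otherwise the edge was
        -- scanned from `b` at the present level.
        rcases (h.scanned a b).1 hsc with ⟨n, hn, -, h1, h2⟩ | h1 | h1
        · have hp : n % 2 = 1 ↔ i % 2 = 1 := h1.symm.trans hpar
          have hkn : IsLevel M b n := by
            rcases h2 with h2 | h2
            · have := h2.unique hu (by omega)
              omega
            · exact h2
          obtain rfl := hk.unique hkn (by omega)
          have hbpar : M.Adj b a ↔ k % 2 = 1 := by rw [M.adj_comm, h1]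
          obtain ⟨m, hm, hma, hmb⟩ := hbr.symm.later_end hk hu hbpar
            (by rw [M.adj_comm, hpar]) hn
          have hnM : ¬ M.Adj b a := fun hadj' => by
            have := (hbr.symm.eq_of_matched hM hadj' hk hu (hbpar.1 hadj')
              (hpar.1 hadj'.symm)).1
            omega
          have hk0 : ¬ k % 2 = 1 := fun h' => hnM (hbpar.2 h')
          have hten : ETen M b a (i + k + 1) :=
            ⟨k, i, hk, hu, hbpar, by rw [M.adj_comm, hpar], by omega⟩
          rw [Sym2.eq_swap]
          refine h.br.inner b a _ hbr.symm hnM hten ?_ (by rw [hm.ml_eq]; omega) ?_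
          · exact h.old a _ ⟨m, i, hm.isLevel, hu, hmb, rfl⟩ (by omega)
          · rcases hk.early (i := i) hki with ⟨h3, -⟩ | ⟨t, h3, h4⟩
            · exact Or.inr ⟨h3.ml, by rw [h3.ml_eq]; omega, by rw [h3.ml_eq]; omega⟩
            · exact Or.inl (h.old b t h3 h4)
        · exact absurd huv h1.2.2.2
        · obtain rfl := h1.1.unique hk (by omega)
          rw [Sym2.eq_swap]
          exact h.scan b a i h1 hbr.symm hu rfl (hu.early le_rfl)
  · by_cases hml : (i + 1 : ℕ∞) ≤ L.minLevel v
    · have hL : MV.scan M i u v L = { L with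
          minLevel := Function.update L.minLevel v (i + 1)
          preds := Function.update L.preds v (insert u (L.preds v))
          scanned := insert s(u, v) L.scanned
          props := insert s(u, v) L.props } := by
        unfold MV.scan
        rw [if_neg hsc, if_pos hml]
      -- The scan shows that the minlevel of `v` is at most `i + 1`; a smaller value would be
      -- assigned already and contradict the test.
      have hmin : IsMin M v (i + 1) := by
        obtain ⟨m, hmi, hm⟩ := hu.1.exists_isMin_of_adj hadj hpar
        by_cases hlt : m ≤ i
        · rw [(h.minLevel v m).2 ⟨hm, Or.inl hlt⟩] at hml
          have : i + 1 ≤ m := by exact_mod_cast hml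
          omega
        · rwa [show i + 1 = m by omega]
      have hpred : IsPredecessor M u v := isPredecessor_iff.2 ⟨i, hmin, hu, hadj, hpar⟩
      have hmem : ∀ a w, a ∈ Function.update L.preds v (insert u (L.preds v)) w ↔
          a ∈ L.preds w ∨ (a = u ∧ w = v) := by
        intro a w
        by_cases hw : w = v
        · subst hw
          simp [or_comm]
        · simp [hw]
      rw [hL]
      refine ⟨h.toBlossoms.congr rfl rfl, h.small, hsub, ?_, ?_, ⟨?_, h.br.sound, h.br.inner⟩,
        ?_, ?_⟩
      · intro w m
        by_cases hw : w = v
        · subst hw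
          simp only [Function.update_self]
          constructor
          · intro hm
            have : i + 1 = m := by exact_mod_cast hm
            subst this
            exact ⟨hmin, Or.inr ⟨rfl, u, (h.done_diff huv _ _).2 (Or.inr ⟨rfl, rfl⟩)⟩⟩
          · rintro ⟨h1, -⟩
            obtain rfl := h1.unique hmin
            norm_cast
        · simp only [Function.update_of_ne hw]
          rw [h.minLevel]
          refine and_congr_right fun hm => or_congr_right (and_congr_right fun hmi => ?_)
          refine exists_congr fun a => ?_
          rw [h.done_diff huv, iff_self_or]
          exact fun h' => absurd h'.2 hw
      · intro a w
        rw [hmem, h.preds]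
        constructor
        · rintro (⟨h1, m, h2, h3⟩ | ⟨rfl, rfl⟩)
          · exact ⟨h1, m, h2, h3.imp id fun h4 => ⟨h4.1, fun h5 => h4.2 h5.1⟩⟩
          · exact ⟨hpred, i + 1, hmin, Or.inr ⟨rfl, fun h5 => h5.2 rfl⟩⟩
        · rintro ⟨h1, m, h2, h3⟩
          by_cases heq : a = u ∧ w = v
          · exact Or.inr heq
          · refine Or.inl ⟨h1, m, h2, h3.imp id fun h4 => ⟨h4.1, fun h5 => h4.2 ⟨h5, ?_⟩⟩⟩
            simpa using heq
      · intro a b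
        simp only [hmem, Set.mem_insert_iff, h.br.props, Sym2.eq_iff]
        tauto
      · intro a b
        simp only [Set.mem_insert_iff, h.scanned, h.done_diff huv, Sym2.eq_iff]
        tauto
      · intro a b k hab hbr hk hpar' he
        rcases (h.done_diff huv a b).1 hab with hab | ⟨rfl, rfl⟩
        · exact h.scan a b k hab hbr hk hpar' he
        · exact absurd (Or.inl hpred) hbr.2
    · have hL : MV.scan M i u v L = { L with
          scanned := insert s(u, v) L.scanned
          bridges := insert s(u, v) L.bridges
          br := fun t => L.br t ∪ {e | e = s(u, v) ∧ L.KnownTenacity M u v t} } := by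
        unfold MV.scan
        rw [if_neg hsc, if_neg hml]
      obtain ⟨m, hmle, hm⟩ : ∃ m ≤ i, IsMin M v m := by
        obtain ⟨m, hm⟩ : ∃ m : ℕ, L.minLevel v = m :=
          (ENat.ne_top_iff_exists.1 (fun h' => hml (by simp [h']))).imp fun _ h => h.symm
        rw [hm] at hml
        have : ¬ i + 1 ≤ m := fun h' => hml (by exact_mod_cast h')
        exact ⟨m, by omega, ((h.minLevel v m).1 hm).1⟩
      -- The minlevel of `v` is too small for `u` to be its predecessor. If `v` were a predecessor
      -- of `u`, the edge would have been scanned from `v` at an earlier search level.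
      have hbr : IsBridge M u v := by
        refine ⟨hadj, ?_⟩
        rintro (h1 | h1) <;> obtain ⟨k, k1, k2, k3, k4⟩ := isPredecessor_iff.1 h1
        · have hp : k % 2 = 1 ↔ i % 2 = 1 := k4.symm.trans hpar
          have := k1.unique hm
          have := k2.unique hu (by omega)
          omega
        · have hp : k % 2 = 1 ↔ i % 2 = 1 := k4.symm.trans (by rw [M.adj_comm, hpar])
          have := k1.2 i hu.1
          exact hsc ((h.scanned u v).2 (Or.inl ⟨k, by omega, hadj,
            by rw [M.adj_comm, k4], Or.inr k2⟩))
      rw [hL]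
      refine ⟨h.toBlossoms.congr rfl rfl, h.small, hsub, h.minLevel_diff huv ⟨m, hmle, hm⟩,
        h.preds_diff ⟨m, hmle, hm⟩, ⟨h.br.props, ?_, ?_⟩, ?_, ?_⟩
      · rintro a b t (h1 | ⟨h1, h2⟩)
        · exact h.br.sound a b t h1
        · have h3 : ETen M u v t := h2.eTen fun v k => h.isLevel
          rcases Sym2.eq_iff.1 h1 with ⟨rfl, rfl⟩ | ⟨rfl, rfl⟩
          · exact ⟨hbr, h3⟩
          · exact ⟨hbr.symm, h3.symm⟩
      · exact fun a b t h1 h2 h3 h4 h5 h6 => Or.inl (h.br.inner a b t h1 h2 h3 h4 h5 h6)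
      · intro a b
        simp only [Set.mem_insert_iff, h.scanned, h.done_diff huv, Sym2.eq_iff]
        tauto
      · intro a b k hab hbr' hk hpar' he
        rcases (h.done_diff huv a b).1 hab with hab | ⟨rfl, rfl⟩
        · exact Or.inl (h.scan a b k hab hbr' hk hpar' he)
        · refine Or.inr ⟨rfl, (h.hasLevel hu (hu.early le_rfl)).knownTenacity
            (h.hasLevel hk he) hpar ?_⟩
          rw [hpar, hpar']

end MinInv

/-! ### Passing between MIN and MAX -/

/-- The invariant of MAX at search level `i`, with the bridges in `done` already processed. -/
structure MaxState (M : G.Subgraph) (i : ℕ) (L : Labels V) (β : V → V) (done : Set (Sym2 V)) : Prop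
    extends MaxInv M i L β where
  br : BrInv M (i + 1) L β
  scanned : ∀ u v, s(u, v) ∈ L.scanned ↔ OldScanned M (i + 1) u v
  all : ∀ u v, IsBridge M u v → ETen M u v (2 * i + 1) → s(u, v) ∈ L.br (2 * i + 1)
  merged : ∀ u v, s(u, v) ∈ done → β u = β v

theorem MinInv.maxState (hM : M.IsMatching) {i : ℕ} {L : Labels V} {β : V → V}
    (h : MinInv M i L β ∅) : MaxState M i L β ∅ := by
  have hdone : ∀ u v, Done M i ∅ u v ↔ IsLevel M u i ∧ G.Adj u v ∧ (M.Adj u v ↔ i % 2 = 1) := by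
    intro u v
    simp [Done]
  refine ⟨⟨h.toBlossoms, ?_, ?_⟩, ⟨h.br.props, h.br.sound, ?_⟩, ?_, ?_, by simp⟩
  · intro v m
    rw [h.minLevel]
    refine and_congr_right fun hm => ⟨by omega, fun hle => ?_⟩
    by_cases hmi : m ≤ i
    · exact Or.inl hmi
    · obtain rfl : m = i + 1 := by omega
      obtain ⟨u, hu⟩ := hm.exists_pred
      exact Or.inr ⟨rfl, u, (hdone u v).2 hu⟩
  · intro u v
    rw [h.preds]
    refine and_congr_right fun _ => ⟨?_, ?_⟩
    · rintro ⟨m, hm, h1⟩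
      exact ⟨m, by omega, hm⟩
    · rintro ⟨m, hmi, hm⟩
      exact ⟨m, hm, by simp; omega⟩
  · intro u v t hbr hn hten hv hodd hu
    rcases hu with hu | ⟨h1, h2, h3⟩
    · exact h.br.inner u v t hbr hn hten hv hodd (Or.inl hu)
    · by_cases hlt : ml M u < i
      · exact h.br.inner u v t hbr hn hten hv hodd (Or.inr ⟨h1, h2, hlt⟩)
      -- The only new demand concerns outer vertices of minlevel exactly `i`. They have just been
      -- scanned, and the levels of `v` were already known by `small`.
      · have hui : ml M u = i := by omega
        rw [hui] at h1 h2
        obtain ⟨a, b, ha, hb, ha2, hb2, rfl⟩ := hten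
        have ha2' : ¬ a % 2 = 1 := fun h' => hn (ha2.2 h')
        have hb2' : ¬ b % 2 = 1 := fun h' => hn (hb2.2 h')
        obtain rfl := h1.isLevel.unique ha (by omega)
        exact h.scan u v b ((hdone u v).2 ⟨ha, hbr.1, ha2⟩) hbr hb (by omega)
          (Or.inr (h.small v hv))
  · intro u v
    rw [h.scanned, hdone, hdone]
    constructor
    · rintro (⟨k, hk, h1, h2, h3⟩ | ⟨h1, h2, h3⟩ | ⟨h1, h2, h3⟩)
      · exact ⟨k, by omega, h1, h2, h3⟩
      · exact ⟨i, by omega, h2, h3, Or.inl h1⟩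
      · exact ⟨i, by omega, h2.symm, by rw [M.adj_comm, h3], Or.inr h1⟩
    · rintro ⟨k, hk, h1, h2, h3⟩
      by_cases hlt : k < i
      · exact Or.inl ⟨k, hlt, h1, h2, h3⟩
      · obtain rfl : k = i := by omega
        rcases h3 with h3 | h3
        · exact Or.inr (Or.inl ⟨h3, h1, h2⟩)
        · exact Or.inr (Or.inr ⟨h3, h1.symm, by rw [M.adj_comm, h2]⟩)
  -- For `a < b` the later end is an inner vertex of an old blossom and `BrInv.inner` applies; for
  -- `a = b = i` the bridge was scanned during this MIN.
  · have key : ∀ u v a b, IsBridge M u v → IsLevel M u a → IsLevel M v b →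
        (M.Adj u v ↔ a % 2 = 1) → (M.Adj u v ↔ b % 2 = 1) → a + b = 2 * i → a ≤ b →
        s(u, v) ∈ L.br (2 * i + 1) := by
      intro u v a b hbr ha hb ha2 hb2 hab hle
      by_cases hlt : a < b
      · obtain ⟨m, hm, hma, hmb⟩ := hbr.later_end ha hb ha2 hb2 hlt
        have hn : ¬ M.Adj u v := fun hadj => by
          have := (hbr.eq_of_matched hM hadj ha hb (ha2.1 hadj) (hb2.1 hadj)).1
          omega
        have ha2' : ¬ a % 2 = 1 := fun h' => hn (ha2.2 h')
        have hb2' : ¬ b % 2 = 1 := fun h' => hn (hb2.2 h')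
        refine h.br.inner u v _ hbr hn ⟨a, b, ha, hb, ha2, hb2, by omega⟩ ?_
          (by rw [hm.ml_eq]; omega) ?_
        · exact h.old v _ ⟨m, b, hm.isLevel, hb, hmb, rfl⟩ (by omega)
        · rcases ha.early (i := i) (by omega) with ⟨h3, -⟩ | ⟨t, h3, h4⟩
          · exact Or.inr ⟨h3.ml, by rw [h3.ml_eq]; omega, by rw [h3.ml_eq]; omega⟩
          · exact Or.inl (h.old u t h3 h4)
      · obtain rfl : a = i := by omega
        obtain rfl : b = a := by omega
        have := h.scan u v b ((hdone u v).2 ⟨ha, hbr.1, ha2⟩) hbr hb rfl (hb.early le_rfl)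
        rwa [show b + b + 1 = 2 * b + 1 by omega] at this
    intro u v hbr ⟨a, b, ha, hb, ha2, hb2, hab⟩
    rcases le_total a b with hle | hle
    · exact key u v a b hbr ha hb ha2 hb2 (by omega) hle
    · rw [Sym2.eq_swap]
      exact key v u b a hbr.symm hb ha (by rw [M.adj_comm, hb2]) (by rw [M.adj_comm, ha2])
        (by omega) hle

namespace MaxInv

variable {i : ℕ} {L : Labels V} {β : V → V}

theorem isLevel (h : MaxInv M i L β) {v : V} {k : ℕ} (hk : L.HasLevel v k) :
    IsLevel M v k ∧ ∃ m ≤ i + 1, IsMin M v m := by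
  rcases hk with hk | hk
  · have := (h.minLevel v k).1 hk
    exact ⟨this.1.isLevel, k, this.2, this.1⟩
  · by_cases hv : β v = v
    · rw [h.maxLevel_base v hv] at hk
      simp at hk
    · obtain ⟨m, a, hm, ha, -, hle, h1⟩ := h.maxLevel v hv
      rw [h1] at hk
      have hak : a = k := by exact_mod_cast hk
      have := hm.2 a ha.1
      rw [← hak]
      exact ⟨ha, m, by omega, hm⟩

theorem hasLevel (h : MaxInv M i L β) {v : V} {k : ℕ} (hk : IsLevel M v k) (hv : β v ≠ v) :
    L.HasLevel v k := by
  obtain ⟨m, a, hm, ha, hp, hle, h3⟩ := h.maxLevel v hv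
  by_cases hpar : k % 2 = m % 2
  · obtain rfl := hk.unique hm.isLevel hpar
    have := hm.2 a ha.1
    exact Or.inl ((h.minLevel v k).2 ⟨hm, by omega⟩)
  · obtain rfl := hk.unique ha (by omega)
    exact Or.inr h3

end MaxInv

theorem BridgeData.of_isBridge (hM : M.IsMatching) {i : ℕ} {x y : V} (hbr : IsBridge M x y)
    (ht : ETen M x y (2 * i + 1)) : ∃ a b, BridgeData M i x y a b ∧ IsLevel M x a ∧
      IsLevel M y b ∧ Early M i x a ∧ Early M i y b := by
  obtain ⟨a, b, ha, hb, ha2, hb2, hab⟩ := ht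
  refine ⟨a, b, ⟨hbr.1, ha2, hb2, by omega, fun hadj => ?_⟩, ha, hb,
    hbr.early ha hb ha2 hb2 (by omega),
    hbr.symm.early hb ha (by rw [M.adj_comm, hb2]) (by rw [M.adj_comm, ha2]) (by omega)⟩
  exact (hbr.eq_of_matched hM hadj ha hb (ha2.1 hadj) (hb2.1 hadj)).1

/-- A double depth first search that ends with a bottleneck preserves the invariant of MAX. -/
theorem MaxState.endDDFS (hM : M.IsMatching) {i : ℕ} {L : Labels V} {β : V → V}
    {done : Set (Sym2 V)} {x y b : V} {lx ly : ℕ} {D : DDFS V} {A B : Set V}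
    (h : MaxState M i L β done) (hxy : BridgeData M i x y lx ly)
    (hD : DInv M L β i x y lx ly (β x) (β y) D A B) (he : D.EndsAt L b) :
    ∃ β', MaxState M i (insertBridges M (D.found b) (assignPetal i (D.found b) b L)) β'
      (insert s(x, y) done) := by
  have hE := hD.endInv he
  have hP : ∀ w, w ∈ D.found b ↔ D.colour w ≠ none ∧ w ≠ b := fun w => Iff.rfl
  have hI := hE.maxInv hM h.toMaxInv hxy hP
  set P := D.found b
  set L' := assignPetal i P b L with hL'
  set β' := EndInv.newBase β D.colour b
  have hne : ∀ v, β' v ≠ v ↔ β v ≠ v ∨ v ∈ P := fun v => EndInv.newBase_ne_iff hE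
  have hprops : ∀ u v, s(u, v) ∈ L'.props ↔ u ∈ L'.preds v ∨ v ∈ L'.preds u := h.br.props
  refine ⟨β', ⟨⟨hI.toBlossoms.congr rfl rfl, hI.minLevel, hI.preds⟩, ⟨hprops, ?_, ?_⟩,
    h.scanned, fun u v h1 h2 => Or.inl (h.all u v h1 h2), ?_⟩⟩
  -- A known tenacity presupposes assigned minlevels at both ends. Were the edge a prop, it would
  -- have been recorded, as all predecessors of such vertices are.
  · have new : ∀ v w t, G.Adj v w → s(v, w) ∉ L'.props → L'.KnownTenacity M v w t →
        IsBridge M v w ∧ ETen M v w t := by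
      intro v w t hadj hnp hkn
      refine ⟨⟨hadj, ?_⟩, hkn.eTen fun v k hk => (hI.isLevel hk).1⟩
      obtain ⟨j, k, hj, hk, -⟩ := hkn
      rintro (h1 | h1)
      · exact hnp ((hprops v w).2 (Or.inl ((hI.preds v w).2 ⟨h1, (hI.isLevel hk).2⟩)))
      · exact hnp ((hprops v w).2 (Or.inr ((hI.preds w v).2 ⟨h1, (hI.isLevel hj).2⟩)))
    rintro u v t (h1 | ⟨a, c, h1, -, -, h2, h3, h4⟩)
    · exact h.br.sound u v t h1
    · rw [h1] at h3
      have h5 := new a c t h2 h3 h4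
      rcases Sym2.eq_iff.1 h1 with ⟨rfl, rfl⟩ | ⟨rfl, rfl⟩
      · exact h5
      · exact ⟨h5.1.symm, h5.2.symm⟩
  · have ins : ∀ u v t, v ∈ P → ml M v % 2 = 1 → IsBridge M u v → ETen M u v t →
        (∀ a, IsLevel M u a → (M.Adj u v ↔ a % 2 = 1) → L'.HasLevel u a) →
        s(u, v) ∈ (insertBridges M P L').br t := by
      intro u v t hv hodd hbr hten hu
      right
      have hl := hE.live v hv.1
      refine ⟨v, u, Sym2.eq_swap, hv, ⟨ml M v, Nat.odd_iff.2 hodd, ?_⟩, hbr.1.symm, ?_, ?_⟩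
      · exact h.layers.minLevel v hl
      · rw [hprops, hI.preds, hI.preds]
        rintro (h1 | h1)
        · exact hbr.2 (Or.inl h1.1)
        · exact hbr.2 (Or.inr h1.1)
      · obtain ⟨a, b, ha, hb, ha2, hb2, rfl⟩ := hten
        have := (hI.hasLevel hb ((hne v).2 (Or.inr hv))).knownTenacity (M := M) (hu a ha ha2)
          (by rw [M.adj_comm, hb2]) (by rw [M.adj_comm, ha2])
        rwa [show a + b + 1 = b + a + 1 by omega]
    intro u v t hbr hn hten hv hodd hu
    -- Either an inner end has just been found, and the bridge is inserted now, or the conditions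
    -- held before this search: an outer `u` just found has minlevel less than `i + 1`.
    by_cases hvP : v ∈ P
    · refine ins u v t hvP hodd hbr hten fun a ha ha2 => ?_
      rcases hu with hu | ⟨h1, h2, h3⟩
      · exact hI.hasLevel ha hu
      · have ha2' : ¬ a % 2 = 1 := fun h' => hn (ha2.2 h')
        obtain rfl := h1.isLevel.unique ha (by omega)
        exact Or.inl ((hI.minLevel u _).2 ⟨h1, by omega⟩)
    · have hv' := ((hne v).1 hv).resolve_right hvP
      by_cases huP : u ∈ P
      · have hl := hE.live u huP.1
        rcases Nat.mod_two_eq_zero_or_one (ml M u) with h0 | h0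
        · exact Or.inl (h.br.inner u v t hbr hn hten hv' hodd
            (Or.inr ⟨hl.2.1, h0, by have := hl.2.2; omega⟩))
        · rw [Sym2.eq_swap]
          exact ins v u t huP h0 hbr.symm hten.symm fun a ha _ => hI.hasLevel ha hv
      · refine Or.inl (h.br.inner u v t hbr hn hten hv' hodd ?_)
        rcases hu with hu | hu
        · exact Or.inl (((hne u).1 hu).resolve_right huP)
        · exact Or.inr hu
  · rintro u v (h1 | h1)
    · have hx : β' x = b := EndInv.newBase_of_vis hE.visx
      have hy : β' y = b := EndInv.newBase_of_vis hE.visy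
      rcases Sym2.eq_iff.1 h1 with ⟨rfl, rfl⟩ | ⟨rfl, rfl⟩
      · rw [hx, hy]
      · rw [hx, hy]
    · exact EndInv.newBase_congr (h.merged u v h1)

/-- When all bridges of tenacity `2 i + 1` have been processed, the certificate is complete. -/
theorem MaxState.cert (hM : M.IsMatching) {i : ℕ} {L : Labels V} {β : V → V}
    {done : Set (Sym2 V)} (h : MaxState M i L β done) (hd : L.br (2 * i + 1) ⊆ done) :
    Cert M i β :=
  h.toMaxInv.cert hM fun u v h1 h2 => h.merged u v (hd (h.all u v h1 h2))

theorem MaxState.nextLevel (hM : M.IsMatching) {i : ℕ} {L : Labels V} {β : V → V}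
    {done : Set (Sym2 V)} (h : MaxState M i L β done) (hd : L.br (2 * i + 1) ⊆ done) :
    MinInv M (i + 1) L β (minQueue M (i + 1) L) := by
  have hc := h.cert hM hd
  -- If `i + 1` is not the minlevel of `v`, its tenacity is at most `i + (i + 1)`; the certificate
  -- then puts `v` in a blossom, so its maxlevel is assigned. Thus the next queue is complete.
  have hlev : ∀ v, L.HasLevel v (i + 1) ↔ IsLevel M v (i + 1) := by
    refine fun v => ⟨fun hv => (h.isLevel hv).1, fun hv => ?_⟩
    obtain ⟨m, hm, rfl | ⟨h1, h2, h3⟩⟩ := hv.exists_isMin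
    · exact Or.inl ((h.minLevel v _).2 ⟨hm, le_rfl⟩)
    · exact h.hasLevel hv ((hc.ten_iff v).2 ⟨_, h3, by omega⟩)
  have hq : ∀ u v, (u, v) ∈ minQueue M (i + 1) L ↔
      IsLevel M u (i + 1) ∧ G.Adj u v ∧ (M.Adj u v ↔ (i + 1) % 2 = 1) := by
    intro u v
    simp only [minQueue, Set.mem_ofPred_eq, hlev, Nat.odd_iff]
  have hdone : ∀ u v, ¬ Done M (i + 1) (minQueue M (i + 1) L) u v := by
    rintro u v ⟨h1, h2, h3, h4⟩
    exact h4 ((hq u v).2 ⟨h1, h2, h3⟩)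
  refine ⟨{ h.toBlossoms with
      prev := fun j hj => ?_
      maxLevel := fun v hv => ?_
      old := fun v t ht hle => (hc.ten_iff v).2 ⟨t, ht, by omega⟩
      old_edge := fun u v t h1 h2 h3 h4 => hc.edge u v t h1 h2 h3 (by omega) },
    fun v hv => ?_, fun u v => (hq u v).1, fun v m => ?_, fun u v => ?_, h.br, fun u v => ?_,
    fun u v k hd => absurd hd (hdone u v)⟩
  · by_cases hji : j < i
    · exact h.prev j hji
    · obtain rfl : j = i := by omega
      exact ⟨β, hc⟩
  · obtain ⟨m, a, h1, h2, h3, h4, h5⟩ := h.maxLevel v hv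
    exact ⟨m, a, h1, h2, h3, by omega, h5⟩
  · obtain ⟨t, ht, hle⟩ := (hc.ten_iff v).1 hv
    exact ⟨t, ht, by omega⟩
  · rw [h.minLevel]
    refine and_congr_right fun hm => ⟨Or.inl, ?_⟩
    rintro (h1 | ⟨-, u, h1⟩)
    · exact h1
    · exact absurd h1 (hdone u v)
  · rw [h.preds]
    refine and_congr_right fun hp => ⟨?_, ?_⟩
    · rintro ⟨m, h1, h2⟩; exact ⟨m, h2, Or.inl h1⟩
    · rintro ⟨m, h1, h2 | ⟨rfl, h2⟩⟩
      · exact ⟨m, h2, h1⟩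
      · obtain ⟨k, k1, k2, k3, k4⟩ := isPredecessor_iff.1 hp
        have := k1.unique h1
        obtain rfl : k = i + 1 := by omega
        exact absurd ((hq u v).2 ⟨k2, k3, k4⟩) h2
  · rw [h.scanned]
    refine ⟨Or.inl, ?_⟩
    rintro (h1 | h1 | h1)
    · exact h1
    · exact absurd h1 (hdone _ _)
    · exact absurd h1 (hdone _ _)

/-! ### The invariant of the algorithm -/

theorem minInv_init : MinInv M 0 (initLabels M) id (minQueue M 0 (initLabels M)) := by
  classical
  have hmin : ∀ v (m : ℕ), (initLabels M).minLevel v = m ↔ Unmatched M v ∧ m = 0 := by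
    intro v m
    change (if Unmatched M v then 0 else ⊤) = (m : ℕ∞) ↔ _
    split_ifs with h
    · simp only [h, true_and]
      constructor
      · intro h'; exact_mod_cast h'.symm
      · rintro rfl; rfl
    · simp [h]
  have hzero : ∀ v, Unmatched M v ↔ IsMin M v 0 := fun v =>
    ⟨fun h => ⟨h.reach_zero, fun _ _ => Nat.zero_le _⟩, fun h => h.1.unmatched⟩
  have hlev : ∀ v, (initLabels M).HasLevel v 0 ↔ IsLevel M v 0 := by
    intro v
    have h1 : (initLabels M).HasLevel v 0 ↔ Unmatched M v := by
      unfold Labels.HasLevel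
      rw [hmin]
      change _ ∨ (⊤ : ℕ∞) = ((0 : ℕ) : ℕ∞) ↔ _
      simp
    rw [h1, hzero]
    exact ⟨fun h => h.isLevel, fun h => ⟨h.1, fun _ _ => Nat.zero_le _⟩⟩
  have hq : ∀ u v, (u, v) ∈ minQueue M 0 (initLabels M) ↔
      IsLevel M u 0 ∧ G.Adj u v ∧ (M.Adj u v ↔ 0 % 2 = 1) := by
    intro u v
    simp only [minQueue, Set.mem_ofPred_eq, hlev, Nat.odd_iff]
  have hdone : ∀ u v, ¬ Done M 0 (minQueue M 0 (initLabels M)) u v := by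
    rintro u v ⟨h1, h2, h3, h4⟩
    exact h4 ((hq u v).2 ⟨h1, h2, h3⟩)
  have hid : ∀ v : V, ¬ id v ≠ v := fun v h => h rfl
  refine ⟨⟨by simp, fun _ _ => rfl, fun v h => absurd h (hid v), fun v => .self v rfl,
      fun v h => absurd h (hid v), fun v h => absurd h (hid v), fun v _ h => absurd h (hid v),
      fun _ _ _ h => by omega, fun _ _ _ _ _ _ h => by omega, fun _ v h => absurd h (hid v),
      fun v _ h => absurd h (hid v)⟩, fun v h => absurd h (hid v), fun u v => (hq u v).1, ?_, ?_,
    ⟨?_, ?_, fun _ v _ _ _ _ h => absurd h (hid v)⟩, ?_, fun u v k hd => absurd hd (hdone u v)⟩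
  · intro v m
    rw [hmin, hzero]
    constructor
    · rintro ⟨h, rfl⟩; exact ⟨h, Or.inl le_rfl⟩
    · rintro ⟨h, h1 | ⟨-, u, h1⟩⟩
      · obtain rfl : m = 0 := by omega
        exact ⟨h, rfl⟩
      · exact absurd h1 (hdone u v)
  · intro u v
    refine ⟨fun h => absurd h (Set.notMem_empty u), ?_⟩
    rintro ⟨hp, m, hm, h⟩
    obtain ⟨k, k1, k2, k3, k4⟩ := isPredecessor_iff.1 hp
    have := k1.unique hm
    rcases h with h | ⟨rfl, h⟩
    · omega
    · obtain rfl : k = 0 := by omega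
      exact absurd ((hq u v).2 ⟨k2, k3, k4⟩) h
  · intro u v
    refine iff_of_false (Set.notMem_empty _) ?_
    rintro (h | h) <;> exact Set.notMem_empty _ h
  · intro u v t h
    exact absurd h (Set.notMem_empty _)
  · intro u v
    refine ⟨fun h => absurd h (Set.notMem_empty _), ?_⟩
    rintro (⟨k, hk, -⟩ | h | h)
    · omega
    · exact absurd h (hdone _ _)
    · exact absurd h (hdone _ _)

/-- The invariant of the algorithm. -/
def Inv (M : G.Subgraph) (s : State V) : Prop :=
  match s.control with
  | .min todo => ∃ β, MinInv M s.level s.labels β todo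
  | .max done => ∃ β, MaxState M s.level s.labels β done
  | .ddfs done D => ∃ β done' x y lx ly A B, MaxState M s.level s.labels β done' ∧
      done = insert s(x, y) done' ∧ BridgeData M s.level x y lx ly ∧
      DInv M s.labels β s.level x y lx ly (β x) (β y) D A B
  | .augment => ∃ β done, MaxState M s.level s.labels β done

theorem Inv.step (hM : M.IsMatching) {s s' : State V} (h : Inv M s) (hs : Step M s s') :
    Inv M s' := by
  cases hs with
  | scan i L todo u v huv =>
    obtain ⟨β, h⟩ := h
    exact ⟨β, h.scan_step hM huv⟩
  | startMax i L =>
    obtain ⟨β, h⟩ := h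
    exact ⟨β, h.maxState hM⟩
  | abortDDFS i L done x y b hxy hd hx hy =>
    obtain ⟨β, h⟩ := h
    refine ⟨β, { h with merged := ?_ }⟩
    rintro u v (h1 | h1)
    · have : β x = β y := by rw [(h.star x).unique hx, (h.star y).unique hy]
      rcases Sym2.eq_iff.1 h1 with ⟨rfl, rfl⟩ | ⟨rfl, rfl⟩
      · exact this
      · exact this.symm
    · exact h.merged u v h1
  | startDDFS i L done x y r g hxy hd hx hy hrg =>
    obtain ⟨β, h⟩ := h
    obtain ⟨h1, h2⟩ := h.br.sound x y _ hxy
    obtain ⟨a, b, hbd, ha, hb, hea, heb⟩ := BridgeData.of_isBridge hM h1 h2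
    obtain rfl := (h.star x).unique hx
    obtain rfl := (h.star y).unique hy
    obtain ⟨l1, p1⟩ := h.live_base ha hea
    obtain ⟨l2, p2⟩ := h.live_base hb heb
    exact ⟨β, done, x, y, a, b, _, _, h, rfl, hbd, DInv.start l1 l2 hrg p1 p2⟩
  | stepDDFS i L done D D' hD =>
    obtain ⟨β, done', x, y, lx, ly, A, B, h1, h2, h3, h4⟩ := h
    obtain ⟨A', B', h5⟩ := h4.step h1.layers hD
    exact ⟨β, done', x, y, lx, ly, A', B', h1, h2, h3, h5⟩
  | endDDFS i L done D b hb =>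
    obtain ⟨β, done', x, y, lx, ly, A, B, h1, h2, h3, h4⟩ := h
    subst h2
    exact h1.endDDFS hM h3 h4 hb
  | foundPaths i L done D hb =>
    obtain ⟨β, done', x, y, lx, ly, A, B, h1, h2, h3, h4⟩ := h
    exact ⟨β, done', h1⟩
  | nextLevel i L done hd =>
    obtain ⟨β, h⟩ := h
    exact ⟨β, h.nextLevel hM hd⟩

theorem Reachable.inv (hM : M.IsMatching) {s : State V} (h : Reachable M s) : Inv M s := by
  induction h with
  | refl => exact ⟨id, minInv_init⟩
  | tail _ hs ih => exact ih.step hM hs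

/-- The part of the invariant common to all control states, including `augment`; it is what makes
assigned levels final. -/
theorem Inv.labels {s : State V} (h : Inv M s) :
    ∃ β, Blossoms M s.level s.labels β ∧
      ∀ v m, IsMin M v m → m ≤ s.level → s.labels.minLevel v = m := by
  have key : ∀ {i L β done}, MaxState M i L β done → ∃ β, Blossoms M i L β ∧
      ∀ v m, IsMin M v m → m ≤ i → L.minLevel v = m := fun h =>
    ⟨_, h.toBlossoms, fun v m hm hle => (h.minLevel v m).2 ⟨hm, by omega⟩⟩
  obtain ⟨i, L, c⟩ := s
  cases c with
  | min todo =>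
    obtain ⟨β, h⟩ := h
    exact ⟨β, h.toBlossoms, fun v m hm hle => (h.minLevel v m).2 ⟨hm, Or.inl hle⟩⟩
  | max done =>
    obtain ⟨β, h⟩ := h
    exact key h
  | ddfs done D =>
    obtain ⟨β, done', x, y, lx, ly, A, B, h1, -⟩ := h
    exact key h1
  | augment =>
    obtain ⟨β, done, h⟩ := h
    exact key h

theorem Step.level_le {s s' : State V} (h : Step M s s') : s.level ≤ s'.level := by
  cases h <;> simp

theorem level_le_of_reflTransGen {s s' : State V} (h : Relation.ReflTransGen (Step M) s s') :
    s.level ≤ s'.level := by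
  induction h with
  | refl => exact le_rfl
  | tail _ hs ih => exact ih.trans hs.level_le

/-! ### Correctness of the labels -/

theorem minlevel_le_iff {v : V} {n : ℕ} : minlevel M v ≤ n ↔ ∃ m ≤ n, IsMin M v m := by
  constructor
  · intro h
    obtain ⟨m, hm⟩ : ∃ m : ℕ, minlevel M v = m :=
      (ENat.ne_top_iff_exists.1 (fun h' => by simp [h'] at h)).imp fun _ h => h.symm
    rw [hm] at h
    exact ⟨m, by exact_mod_cast h, minlevel_eq_iff.1 hm⟩
  · rintro ⟨m, hmn, hm⟩
    rw [minlevel_eq_iff.2 hm]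
    exact_mod_cast hmn

theorem tenacity_le_iff {v : V} {n : ℕ} : tenacity M v ≤ n ↔ ∃ t, Ten M v t ∧ t ≤ n := by
  constructor
  · intro h
    obtain ⟨m, hm⟩ : ∃ m : ℕ, tenacity M v = m :=
      (ENat.ne_top_iff_exists.1 (fun h' => by simp [h'] at h)).imp fun _ h => h.symm
    rw [hm] at h
    exact ⟨m, tenacity_eq_iff.1 hm, by exact_mod_cast h⟩
  · rintro ⟨m, hm, hmn⟩
    rw [tenacity_eq_iff.2 hm]
    exact_mod_cast hmn

theorem MaxState.minCorrect {i : ℕ} {L : Labels V} {β : V → V} {done : Set (Sym2 V)}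
    (h : MaxState M i L β done) : MinCorrect M i L := by
  have hcast : (i + 1 : ℕ∞) = ((i + 1 : ℕ) : ℕ∞) := by norm_cast
  have hpr : ∀ u v, u ∈ L.preds v ↔ IsPredecessor M u v ∧ minlevel M v ≤ (i + 1 : ℕ∞) := by
    intro u v
    rw [h.preds, hcast, minlevel_le_iff]
  refine ⟨fun v => ?_, hpr, fun u v => ?_⟩
  · rw [hcast]
    split_ifs with hle
    · obtain ⟨m, hmi, hm⟩ := minlevel_le_iff.1 hle
      rw [minlevel_eq_iff.2 hm]
      exact (h.minLevel v m).2 ⟨hm, hmi⟩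
    · by_contra hne
      obtain ⟨m, hm⟩ := ENat.ne_top_iff_exists.1 hne
      have := (h.minLevel v m).1 hm.symm
      exact hle (minlevel_le_iff.2 ⟨m, this.2, this.1⟩)
  · rw [h.br.props, hpr, hpr]

theorem MaxState.bridgesCollected {i : ℕ} {L : Labels V} {β : V → V} {done : Set (Sym2 V)}
    (h : MaxState M i L β done) : BridgesCollected M i L := by
  intro u v
  have hcast : (2 * i + 1 : ℕ∞) = ((2 * i + 1 : ℕ) : ℕ∞) := by norm_cast
  rw [hcast, edgeTenacity_eq_iff]
  exact ⟨h.br.sound u v _, fun h' => h.all u v h'.1 h'.2⟩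

theorem Blossoms.maxLevel_eq {i : ℕ} {L : Labels V} {β : V → V} (h : Blossoms M i L β) {v : V}
    (hv : β v ≠ v) : L.maxLevel v = maxlevel M v := by
  obtain ⟨m, a, hm, ha, hp, -, h1⟩ := h.maxLevel v hv
  rw [h1, maxlevel_eq hm ha hp]

theorem MaxState.maxCorrect (hM : M.IsMatching) {i : ℕ} {L : Labels V} {β : V → V}
    {done : Set (Sym2 V)} (h : MaxState M i L β done) (hd : L.br (2 * i + 1) ⊆ done) :
    MaxCorrect M i L := by
  intro v
  have hcast : (2 * i + 1 : ℕ∞) = ((2 * i + 1 : ℕ) : ℕ∞) := by norm_cast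
  have hc := (h.cert hM hd).ten_iff v
  rw [hcast]
  split_ifs with hle
  · exact h.maxLevel_eq (hc.2 (tenacity_le_iff.1 hle))
  · refine h.maxLevel_base v ?_
    by_contra hv
    exact hle (tenacity_le_iff.2 (hc.1 hv))

/-! ### Termination -/

/-- Remembering reachability makes the invariant available at whatever state first satisfies `P`. -/
theorem Inevitably.and_reachable {P : State V → Prop} {s : State V} (h : Inevitably M P s)
    (hs : Reachable M s) : Inevitably M (fun s => P s ∧ Reachable M s) s := by
  induction h with
  | now s h => exact .now s ⟨h, hs⟩
  | later s hex _ ih => exact .later s hex fun s' hs' => ih s' hs' (hs.tail hs')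

theorem Inevitably.bind {P Q : State V → Prop} {s : State V} (h : Inevitably M P s)
    (hPQ : ∀ s, P s → Inevitably M Q s) : Inevitably M Q s := by
  induction h with
  | now s h => exact hPQ s h
  | later s hex _ ih => exact .later s hex ih

/-- The rank of the modes in the order in which they follow each other without a new vertex being
visited. -/
def Mode.rank : Mode → ℕ
  | .normal => 2
  | .redSeeks => 1
  | .greenSeeks => 0

/-- How far the search that is backtracking is below the level `i + 1`. -/
noncomputable def gap (M : G.Subgraph) (i : ℕ) (D : DDFS V) : ℕ :=
  match D.mode with
  | .normal => 0
  | .redSeeks => i + 1 - ml M D.cR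
  | .greenSeeks => i + 1 - ml M D.cG

/-- A measure that decreases in every step of a double depth first search. -/
noncomputable def searchMeasure (M : G.Subgraph) (i : ℕ) (D : DDFS V) : ℕ ×ₗ ℕ ×ₗ ℕ :=
  toLex ({w | D.colour w = none}.ncard, toLex (D.mode.rank, gap M i D))

theorem ncard_unvisited_lt [Finite V] [DecidableEq V] {colour : V → Option Colour} {u : V}
    (hu : colour u = none) (c : Colour) :
    {w | Function.update colour u (some c) w = none}.ncard < {w | colour w = none}.ncard := by
  refine Set.ncard_lt_ncard ⟨fun w hw => ?_, fun h => ?_⟩ (Set.toFinite _)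
  · by_cases h : w = u
    · subst h; exact hu
    · have hw : Function.update colour u (some c) w = none := hw
      rwa [Function.update_of_ne h] at hw
  · have : Function.update colour u (some c) u = none := h hu
    simp at this

theorem ncard_unvisited_eq [DecidableEq V] {colour : V → Option Colour} {u : V}
    (hu : colour u ≠ none) (c : Colour) :
    {w | Function.update colour u (some c) w = none}.ncard = {w | colour w = none}.ncard := by
  congr 1
  ext w
  change Function.update colour u (some c) w = none ↔ colour w = none
  by_cases h : w = u
  · subst h; simp [hu]
  · rw [Function.update_of_ne h]

/-- Visiting a vertex lowers the first component. A meeting or a failure of the red tree lowers the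
rank of the mode. Backtracking moves to a higher layer and lowers the gap. -/
theorem DInv.searchMeasure_lt [Finite V] {L : Labels V} {β : V → V} {i lx ly : ℕ} {x y r g : V}
    {D D' : DDFS V} {A B : Set V} (hD : DInv M L β i x y lx ly r g D A B) (hs : D.Step L D') :
    searchMeasure M i D' < searchMeasure M i D := by
  classical
  have hcR := hD.visR _ hD.stackR.mem
  have hcG := hD.visG _ hD.stackG.mem
  unfold searchMeasure
  rw [Prod.Lex.toLex_lt_toLex, Prod.Lex.toLex_lt_toLex]
  cases hs with
  | redMove u hm hl he hu => exact Or.inl (ncard_unvisited_lt hu _)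
  | greenMove u hm hl he hu => exact Or.inl (ncard_unvisited_lt hu _)
  | redMeets hm hl he =>
    exact Or.inr ⟨ncard_unvisited_eq hcG _, Or.inl (by rw [hm]; simp [Mode.rank])⟩
  | greenMeets hm hl he =>
    exact Or.inr ⟨ncard_unvisited_eq hcR _, Or.inl (by rw [hm]; simp [Mode.rank])⟩
  | redSeek u hm hc he hu => exact Or.inl (ncard_unvisited_lt hu _)
  | redBacktrack p hm hs hb hx =>
    obtain ⟨p', A', hp1, hp2, hp3, rfl⟩ := hD.stackR.pop hb
    obtain rfl : p' = p := by rw [hp1] at hx; exact Option.some.inj hx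
    have hle := (hD.live p' (hD.visR _ (Or.inr hp3.mem))).2.2
    refine Or.inr ⟨rfl, Or.inr ⟨rfl, ?_⟩⟩
    simp only [gap, hm]
    omega
  | redFail hm hs hb =>
    exact Or.inr ⟨ncard_unvisited_eq hcG _, Or.inl (by rw [hm]; simp [Mode.rank])⟩
  | greenSeek u hm hc he hu => exact Or.inl (ncard_unvisited_lt hu _)
  | greenBacktrack p hm hs hb hx =>
    obtain ⟨p', B', hp1, hp2, hp3, rfl⟩ := hD.stackG.pop hb
    obtain rfl : p' = p := by rw [hp1] at hx; exact Option.some.inj hx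
    have hle := (hD.live p' (hD.visG _ (Or.inr hp3.mem))).2.2
    refine Or.inr ⟨rfl, Or.inr ⟨rfl, ?_⟩⟩
    simp only [gap, hm]
    omega

/-- Below `l_m` the search cannot find disjoint paths, so it must return to MAX; `hnext` takes over
from there. -/
theorem inevitably_of_ddfs [Finite V] (hM : M.IsMatching) {i : ℕ}
    (hi : ((2 * i + 1 : ℕ) : ℕ∞) < minAugLength M) {P : State V → Prop} {L : Labels V}
    {done : Set (Sym2 V)} {D : DDFS V} (h : Inv M ⟨i, L, .ddfs done D⟩)
    (hnext : ∀ L', Inv M ⟨i, L', .max done⟩ → Inevitably M P ⟨i, L', .max done⟩) :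
    Inevitably M P ⟨i, L, .ddfs done D⟩ := by
  induction hn : searchMeasure M i D using WellFoundedLT.induction generalizing D with
  | _ n ih =>
    have h' := h
    obtain ⟨β, done', x, y, lx, ly, A, B, h1, h2, h3, h4⟩ := h'
    have hno : ¬ D.EndsDisjoint L := fun he =>
      absurd (h4.minAugLength_le h1.layers h3 he) (not_le.2 hi)
    refine .later _ ?_ ?_
    · rcases h4.progress h1.layers with ⟨D', hD'⟩ | ⟨b, hb⟩ | hb
      · exact ⟨_, .stepDDFS i L done D D' hD'⟩
      · exact ⟨_, .endDDFS i L done D b hb⟩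
      · exact absurd hb hno
    · intro s' hs
      have hI := h.step hM hs
      cases hs with
      | stepDDFS _ _ _ _ D' hD' =>
        exact ih _ (hn ▸ h4.searchMeasure_lt hD') hI rfl
      | endDDFS _ _ _ _ b hb => exact hnext _ hI
      | foundPaths _ _ _ _ hb => exact absurd hb hno

/-- Every aborted or completed call leaves one more of the finitely many edges in `done`. -/
theorem inevitably_endOfMax [Finite V] (hM : M.IsMatching) {i : ℕ}
    (hi : ((2 * i + 1 : ℕ) : ℕ∞) < minAugLength M) {L : Labels V} {done : Set (Sym2 V)}
    (h : Inv M ⟨i, L, .max done⟩) : Inevitably M (EndOfMax i) ⟨i, L, .max done⟩ := by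
  induction hn : (doneᶜ).ncard using Nat.strong_induction_on generalizing L done with
  | _ n ih =>
    have hlt : ∀ e : Sym2 V, e ∉ done → ((insert e done)ᶜ).ncard < n := by
      intro e he
      rw [← hn]
      refine Set.ncard_lt_ncard ⟨fun w hw hw' => hw (Or.inr hw'), fun h' => ?_⟩ (Set.toFinite _)
      exact h' he (Or.inl rfl)
    by_cases hd : L.br (2 * i + 1) ⊆ done
    · exact .now _ ⟨rfl, done, rfl, hd⟩
    · refine .later _ ?_ ?_
      · obtain ⟨e, he, hed⟩ := Set.not_subset.1 hd
        obtain ⟨β, h'⟩ := h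
        induction e with
        | _ x y =>
          by_cases hxy : β x = β y
          · exact ⟨_, .abortDDFS i L done x y (β x) he hed (h'.star x) (hxy ▸ h'.star y)⟩
          · exact ⟨_, .startDDFS i L done x y _ _ he hed (h'.star x) (h'.star y) hxy⟩
      · intro s' hs
        have hI := h.step hM hs
        cases hs with
        | abortDDFS _ _ _ x y b hxy hxd hx hy => exact ih _ (hlt _ hxd) hI rfl
        | startDDFS _ _ _ x y r g hxy hxd hx hy hrg =>
          exact inevitably_of_ddfs hM hi hI fun L' hL' => ih _ (hlt _ hxd) hL' rfl
        | nextLevel _ _ _ hd' => exact absurd hd' hd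

theorem inevitably_endOfMin [Finite V] {i : ℕ} {L : Labels V} {todo : Set (V × V)} :
    Inevitably M (EndOfMin i) ⟨i, L, .min todo⟩ := by
  induction hn : todo.ncard using Nat.strong_induction_on generalizing L todo with
  | _ n ih =>
    rcases todo.eq_empty_or_nonempty with rfl | ⟨⟨u, v⟩, huv⟩
    · exact .now _ ⟨rfl, rfl⟩
    · refine .later _ ⟨_, .scan i L todo u v huv⟩ fun s' hs => ?_
      cases hs with
      | scan _ _ _ a b hab =>
        refine ih _ ?_ rfl
        rw [← hn]
        exact Set.ncard_sdiff_singleton_lt_of_mem hab (Set.toFinite _)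
      | startMax => exact absurd huv (Set.notMem_empty _)

/-- The bound by `l_m` is needed only to get through MAX. Since reaching MIN at level `i + 1`
requires only MAX at level `i`, the weak inequality suffices there. -/
theorem inevitably_from_init [Finite V] (hM : M.IsMatching) (i : ℕ) :
    (((2 * i + 1 : ℕ) : ℕ∞) ≤ minAugLength M → Inevitably M (EndOfMin i) (init M)) ∧
    (((2 * i + 1 : ℕ) : ℕ∞) < minAugLength M → Inevitably M (EndOfMax i) (init M)) := by
  have hmax : ∀ i, ((2 * i + 1 : ℕ) : ℕ∞) < minAugLength M →
      Inevitably M (EndOfMin i) (init M) → Inevitably M (EndOfMax i) (init M) := by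
    intro i hi h
    refine (h.and_reachable .refl).bind ?_
    rintro ⟨j, L, c⟩ ⟨⟨rfl, hc⟩, hr⟩
    obtain rfl : c = .min ∅ := hc
    refine .later _ ⟨_, .startMax j L⟩ fun s' hs => ?_
    have hI := (hr.inv hM).step hM hs
    cases hs with
    | scan _ _ _ a b hab => exact absurd hab (Set.notMem_empty _)
    | startMax => exact inevitably_endOfMax hM hi hI
  induction i with
  | zero => exact ⟨fun _ => inevitably_endOfMin, fun hi => hmax 0 hi inevitably_endOfMin⟩
  | succ i ih =>
    have hmin : ((2 * (i + 1) + 1 : ℕ) : ℕ∞) ≤ minAugLength M →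
        Inevitably M (EndOfMin (i + 1)) (init M) := by
      intro hi
      refine (ih.2 (lt_of_lt_of_le (by exact_mod_cast (by omega)) hi)).bind ?_
      rintro ⟨j, L, c⟩ ⟨rfl, done, hc, hd⟩
      obtain rfl : c = .max done := hc
      refine .later _ ⟨_, .nextLevel j L done hd⟩ fun s' hs => ?_
      cases hs with
      | abortDDFS _ _ _ x y b hxy hxd hx hy => exact absurd (hd hxy) hxd
      | startDDFS _ _ _ x y r g hxy hxd hx hy hrg => exact absurd (hd hxy) hxd
      | nextLevel => exact inevitably_endOfMin
    exact ⟨hmin, fun hi => hmax _ hi (hmin hi.le)⟩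

/-- The labels of a vertex of tenacity at most `2 i + 1` are final at the end of MAX. -/
theorem EndOfMax.labels_final (hM : M.IsMatching) {i : ℕ} {s s' : State V} {v : V}
    (hs : EndOfMax i s) (hr : Reachable M s) (hss' : Relation.ReflTransGen (Step M) s s')
    {t : ℕ} (ht : Ten M v t) (hti : t ≤ 2 * i + 1) :
    s'.labels.minLevel v = minlevel M v ∧ s'.labels.maxLevel v = maxlevel M v := by
  have hmin : ∃ m ≤ i, IsMin M v m := by
    obtain ⟨a, b, ha, hb, hab, rfl⟩ := ht
    obtain ⟨m, hm, hma⟩ := ha.1.exists_isMin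
    have := hm.2 b hb.1
    exact ⟨m, by omega, hm⟩
  obtain ⟨m, hmi, hm⟩ := hmin
  rw [minlevel_eq_iff.2 hm]
  obtain ⟨j, L, c⟩ := s
  obtain ⟨rfl, done, hc, hd⟩ := hs
  obtain rfl : c = .max done := hc
  rcases hss'.cases_head with rfl | ⟨s₁, h1, h2⟩
  · obtain ⟨β, h⟩ := hr.inv hM
    exact ⟨(h.minLevel v m).2 ⟨hm, Nat.le_succ_of_le hmi⟩,
      h.maxLevel_eq (((h.cert hM hd).ten_iff v).2 ⟨t, ht, hti⟩)⟩
  -- With all bridges processed, the only possible step raises the search level. From then on the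
  -- tenacity `t ≤ 2 j + 1` counts as old.
  · have hlev : j + 1 ≤ s'.level := by
      have := level_le_of_reflTransGen h2
      cases h1 with
      | abortDDFS _ _ _ x y b hxy hxd hx hy => exact absurd (hd hxy) hxd
      | startDDFS _ _ _ x y r g hxy hxd hx hy hrg => exact absurd (hd hxy) hxd
      | nextLevel => exact this
    obtain ⟨β, hb, hml⟩ := (Reachable.inv hM (hr.trans hss')).labels
    have hmi : m ≤ j := hmi
    have hti : t ≤ 2 * j + 1 := hti
    exact ⟨hml v m hm (by omega), hb.maxLevel_eq (hb.old v t ht (by omega))⟩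

end MV

/-! ### The theorem -/

theorem mainTheorem2 {V : Type*} [Finite V] (G : SimpleGraph V) (M : G.Subgraph)
    (hM : M.IsMatching) :
    (∀ v : V, MV.tenacity M v < MV.minAugLength M →
      MV.Inevitably M
        (fun s => ∀ s', Relation.ReflTransGen (MV.Step M) s s' →
          s'.labels.minLevel v = MV.minlevel M v ∧ s'.labels.maxLevel v = MV.maxlevel M v)
        (MV.init M)) ∧
    (∀ i : ℕ, (2 * i + 1 : ℕ∞) ≤ MV.minAugLength M →
      MV.Inevitably M (MV.EndOfMin i) (MV.init M) ∧
      ∀ s, MV.Reachable M s → MV.EndOfMin i s →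
        MV.MinCorrect M i s.labels ∧ MV.BridgesCollected M i s.labels) ∧
    (∀ i : ℕ, (2 * i + 1 : ℕ∞) < MV.minAugLength M →
      MV.Inevitably M (MV.EndOfMax i) (MV.init M) ∧
      ∀ s, MV.Reachable M s → MV.EndOfMax i s → MV.MaxCorrect M i s.labels) := by
  have hcast : ∀ i : ℕ, (2 * i + 1 : ℕ∞) = ((2 * i + 1 : ℕ) : ℕ∞) := fun i => by norm_cast
  refine ⟨fun v hv => ?_, fun i hi => ⟨?_, ?_⟩, fun i hi => ⟨?_, ?_⟩⟩
  · obtain ⟨t, ht⟩ : ∃ t : ℕ, MV.tenacity M v = t :=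
      (ENat.ne_top_iff_exists.1 hv.ne_top).imp fun _ h => h.symm
    have hten := MV.tenacity_eq_iff.1 ht
    have hodd := hten.odd
    -- Finite tenacities are odd, so the labels of `v` are final at the end of MAX at search level
    -- `i`.
    obtain ⟨i, rfl⟩ : ∃ i, t = 2 * i + 1 := ⟨t / 2, by omega⟩
    rw [ht] at hv
    refine (((MV.inevitably_from_init hM i).2 hv).and_reachable .refl).bind fun s hs => ?_
    exact .now s fun s' hss' => hs.1.labels_final hM hs.2 hss' hten le_rfl
  · exact (MV.inevitably_from_init hM i).1 (hcast i ▸ hi)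
  · rintro ⟨j, L, c⟩ hr ⟨rfl, hc⟩
    obtain rfl : c = .min ∅ := hc
    obtain ⟨β, h⟩ := hr.inv hM
    have h' := h.maxState hM
    exact ⟨h'.minCorrect, h'.bridgesCollected⟩
  · exact (MV.inevitably_from_init hM i).2 (hcast i ▸ hi)
  · rintro ⟨j, L, c⟩ hr ⟨rfl, done, hc, hd⟩
    obtain rfl : c = .max done := hc
    obtain ⟨β, h⟩ := hr.inv hM
    exact h.maxCorrect hM hd
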